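/- Let $A$ be a simple separable infinite dimensional stably finite unital C*-algebra, let $B \subseteq A$ be a large (unital C*-)subalgebra, and let $m \ge 0$ be an integer. Then $B$ has $m$-comparison if and only if $A$ has $m$-comparison. Here the terms mean the following. * For a C*-algebra $E$ and $a, b \in E_+$, write $a \precsim_E b$ if there is a sequence $(v_n)$ in $E$ with $\lim_{n} v_n b v_n^* = a$. * $A$ is *stably finite* if for every $n$ every $v \in M_n(A)$ with $v^*v = 1$ satisfies $vv^* = 1$. * A closed unital $*$-subalgebra $B \subseteq A$ is *large* in $A$ if for all $k \ge 1$, $a_1, \dots, a_k \in A$, $\varepsilon > 0$, $x \in A_+$ with $\|x\| = 1$, and $y \in B_+ \setminus \{0\}$, there are $c_1, \dots, c_k \in A$ and $g \in B$ such that $0 \le g \le 1$; $\|c_j - a_j\| < \varepsilon$ and $(1-g)c_j \in B$ for $j = 1, \dots, k$; $g \precsim_B y$ and $g \precsim_A x$; and $\|(1-g)x(1-g)\| > 1 - \varepsilon$. * Let $K$ be the algebra of compact operators on $\ell^2(\mathbb{N})$. The Cuntz semigroup of a C*-algebra $D$ is $\operatorname{Cu}(D) = (D \otimes K)_+ / \sim$,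 where $a \sim b$ means $a \precsim_{D \otimes K} b$ and $b \precsim_{D \otimes K} a$, with addition $\langle a \rangle + \langle b \rangle = \langle a \oplus b \rangle$ and order $\langle a \rangle \le \langle b \rangle$ if and only if $a \precsim_{D \otimes K} b$. * $D$ has *$m$-comparison* if for all $\xi, \eta_0, \dots, \eta_m \in \operatorname{Cu}(D)$ such that for each $j = 0, \dots, m$ there is an integer $k_j \ge 1$ with $(k_j + 1)\xi \le k_j \eta_j$, one has $\xi \le \sum_{j=0}^m \eta_j$. -/

import Mathlib

noncomputable section

namespace CuntzCu

open Filter Topology UniformSpace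

attribute [local instance] CStarAlgebra.spectralOrder CStarAlgebra.spectralOrderedRing

/-! ### The algebra `M_∞(A)` of finitely supported `ℕ × ℕ` matrices -/

section FinMat

variable (A : Type*) [CStarAlgebra A]

/-- The space of `ℕ × ℕ` matrices over `A` with only finitely many nonzero entries. -/
def finMatSubmodule : Submodule ℂ (ℕ → ℕ → A) where
  carrier := {M | ∃ n : ℕ, ∀ i j, n ≤ i ∨ n ≤ j → M i j = 0}
  add_mem' := by
    rintro M N ⟨m, hm⟩ ⟨n, hn⟩
    refine ⟨max m n, fun i j h => ?_⟩
    have h1 : m ≤ i ∨ m ≤ j := by omega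
    have h2 : n ≤ i ∨ n ≤ j := by omega
    simp [hm i j h1, hn i j h2]
  zero_mem' := ⟨0, fun _ _ _ => rfl⟩
  smul_mem' := by
    rintro c M ⟨m, hm⟩
    exact ⟨m, fun i j h => by simp [hm i j h]⟩

/-- `M_∞(A) = ⋃ₙ Mₙ(A)`, each `Mₙ(A)` being the upper left corner of `Mₙ₊₁(A)`. -/
def FinMat : Type _ := finMatSubmodule A

instance : AddCommGroup (FinMat A) := inferInstanceAs (AddCommGroup (finMatSubmodule A))
instance : Module ℂ (FinMat A) := inferInstanceAs (Module ℂ (finMatSubmodule A))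

namespace FinMat

variable {A}

/-- The entries of a matrix. -/
def entry (M : FinMat A) : ℕ → ℕ → A := M.1

/-- `M` lives in the upper left `n × n` corner. -/
def SuppLE (n : ℕ) (M : FinMat A) : Prop := ∀ i j, n ≤ i ∨ n ≤ j → M.entry i j = 0

/-- Constructor from entries. -/
def mk (f : ℕ → ℕ → A) (h : ∃ n : ℕ, ∀ i j, n ≤ i ∨ n ≤ j → f i j = 0) : FinMat A := ⟨f, h⟩

@[simp] theorem entry_mk (f : ℕ → ℕ → A) (h) : (mk f h).entry = f := rfl

theorem ext' {M N : FinMat A} (h : ∀ i j, M.entry i j = N.entry i j) : M = N :=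
  Subtype.ext (funext fun i => funext fun j => h i j)

@[simp] theorem entry_add (M N : FinMat A) (i j : ℕ) :
    (M + N).entry i j = M.entry i j + N.entry i j := rfl
@[simp] theorem entry_zero (i j : ℕ) : (0 : FinMat A).entry i j = 0 := rfl
@[simp] theorem entry_smul (c : ℂ) (M : FinMat A) (i j : ℕ) :
    (c • M).entry i j = c • M.entry i j := rfl
@[simp] theorem entry_neg (M : FinMat A) (i j : ℕ) : (-M).entry i j = -M.entry i j := rfl

theorem exists_suppLE (M : FinMat A) : ∃ n, SuppLE n M := M.2

theorem SuppLE.mono {m n : ℕ} (h : m ≤ n) {M : FinMat A} (hM : SuppLE m M) : SuppLE n M :=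
  fun i j hij => hM i j (by omega)

theorem eventually_suppLE (M : FinMat A) : ∀ᶠ n in atTop, SuppLE n M := by
  obtain ⟨n, hn⟩ := M.exists_suppLE
  filter_upwards [eventually_ge_atTop n] with m hm using hn.mono hm

theorem finsum_eq {n : ℕ} {M : FinMat A} (hM : SuppLE n M) (g : ℕ → A) (i : ℕ) :
    ∑ᶠ k, M.entry i k * g k = ∑ k ∈ Finset.range n, M.entry i k * g k := by
  apply finsum_eq_sum_of_support_subset
  intro k hk
  by_contra h
  apply hk
  simp only [Finset.coe_range, Set.mem_Iio, not_lt] at h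
  simp [hM i k (Or.inr h)]

/-- Matrix multiplication; the sum has only finitely many nonzero terms. -/
instance : Mul (FinMat A) where
  mul M N := mk (fun i j => ∑ᶠ k, M.entry i k * N.entry k j) <| by
    obtain ⟨m, hm⟩ := M.exists_suppLE
    obtain ⟨n, hn⟩ := N.exists_suppLE
    refine ⟨max m n, fun i j h => ?_⟩
    rw [finsum_eq hm]
    refine Finset.sum_eq_zero fun k _ => ?_
    rcases h with h | h
    · simp [hm i k (Or.inl (by omega))]
    · simp [hn k j (Or.inr (by omega))]

/-- The conjugate transpose. -/
instance : Star (FinMat A) where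
  star M := mk (fun i j => star (M.entry j i)) <| by
    obtain ⟨m, hm⟩ := M.exists_suppLE
    exact ⟨m, fun i j h => by simp [hm j i h.symm]⟩

theorem entry_mul (M N : FinMat A) (i j : ℕ) :
    (M * N).entry i j = ∑ᶠ k, M.entry i k * N.entry k j := rfl
@[simp] theorem entry_star (M : FinMat A) (i j : ℕ) :
    (star M).entry i j = star (M.entry j i) := rfl

theorem SuppLE.mul {n : ℕ} {M N : FinMat A} (hM : SuppLE n M) (hN : SuppLE n N) :
    SuppLE n (M * N) := by
  intro i j h
  rw [entry_mul, finsum_eq hM]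
  refine Finset.sum_eq_zero fun k _ => ?_
  rcases h with h | h
  · simp [hM i k (Or.inl h)]
  · simp [hN k j (Or.inr h)]

/-- The upper left `n × n` corner of `M`. -/
def trunc (n : ℕ) (M : FinMat A) : CStarMatrix (Fin n) (Fin n) A :=
  CStarMatrix.ofMatrix fun i j => M.entry i j

theorem trunc_apply (n : ℕ) (M : FinMat A) (i j : Fin n) : trunc n M i j = M.entry i j := rfl

theorem trunc_add (n : ℕ) (M N : FinMat A) : trunc n (M + N) = trunc n M + trunc n N := rfl
theorem trunc_zero (n : ℕ) : trunc n (0 : FinMat A) = 0 := rfl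
theorem trunc_neg (n : ℕ) (M : FinMat A) : trunc n (-M) = -trunc n M := rfl
theorem trunc_smul (n : ℕ) (c : ℂ) (M : FinMat A) : trunc n (c • M) = c • trunc n M := rfl
theorem trunc_star (n : ℕ) (M : FinMat A) : trunc n (star M) = star (trunc n M) := rfl

theorem trunc_mul {n : ℕ} {M : FinMat A} (hM : SuppLE n M) (N : FinMat A) :
    trunc n (M * N) = trunc n M * trunc n N := by
  ext i j
  rw [trunc_apply, entry_mul, finsum_eq hM, CStarMatrix.mul_apply, Finset.sum_range]
  rfl

theorem eq_of_trunc {n : ℕ} {M N : FinMat A} (hM : SuppLE n M) (hN : SuppLE n N)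
    (h : trunc n M = trunc n N) : M = N := by
  refine ext' fun i j => ?_
  by_cases hij : n ≤ i ∨ n ≤ j
  · rw [hM i j hij, hN i j hij]
  · push Not at hij
    have := congrFun (congrFun h ⟨i, hij.1⟩) ⟨j, hij.2⟩
    exact this

theorem eq_of_eventually {M N : FinMat A} (h : ∀ᶠ n in atTop, trunc n M = trunc n N) : M = N := by
  obtain ⟨n, h1, h2, h3⟩ := (h.and (M.eventually_suppLE.and N.eventually_suppLE)).exists
  exact eq_of_trunc h2 h3 h1

theorem eventually_trunc_mul (M N : FinMat A) :
    ∀ᶠ n in atTop, trunc n (M * N) = trunc n M * trunc n N := by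
  filter_upwards [M.eventually_suppLE] with n hn using trunc_mul hn N

instance : NonUnitalRing (FinMat A) where
  left_distrib M N K := eq_of_eventually <| by
    filter_upwards [eventually_trunc_mul M (N + K), eventually_trunc_mul M N,
      eventually_trunc_mul M K] with n h1 h2 h3
    rw [h1, trunc_add, trunc_add, h2, h3, mul_add]
  right_distrib M N K := eq_of_eventually <| by
    filter_upwards [eventually_trunc_mul (M + N) K, eventually_trunc_mul M K,
      eventually_trunc_mul N K] with n h1 h2 h3
    rw [h1, trunc_add, trunc_add, h2, h3, add_mul]
  zero_mul M := eq_of_eventually <| by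
    filter_upwards [eventually_trunc_mul 0 M] with n h1
    rw [h1, trunc_zero, zero_mul]
  mul_zero M := eq_of_eventually <| by
    filter_upwards [eventually_trunc_mul M 0] with n h1
    rw [h1, trunc_zero, mul_zero]
  mul_assoc M N K := eq_of_eventually <| by
    filter_upwards [eventually_trunc_mul (M * N) K, eventually_trunc_mul M N,
      eventually_trunc_mul M (N * K), eventually_trunc_mul N K] with n h1 h2 h3 h4
    rw [h1, h2, h3, h4, mul_assoc]

instance : StarRing (FinMat A) where
  star_involutive M := ext' fun i j => by simp
  star_mul M N := eq_of_eventually <| by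
    filter_upwards [eventually_trunc_mul M N, eventually_trunc_mul (star N) (star M)] with n h1 h2
    rw [trunc_star, h1, h2, star_mul, trunc_star, trunc_star]
  star_add M N := ext' fun i j => by simp

instance : StarModule ℂ (FinMat A) where
  star_smul c M := ext' fun i j => by simp

instance : IsScalarTower ℂ (FinMat A) (FinMat A) where
  smul_assoc c M N := eq_of_eventually <| by
    filter_upwards [eventually_trunc_mul (c • M) N, eventually_trunc_mul M N] with n h1 h2
    rw [smul_eq_mul, smul_eq_mul, h1, trunc_smul, trunc_smul, h2, smul_mul_assoc]

instance : SMulCommClass ℂ (FinMat A) (FinMat A) where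
  smul_comm c M N := eq_of_eventually <| by
    filter_upwards [eventually_trunc_mul M (c • N), eventually_trunc_mul M N] with n h1 h2
    rw [smul_eq_mul, smul_eq_mul, h1, trunc_smul, trunc_smul, h2, mul_smul_comm]

/-- An `n × n` matrix as an element of `M_∞(A)`. -/
def pad {n : ℕ} (x : CStarMatrix (Fin n) (Fin n) A) : FinMat A :=
  mk (fun i j => if h : i < n ∧ j < n then x ⟨i, h.1⟩ ⟨j, h.2⟩ else 0)
    ⟨n, fun i j h => dif_neg (by omega)⟩

theorem suppLE_pad {n : ℕ} (x : CStarMatrix (Fin n) (Fin n) A) : SuppLE n (pad x) :=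
  fun i j h => dif_neg (by omega)

theorem trunc_pad {n : ℕ} (x : CStarMatrix (Fin n) (Fin n) A) : trunc n (pad x) = x := by
  ext i j
  rw [trunc_apply, pad, entry_mk, dif_pos ⟨i.2, j.2⟩]

theorem pad_trunc {n : ℕ} {M : FinMat A} (hM : SuppLE n M) : pad (trunc n M) = M :=
  eq_of_trunc (suppLE_pad _) hM (trunc_pad _)

theorem pad_add {n : ℕ} (x y : CStarMatrix (Fin n) (Fin n) A) : pad (x + y) = pad x + pad y := by
  refine ext' fun i j => ?_
  by_cases h : i < n ∧ j < n <;> simp [pad, h]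

theorem pad_zero {n : ℕ} : pad (0 : CStarMatrix (Fin n) (Fin n) A) = 0 := by
  refine ext' fun i j => ?_
  simp [pad]

theorem pad_smul {n : ℕ} (c : ℂ) (x : CStarMatrix (Fin n) (Fin n) A) :
    pad (c • x) = c • pad x := by
  refine ext' fun i j => ?_
  by_cases h : i < n ∧ j < n <;> simp [pad, h]

theorem pad_star {n : ℕ} (x : CStarMatrix (Fin n) (Fin n) A) : pad (star x) = star (pad x) := by
  refine ext' fun i j => ?_
  by_cases h : i < n ∧ j < n <;> simp [pad, h, and_comm, CStarMatrix.star_apply]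

theorem pad_mul {n : ℕ} (x y : CStarMatrix (Fin n) (Fin n) A) : pad (x * y) = pad x * pad y :=
  eq_of_trunc (suppLE_pad _) ((suppLE_pad _).mul (suppLE_pad _)) <| by
    rw [trunc_mul (suppLE_pad x), trunc_pad, trunc_pad, trunc_pad]

/-- The upper left corner embedding of `Mₙ(A)` into `Mₘ(A)`, where `n ≤ m`. -/
def corner {n m : ℕ} (h : n ≤ m) :
    CStarMatrix (Fin n) (Fin n) A →⋆ₙₐ[ℂ] CStarMatrix (Fin m) (Fin m) A where
  toFun x := trunc m (pad x)
  map_smul' c x := by simp only [pad_smul, trunc_smul]; rfl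
  map_zero' := by rw [pad_zero, trunc_zero]
  map_add' x y := by rw [pad_add, trunc_add]
  map_mul' x y := by rw [pad_mul, trunc_mul ((suppLE_pad x).mono h)]
  map_star' x := by rw [pad_star, trunc_star]

theorem corner_injective {n m : ℕ} (h : n ≤ m) :
    Function.Injective (corner (A := A) h) := by
  intro x y hxy
  have := eq_of_trunc ((suppLE_pad x).mono h) ((suppLE_pad y).mono h) hxy
  rw [← trunc_pad x, this, trunc_pad]

theorem norm_trunc_eq {n m : ℕ} (h : n ≤ m) {M : FinMat A} (hM : SuppLE n M) :
    ‖trunc m M‖ = ‖trunc n M‖ := by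
  rw [← NonUnitalStarAlgHom.norm_map (corner (A := A) h) (corner_injective h) (trunc n M)]
  show _ = ‖trunc m (pad (trunc n M))‖
  rw [pad_trunc hM]

/-- The C⋆-norm of `M` is its norm in `Mₙ(A)`, for any `n` such that `M` lives in the upper left
`n × n` corner. -/
instance : Norm (FinMat A) where
  norm M := ‖trunc M.exists_suppLE.choose M‖

theorem norm_eq {n : ℕ} {M : FinMat A} (hM : SuppLE n M) : ‖M‖ = ‖trunc n M‖ := by
  show ‖trunc M.exists_suppLE.choose M‖ = _
  rcases le_total n M.exists_suppLE.choose with h | h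
  · exact norm_trunc_eq h hM
  · exact (norm_trunc_eq h M.exists_suppLE.choose_spec).symm

theorem eventually_norm (M : FinMat A) : ∀ᶠ n in atTop, ‖M‖ = ‖trunc n M‖ := by
  filter_upwards [M.eventually_suppLE] with n hn using norm_eq hn

theorem norm_core : NormedSpace.Core ℂ (FinMat A) where
  norm_nonneg M := norm_nonneg (trunc _ M)
  norm_smul c M := by
    obtain ⟨n, h1, h2⟩ := ((eventually_norm M).and (eventually_norm (c • M))).exists
    rw [h1, h2, trunc_smul, norm_smul]
  norm_triangle M N := by
    obtain ⟨n, h1, h2, h3⟩ := ((eventually_norm M).and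
      ((eventually_norm N).and (eventually_norm (M + N)))).exists
    rw [h1, h2, h3, trunc_add]
    exact norm_add_le _ _
  norm_eq_zero_iff M := by
    obtain ⟨n, h1, h2⟩ := ((eventually_norm M).and (eventually_suppLE M)).exists
    rw [h1, norm_eq_zero]
    constructor
    · intro h
      exact eq_of_trunc h2 (fun _ _ _ => rfl) (h.trans (trunc_zero n).symm)
    · rintro rfl
      exact trunc_zero n

instance : NormedAddCommGroup (FinMat A) := NormedAddCommGroup.ofCore norm_core

instance : NonUnitalNormedRing (FinMat A) where
  __ := (inferInstance : NormedAddCommGroup (FinMat A))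
  __ := (inferInstance : NonUnitalRing (FinMat A))
  norm_mul_le M N := by
    obtain ⟨n, h1, h2, h3, h4⟩ := ((eventually_norm M).and ((eventually_norm N).and
      ((eventually_norm (M * N)).and (eventually_trunc_mul M N)))).exists
    rw [h1, h2, h3, h4]
    exact norm_mul_le _ _

instance : NormedSpace ℂ (FinMat A) where
  norm_smul_le c M := (norm_core.norm_smul c M).le

instance : CStarRing (FinMat A) where
  norm_mul_self_le M := by
    obtain ⟨n, h1, h2, h3⟩ := ((eventually_norm M).and
      ((eventually_norm (star M * M)).and (eventually_trunc_mul (star M) M))).exists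
    rw [h1, h2, h3, trunc_star]
    exact CStarRing.norm_mul_self_le _

/-! #### Moving rows and columns along an injection of the index set -/

/-- For an injection `σ : ℕ → ℕ`, the matrix whose `(σ i, σ j)` entry is the `(i, j)` entry of `M`
and whose other entries are zero. -/
def reindex (σ : ℕ ↪ ℕ) (M : FinMat A) : FinMat A :=
  mk (fun i j => Function.extend (Prod.map σ σ) (fun p => M.entry p.1 p.2) 0 (i, j)) <| by
    obtain ⟨n, hn⟩ := M.exists_suppLE
    refine ⟨(Finset.range n).sup σ + 1, fun i j h => ?_⟩
    by_cases hp : ∃ p, Prod.map σ σ p = (i, j)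
    · obtain ⟨⟨k, l⟩, hp⟩ := hp
      rw [← hp, (σ.injective.prodMap σ.injective).extend_apply]
      simp only [Prod.map_apply, Prod.mk.injEq] at hp
      refine hn k l ?_
      by_contra hc
      push Not at hc
      have h1 := Finset.le_sup (f := σ) (Finset.mem_range.2 hc.1)
      have h2 := Finset.le_sup (f := σ) (Finset.mem_range.2 hc.2)
      omega
    · rw [Function.extend_apply' _ _ _ hp]
      rfl

theorem entry_reindex (σ : ℕ ↪ ℕ) (M : FinMat A) (i j : ℕ) :
    (reindex σ M).entry (σ i) (σ j) = M.entry i j :=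
  (σ.injective.prodMap σ.injective).extend_apply
    (fun p : ℕ × ℕ => M.entry p.1 p.2) 0 (i, j)

theorem entry_reindex_left (σ : ℕ ↪ ℕ) (M : FinMat A) {i : ℕ} (hi : i ∉ Set.range σ) (j : ℕ) :
    (reindex σ M).entry i j = 0 := by
  refine Function.extend_apply' (f := Prod.map σ σ) (fun p : ℕ × ℕ => M.entry p.1 p.2) 0 (i, j) ?_
  rintro ⟨⟨k, l⟩, hp⟩
  exact hi ⟨k, (Prod.mk.inj hp).1⟩

theorem entry_reindex_right (σ : ℕ ↪ ℕ) (M : FinMat A) (i : ℕ) {j : ℕ} (hj : j ∉ Set.range σ) :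
    (reindex σ M).entry i j = 0 := by
  refine Function.extend_apply' (f := Prod.map σ σ) (fun p : ℕ × ℕ => M.entry p.1 p.2) 0 (i, j) ?_
  rintro ⟨⟨k, l⟩, hp⟩
  exact hj ⟨l, (Prod.mk.inj hp).2⟩

theorem reindex_ext (σ : ℕ ↪ ℕ) {M N : FinMat A}
    (h : ∀ i j, N.entry (σ i) (σ j) = M.entry i j)
    (hl : ∀ i j, i ∉ Set.range σ → N.entry i j = 0)
    (hr : ∀ i j, j ∉ Set.range σ → N.entry i j = 0) : reindex σ M = N := by
  refine ext' fun i j => ?_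
  by_cases hi : i ∈ Set.range σ
  · by_cases hj : j ∈ Set.range σ
    · obtain ⟨i, rfl⟩ := hi
      obtain ⟨j, rfl⟩ := hj
      rw [entry_reindex, h]
    · rw [entry_reindex_right _ _ _ hj, hr _ _ hj]
  · rw [entry_reindex_left _ _ hi, hl _ _ hi]

theorem reindex_add (σ : ℕ ↪ ℕ) (M N : FinMat A) :
    reindex σ (M + N) = reindex σ M + reindex σ N :=
  reindex_ext σ (fun i j => by simp [entry_reindex])
    (fun i j h => by simp [entry_reindex_left _ _ h])
    (fun i j h => by simp [entry_reindex_right _ _ _ h])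

theorem reindex_zero (σ : ℕ ↪ ℕ) : reindex σ (0 : FinMat A) = 0 :=
  reindex_ext σ (fun _ _ => rfl) (fun _ _ _ => rfl) (fun _ _ _ => rfl)

theorem reindex_star (σ : ℕ ↪ ℕ) (M : FinMat A) : reindex σ (star M) = star (reindex σ M) :=
  reindex_ext σ (fun i j => by simp [entry_reindex])
    (fun i j h => by simp [entry_reindex_right _ _ _ h])
    (fun i j h => by simp [entry_reindex_left _ _ h])

theorem reindex_reindex (σ τ : ℕ ↪ ℕ) (M : FinMat A) :
    reindex τ (reindex σ M) = reindex (σ.trans τ) M := by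
  symm
  refine reindex_ext _ (fun i j => ?_) (fun i j h => ?_) (fun i j h => ?_)
  · exact (entry_reindex τ _ _ _).trans (entry_reindex σ _ _ _)
  · by_cases hi : i ∈ Set.range τ
    · obtain ⟨k, rfl⟩ := hi
      by_cases hj : j ∈ Set.range τ
      · obtain ⟨l, rfl⟩ := hj
        rw [entry_reindex]
        refine entry_reindex_left σ M ?_ l
        rintro ⟨p, rfl⟩
        exact h ⟨p, rfl⟩
      · exact entry_reindex_right _ _ _ hj
    · exact entry_reindex_left _ _ hi _
  · by_cases hj : j ∈ Set.range τ
    · obtain ⟨l, rfl⟩ := hj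
      by_cases hi : i ∈ Set.range τ
      · obtain ⟨k, rfl⟩ := hi
        rw [entry_reindex]
        refine entry_reindex_right σ M k ?_
        rintro ⟨p, rfl⟩
        exact h ⟨p, rfl⟩
      · exact entry_reindex_left _ _ hi _
    · exact entry_reindex_right _ _ _ hj

theorem reindex_refl (M : FinMat A) : reindex (Function.Embedding.refl ℕ) M = M :=
  reindex_ext _ (fun _ _ => rfl) (fun i _ h => (h ⟨i, rfl⟩).elim) (fun _ j h => (h ⟨j, rfl⟩).elim)

/-- The partial isometry `∑_{j < n} e_{σ j, j}`. -/
def shift (A : Type*) [CStarAlgebra A] (σ : ℕ ↪ ℕ) (n : ℕ) : FinMat A :=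
  mk (fun i j => if j < n ∧ i = σ j then 1 else 0) <| by
    refine ⟨max n ((Finset.range n).sup σ + 1), fun i j h => if_neg ?_⟩
    rintro ⟨h1, rfl⟩
    have h2 := Finset.le_sup (f := σ) (Finset.mem_range.2 h1)
    omega

theorem entry_shift (σ : ℕ ↪ ℕ) (n i j : ℕ) :
    (shift A σ n).entry i j = if j < n ∧ i = σ j then 1 else 0 := rfl

theorem star_shift_mul_shift (σ : ℕ ↪ ℕ) (n : ℕ) :
    star (shift A σ n) * shift A σ n = shift A (Function.Embedding.refl ℕ) n := by
  refine ext' fun i j => ?_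
  rw [entry_mul, finsum_eq_single _ (σ i)]
  · by_cases hi : i < n <;> by_cases hij : i = j
    · subst hij; simp [entry_shift, hi]
    · simp [entry_shift, hi, hij]
    · subst hij; simp [entry_shift, hi]
    · simp [entry_shift, hi, hij]
  · intro k hk
    simp [entry_shift, hk]

theorem shift_mul (σ : ℕ ↪ ℕ) {n : ℕ} {M : FinMat A} (hM : SuppLE n M) (i j : ℕ) :
    (shift A σ n * M).entry (σ i) j = M.entry i j := by
  rw [entry_mul, finsum_eq_single _ i]
  · by_cases hi : i < n
    · simp [entry_shift, hi]
    · rw [hM i j (Or.inl (by omega)), mul_zero]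
  · intro k hk
    simp [entry_shift, hk.symm]

theorem shift_mul_of_notMem (σ : ℕ ↪ ℕ) (n : ℕ) (M : FinMat A) {i : ℕ} (hi : i ∉ Set.range σ)
    (j : ℕ) : (shift A σ n * M).entry i j = 0 := by
  rw [entry_mul]
  refine finsum_eq_zero_of_forall_eq_zero fun k => ?_
  have : i ≠ σ k := fun h => hi ⟨k, h.symm⟩
  simp [entry_shift, this]

theorem shift_refl_mul {n : ℕ} {M : FinMat A} (hM : SuppLE n M) :
    shift A (Function.Embedding.refl ℕ) n * M = M :=
  ext' fun i j => shift_mul (Function.Embedding.refl ℕ) hM i j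

theorem SuppLE.star {n : ℕ} {M : FinMat A} (hM : SuppLE n M) : SuppLE n (star M) :=
  fun i j h => by simp [hM j i h.symm]

theorem mul_star_shift_refl {n : ℕ} {M : FinMat A} (hM : SuppLE n M) :
    M * star (shift A (Function.Embedding.refl ℕ) n) = M := by
  rw [← star_inj, star_mul, star_star, shift_refl_mul hM.star]

theorem star_shift_refl (n : ℕ) :
    star (shift A (Function.Embedding.refl ℕ) n) = shift A (Function.Embedding.refl ℕ) n := by
  rw [← star_shift_mul_shift (Function.Embedding.refl ℕ) n, star_mul, star_star]

theorem reindex_eq (σ : ℕ ↪ ℕ) {n : ℕ} {M : FinMat A} (hM : SuppLE n M) :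
    reindex σ M = shift A σ n * M * star (shift A σ n) := by
  have key : ∀ i j, (shift A σ n * M * star (shift A σ n)).entry i j =
      star ((shift A σ n * (star M * star (shift A σ n))).entry j i) := by
    intro i j
    rw [← entry_star]
    simp [mul_assoc]
  refine reindex_ext σ (fun i j => ?_) (fun i j h => ?_) (fun i j h => ?_)
  · have h1 : SuppLE n (star M) := hM.star
    rw [key, ← star_star (star M * star (shift A σ n)), star_mul, star_star, star_star,
      entry_mul, finsum_eq_single _ j]
    · by_cases hj : j < n
      · rw [entry_shift, if_pos ⟨hj, rfl⟩, one_mul, entry_star, star_star, shift_mul σ hM]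
      · rw [entry_star, shift_mul σ hM, hM i j (Or.inr (by omega)), star_zero, mul_zero, star_zero]
    · intro k hk
      rw [entry_shift, if_neg, zero_mul]
      rintro ⟨-, h⟩
      exact hk (σ.injective h).symm
  · rw [mul_assoc]
    exact shift_mul_of_notMem σ n _ h j
  · rw [key, shift_mul_of_notMem σ n _ h, star_zero]

theorem star_shift_reindex (σ : ℕ ↪ ℕ) {n : ℕ} {M : FinMat A} (hM : SuppLE n M) :
    star (shift A σ n) * reindex σ M * shift A σ n = M := by
  calc star (shift A σ n) * reindex σ M * shift A σ n
      = (star (shift A σ n) * shift A σ n) * M * (star (shift A σ n) * shift A σ n) := by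
        rw [reindex_eq σ hM]; simp only [mul_assoc]
    _ = M := by
        rw [star_shift_mul_shift, shift_refl_mul hM, ← star_shift_refl, mul_star_shift_refl hM]

theorem reindex_mul (σ : ℕ ↪ ℕ) (M N : FinMat A) :
    reindex σ (M * N) = reindex σ M * reindex σ N := by
  obtain ⟨n, hM, hN⟩ := (M.eventually_suppLE.and N.eventually_suppLE).exists
  rw [reindex_eq σ hM, reindex_eq σ hN, reindex_eq σ (hM.mul hN)]
  calc shift A σ n * (M * N) * star (shift A σ n)
      = shift A σ n * (M * ((star (shift A σ n) * shift A σ n) * N)) * star (shift A σ n) := by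
        rw [star_shift_mul_shift, shift_refl_mul hN]
    _ = _ := by simp only [mul_assoc]

theorem norm_shift_refl_le (n : ℕ) : ‖shift A (Function.Embedding.refl ℕ) n‖ ≤ 1 := by
  have h : ‖shift A (Function.Embedding.refl ℕ) n‖ * ‖shift A (Function.Embedding.refl ℕ) n‖ =
      ‖shift A (Function.Embedding.refl ℕ) n‖ := by
    rw [← CStarRing.norm_star_mul_self, star_shift_mul_shift]
  nlinarith [norm_nonneg (shift A (Function.Embedding.refl ℕ) n)]

theorem norm_shift_le (σ : ℕ ↪ ℕ) (n : ℕ) : ‖shift A σ n‖ ≤ 1 := by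
  have h : ‖shift A σ n‖ * ‖shift A σ n‖ ≤ 1 := by
    rw [← CStarRing.norm_star_mul_self, star_shift_mul_shift]
    exact norm_shift_refl_le n
  nlinarith [norm_nonneg (shift A σ n)]

theorem norm_reindex_le (σ : ℕ ↪ ℕ) (M : FinMat A) : ‖reindex σ M‖ ≤ ‖M‖ := by
  obtain ⟨n, hM⟩ := M.exists_suppLE
  rw [reindex_eq σ hM]
  calc _ ≤ ‖shift A σ n‖ * ‖M‖ * ‖star (shift A σ n)‖ := norm_mul₃_le
    _ ≤ 1 * ‖M‖ * 1 := by
        rw [norm_star]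
        gcongr
        · exact norm_shift_le σ n
        · exact norm_shift_le σ n
    _ = ‖M‖ := by ring

theorem reindex_mul_reindex_of_disjoint {σ τ : ℕ ↪ ℕ}
    (h : Disjoint (Set.range σ) (Set.range τ)) (M N : FinMat A) :
    reindex σ M * reindex τ N = 0 := by
  refine ext' fun i j => ?_
  rw [entry_mul]
  refine finsum_eq_zero_of_forall_eq_zero fun k => ?_
  by_cases hk : k ∈ Set.range σ
  · rw [entry_reindex_left τ N (Set.disjoint_left.1 h hk), mul_zero]
  · rw [entry_reindex_right σ M i hk, zero_mul]

/-- `reindex` as an additive map. -/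
def reindexHom (σ : ℕ ↪ ℕ) : FinMat A →+ FinMat A where
  toFun := reindex σ
  map_zero' := reindex_zero σ
  map_add' := reindex_add σ

theorem uniformContinuous_reindex (σ : ℕ ↪ ℕ) :
    UniformContinuous (reindex σ : FinMat A → FinMat A) :=
  AddMonoidHomClass.uniformContinuous_of_bound (reindexHom σ) 1
    (fun M => by rw [one_mul]; exact norm_reindex_le σ M)

end FinMat

end FinMat

/-! ### The stabilization `A ⊗ K` -/

section Stab

variable (A : Type*) [CStarAlgebra A]

/-- The stabilization `A ⊗ K`, with `K` the compact operators on `ℓ²(ℕ)`: the C⋆-completion of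
`M_∞(A)`. -/
def Stab : Type _ := Completion (FinMat A)

namespace Stab

instance : NormedAddCommGroup (Stab A) :=
  inferInstanceAs (NormedAddCommGroup (Completion (FinMat A)))
instance : CompleteSpace (Stab A) := inferInstanceAs (CompleteSpace (Completion (FinMat A)))

variable {A}

/-- Scalar multiplication, sealed so that unification does not unfold it. -/
def smulAux (c : ℂ) (x : Stab A) : Stab A :=
  ((c • (show Completion (FinMat A) from x) : Completion (FinMat A)))

instance : NormedSpace ℂ (Stab A) where
  smul c x := smulAux c x
  one_smul x := one_smul ℂ (show Completion (FinMat A) from x)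
  mul_smul c d x := mul_smul c d (show Completion (FinMat A) from x)
  smul_zero c := smul_zero (A := Completion (FinMat A)) c
  smul_add c x y := smul_add (A := Completion (FinMat A)) c x y
  add_smul c d x := add_smul c d (show Completion (FinMat A) from x)
  zero_smul x := zero_smul ℂ (show Completion (FinMat A) from x)
  norm_smul_le c x := norm_smul_le c (show Completion (FinMat A) from x)

theorem smul_eq (c : ℂ) (x : Stab A) :
    c • x = (c • (show Completion (FinMat A) from x) : Completion (FinMat A)) := rfl

attribute [irreducible] smulAux

/-- The inclusion of `M_∞(A)` in `A ⊗ K`. -/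
def of (M : FinMat A) : Stab A := (M : Completion (FinMat A))

theorem isometry_of : Isometry (of : FinMat A → Stab A) := Completion.coe_isometry
theorem continuous_of : Continuous (of : FinMat A → Stab A) := isometry_of.continuous
theorem denseRange_of : DenseRange (of : FinMat A → Stab A) := Completion.denseRange_coe
theorem isDenseInducing_of : IsDenseInducing (of : FinMat A → Stab A) :=
  Completion.isDenseInducing_coe
theorem norm_of (M : FinMat A) : ‖of M‖ = ‖M‖ := Completion.norm_coe M
theorem of_add (M N : FinMat A) : of (M + N) = of M + of N := Completion.coe_add M N
theorem of_zero : of (0 : FinMat A) = 0 := rfl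
theorem of_smul (c : ℂ) (M : FinMat A) : of (c • M) = c • of M :=
  (Completion.coe_smul c M).trans (smul_eq c (of M)).symm

theorem ind {p : Stab A → Prop} (x : Stab A) (hc : IsClosed {x | p x}) (h : ∀ M, p (of M)) : p x :=
  Completion.induction_on x hc h
theorem ind₂ {p : Stab A → Stab A → Prop} (x y : Stab A)
    (hc : IsClosed {z : Stab A × Stab A | p z.1 z.2}) (h : ∀ M N, p (of M) (of N)) : p x y :=
  Completion.induction_on₂ x y hc h
theorem ind₃ {p : Stab A → Stab A → Stab A → Prop} (x y z : Stab A)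
    (hc : IsClosed {z : Stab A × Stab A × Stab A | p z.1 z.2.1 z.2.2})
    (h : ∀ M N K, p (of M) (of N) (of K)) : p x y z :=
  Completion.induction_on₃ x y z hc h

/-- The continuous extension of the multiplication of `M_∞(A)`. -/
instance : Mul (Stab A) where
  mul x y := (isDenseInducing_of.prodMap isDenseInducing_of).extend
    (fun p : FinMat A × FinMat A => of (p.1 * p.2)) (x, y)

theorem of_mul (M N : FinMat A) : of (M * N) = of M * of N :=
  ((isDenseInducing_of.prodMap isDenseInducing_of).extend_eq
    (continuous_of.comp continuous_mul) (M, N)).symm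

instance : ContinuousMul (Stab A) where
  continuous_mul := by
    let m := (AddMonoidHom.mul : FinMat A →+ FinMat A →+ FinMat A).compr₂
      (Completion.toCompl : FinMat A →+ Completion (FinMat A))
    have : Continuous fun p : FinMat A × FinMat A => m p.1 p.2 :=
      continuous_of.comp continuous_mul
    have di : IsDenseInducing (Completion.toCompl : FinMat A → Completion (FinMat A)) :=
      Completion.isDenseInducing_coe
    exact (di.extend_Z_bilin di this :)

theorem left_distrib' (x y z : Stab A) : x * (y + z) = x * y + x * z := by
  induction x, y, z using ind₃ with
  | hc => exact isClosed_eq (by fun_prop) (by fun_prop)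
  | h M N K => rw [← of_add, ← of_mul, ← of_mul, ← of_mul, ← of_add, mul_add]

theorem right_distrib' (x y z : Stab A) : (x + y) * z = x * z + y * z := by
  induction x, y, z using ind₃ with
  | hc => exact isClosed_eq (by fun_prop) (by fun_prop)
  | h M N K => rw [← of_add, ← of_mul, ← of_mul, ← of_mul, ← of_add, add_mul]

theorem zero_mul' (x : Stab A) : 0 * x = 0 := by
  induction x using ind with
  | hc => exact isClosed_eq (by fun_prop) (by fun_prop)
  | h M => rw [← of_zero, ← of_mul, zero_mul]

theorem mul_zero' (x : Stab A) : x * 0 = 0 := by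
  induction x using ind with
  | hc => exact isClosed_eq (by fun_prop) (by fun_prop)
  | h M => rw [← of_zero, ← of_mul, mul_zero]

theorem mul_assoc' (x y z : Stab A) : x * y * z = x * (y * z) := by
  induction x, y, z using ind₃ with
  | hc => exact isClosed_eq (by fun_prop) (by fun_prop)
  | h M N K => rw [← of_mul, ← of_mul, ← of_mul, ← of_mul, mul_assoc]

theorem norm_mul_le' (x y : Stab A) : ‖x * y‖ ≤ ‖x‖ * ‖y‖ := by
  induction x, y using ind₂ with
  | hc => exact isClosed_le (by fun_prop) (by fun_prop)
  | h M N =>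
    rw [← of_mul, norm_of, norm_of, norm_of]
    exact norm_mul_le M N

/-- The continuous extension of the conjugate transpose. -/
instance : Star (Stab A) where
  star := Completion.map (star : FinMat A → FinMat A)

theorem uniformContinuous_star' : UniformContinuous (star : FinMat A → FinMat A) :=
  (AddMonoidHomClass.isometry_of_norm (starAddEquiv : FinMat A ≃+ FinMat A)
    (fun M => norm_star M)).uniformContinuous

theorem of_star (M : FinMat A) : of (star M) = star (of M) :=
  (Completion.map_coe uniformContinuous_star' M).symm

instance : ContinuousStar (Stab A) where
  continuous_star := by
    have : Continuous (Completion.map (star : FinMat A → FinMat A)) := Completion.continuous_map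
    exact this

theorem smul_mul' (c : ℂ) (x y : Stab A) : c • x * y = c • (x * y) := by
  induction x, y using ind₂ with
  | hc => exact isClosed_eq (by fun_prop) (by fun_prop)
  | h M N => rw [← of_smul, ← of_mul, ← of_mul, ← of_smul, smul_mul_assoc]

theorem mul_smul' (c : ℂ) (x y : Stab A) : c • (x * y) = x * c • y := by
  induction x, y using ind₂ with
  | hc => exact isClosed_eq (by fun_prop) (by fun_prop)
  | h M N => rw [← of_smul, ← of_mul, ← of_mul, ← of_smul, mul_smul_comm]

theorem star_smul' (c : ℂ) (x : Stab A) : star (c • x) = star c • star x := by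
  induction x using ind with
  | hc => exact isClosed_eq (by fun_prop) (by fun_prop)
  | h M => rw [← of_smul, ← of_star, ← of_star, ← of_smul, star_smul]

instance : NonUnitalNormedRing (Stab A) where
  __ := (inferInstance : NormedAddCommGroup (Stab A))
  left_distrib := left_distrib'
  right_distrib := right_distrib'
  zero_mul := zero_mul'
  mul_zero := mul_zero'
  mul_assoc := mul_assoc'
  norm_mul_le := norm_mul_le'

instance : StarRing (Stab A) where
  star_involutive x := by
    induction x using ind with
    | hc => exact isClosed_eq (by fun_prop) (by fun_prop)
    | h M => rw [← of_star, ← of_star, star_star]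
  star_mul x y := by
    induction x, y using ind₂ with
    | hc => exact isClosed_eq (by fun_prop) (by fun_prop)
    | h M N => rw [← of_star, ← of_star, ← of_mul, ← of_mul, ← of_star, star_mul]
  star_add x y := by
    induction x, y using ind₂ with
    | hc => exact isClosed_eq (by fun_prop) (by fun_prop)
    | h M N => rw [← of_star, ← of_star, ← of_add, ← of_add, ← of_star, star_add]

theorem norm_mul_self_le' (x : Stab A) : ‖x‖ * ‖x‖ ≤ ‖star x * x‖ := by
  induction x using ind with
  | hc => exact isClosed_le (by fun_prop) (by fun_prop)
  | h M =>
    rw [← of_star, ← of_mul, norm_of, norm_of]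
    exact CStarRing.norm_mul_self_le M

instance : NonUnitalCStarAlgebra (Stab A) where
  norm_smul_le := norm_smul_le
  norm_mul_self_le := norm_mul_self_le'
  smul_assoc := smul_mul'
  smul_comm := mul_smul'
  star_smul := star_smul'

/-- The continuous extension of `FinMat.reindex` to `A ⊗ K`. -/
def reindex (σ : ℕ ↪ ℕ) : Stab A → Stab A := Completion.map (FinMat.reindex σ)

theorem of_reindex (σ : ℕ ↪ ℕ) (M : FinMat A) : of (M.reindex σ) = reindex σ (of M) :=
  (Completion.map_coe (FinMat.uniformContinuous_reindex σ) M).symm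

@[fun_prop]
theorem continuous_reindex (σ : ℕ ↪ ℕ) : Continuous (reindex σ : Stab A → Stab A) := by
  have : Continuous (Completion.map (FinMat.reindex σ : FinMat A → FinMat A)) :=
    Completion.continuous_map
  exact this

theorem reindex_add (σ : ℕ ↪ ℕ) (x y : Stab A) :
    reindex σ (x + y) = reindex σ x + reindex σ y := by
  induction x, y using ind₂ with
  | hc => exact isClosed_eq (by fun_prop) (by fun_prop)
  | h M N => rw [← of_add, ← of_reindex, ← of_reindex, ← of_reindex, ← of_add, FinMat.reindex_add]

theorem reindex_zero (σ : ℕ ↪ ℕ) : reindex σ (0 : Stab A) = 0 := by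
  rw [← of_zero, ← of_reindex, FinMat.reindex_zero]

theorem reindex_mul (σ : ℕ ↪ ℕ) (x y : Stab A) :
    reindex σ (x * y) = reindex σ x * reindex σ y := by
  induction x, y using ind₂ with
  | hc => exact isClosed_eq (by fun_prop) (by fun_prop)
  | h M N => rw [← of_mul, ← of_reindex, ← of_reindex, ← of_reindex, ← of_mul, FinMat.reindex_mul]

theorem reindex_star (σ : ℕ ↪ ℕ) (x : Stab A) : reindex σ (star x) = star (reindex σ x) := by
  induction x using ind with
  | hc => exact isClosed_eq (by fun_prop) (by fun_prop)
  | h M => rw [← of_star, ← of_reindex, ← of_reindex, ← of_star, FinMat.reindex_star]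

theorem reindex_reindex (σ τ : ℕ ↪ ℕ) (x : Stab A) :
    reindex τ (reindex σ x) = reindex (σ.trans τ) x := by
  induction x using ind with
  | hc => exact isClosed_eq (by fun_prop) (by fun_prop)
  | h M => rw [← of_reindex, ← of_reindex, ← of_reindex, FinMat.reindex_reindex]

theorem reindex_refl (x : Stab A) : reindex (Function.Embedding.refl ℕ) x = x := by
  induction x using ind with
  | hc => exact isClosed_eq (by fun_prop) (by fun_prop)
  | h M => rw [← of_reindex, FinMat.reindex_refl]

theorem norm_reindex_le (σ : ℕ ↪ ℕ) (x : Stab A) : ‖reindex σ x‖ ≤ ‖x‖ := by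
  induction x using ind with
  | hc => exact isClosed_le (by fun_prop) (by fun_prop)
  | h M => rw [← of_reindex, norm_of, norm_of]; exact FinMat.norm_reindex_le σ M

theorem reindex_mul_reindex_of_disjoint {σ τ : ℕ ↪ ℕ}
    (h : Disjoint (Set.range σ) (Set.range τ)) (x y : Stab A) :
    reindex σ x * reindex τ y = 0 := by
  induction x, y using ind₂ with
  | hc => exact isClosed_eq (by fun_prop) (by fun_prop)
  | h M N =>
    rw [← of_reindex, ← of_reindex, ← of_mul, FinMat.reindex_mul_reindex_of_disjoint h, of_zero]

/-- `reindex` as an additive map. -/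
def reindexHom (σ : ℕ ↪ ℕ) : Stab A →+ Stab A where
  toFun := reindex σ
  map_zero' := reindex_zero σ
  map_add' := reindex_add σ

theorem tendsto_of_dense {a b : ℕ → Stab A} (ha : ∀ n, ‖a n‖ ≤ 1) (hb : ∀ n, ‖b n‖ ≤ 1)
    (F G : Stab A →+ Stab A) (hF : ∀ x, ‖F x‖ ≤ ‖x‖) (hG : ∀ x, ‖G x‖ ≤ ‖x‖)
    (h : ∀ M : FinMat A, ∀ᶠ n in atTop, a n * F (of M) * b n = G (of M)) (x : Stab A) :
    Tendsto (fun n => a n * F x * b n) atTop (𝓝 (G x)) := by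
  rw [Metric.tendsto_atTop]
  intro ε hε
  obtain ⟨M, hM⟩ := (denseRange_of (A := A)).exists_dist_lt x (half_pos hε)
  obtain ⟨n₀, hn₀⟩ := eventually_atTop.1 (h M)
  refine ⟨n₀, fun n hn => ?_⟩
  rw [dist_eq_norm] at hM ⊢
  have e : a n * F x * b n - G x = a n * F (x - of M) * b n - G (x - of M) := by
    have := hn₀ n hn
    rw [map_sub, map_sub, mul_sub, sub_mul, this]
    abel
  have e2 : ‖a n * F (x - of M) * b n‖ ≤ ‖x - of M‖ := by
    calc _ ≤ ‖a n‖ * ‖F (x - of M)‖ * ‖b n‖ := norm_mul₃_le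
      _ ≤ 1 * ‖x - of M‖ * 1 := by
          gcongr
          · exact ha n
          · exact hF _
          · exact hb n
      _ = _ := by ring
  rw [e]
  calc _ ≤ ‖a n * F (x - of M) * b n‖ + ‖G (x - of M)‖ := norm_sub_le _ _
    _ ≤ ‖x - of M‖ + ‖x - of M‖ := add_le_add e2 (hG _)
    _ < ε := by linarith

theorem norm_of_shift_le (σ : ℕ ↪ ℕ) (n : ℕ) : ‖of (FinMat.shift A σ n)‖ ≤ 1 := by
  rw [norm_of]; exact FinMat.norm_shift_le σ n

theorem norm_star_of_shift_le (σ : ℕ ↪ ℕ) (n : ℕ) : ‖star (of (FinMat.shift A σ n))‖ ≤ 1 := by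
  rw [norm_star]; exact norm_of_shift_le σ n

theorem tendsto_shift (σ : ℕ ↪ ℕ) (x : Stab A) :
    Tendsto (fun n => of (FinMat.shift A σ n) * x * star (of (FinMat.shift A σ n))) atTop
      (𝓝 (reindex σ x)) := by
  refine tendsto_of_dense (norm_of_shift_le σ) (norm_star_of_shift_le σ) (AddMonoidHom.id _)
    (reindexHom σ) (fun _ => le_rfl) (norm_reindex_le σ) (fun M => ?_) x
  filter_upwards [M.eventually_suppLE] with n hn
  show of (FinMat.shift A σ n) * of M * star (of (FinMat.shift A σ n)) = reindex σ (of M)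
  rw [← of_star, ← of_mul, ← of_mul, ← of_reindex, FinMat.reindex_eq σ hn]

theorem tendsto_star_shift (σ : ℕ ↪ ℕ) (x : Stab A) :
    Tendsto (fun n => star (of (FinMat.shift A σ n)) * reindex σ x * of (FinMat.shift A σ n)) atTop
      (𝓝 x) := by
  refine tendsto_of_dense (norm_star_of_shift_le σ) (norm_of_shift_le σ) (reindexHom σ)
    (AddMonoidHom.id _) (norm_reindex_le σ) (fun _ => le_rfl) (fun M => ?_) x
  filter_upwards [M.eventually_suppLE] with n hn
  show star (of (FinMat.shift A σ n)) * reindex σ (of M) * of (FinMat.shift A σ n) = of M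
  rw [← of_star, ← of_reindex, ← of_mul, ← of_mul, FinMat.star_shift_reindex σ hn]

theorem reindex_nonneg (σ : ℕ ↪ ℕ) {x : Stab A} (hx : 0 ≤ x) : 0 ≤ reindex σ x := by
  obtain ⟨y, rfl⟩ := CStarAlgebra.nonneg_iff_eq_star_mul_self.1 hx
  rw [reindex_mul, reindex_star]
  exact star_mul_self_nonneg _

end Stab

end Stab

/-! ### Cuntz subequivalence and the Cuntz semigroup -/

section Cuntz

/-- Cuntz subequivalence `a ≾_E b` in a C⋆-algebra `E`: there are `vₙ ∈ E` with
`vₙ b vₙ* → a`. -/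
def CuntzSubeq {E : Type*} [NonUnitalCStarAlgebra E] (a b : E) : Prop :=
  ∃ v : ℕ → E, Tendsto (fun n => v n * b * star (v n)) atTop (𝓝 a)

theorem CuntzSubeq.trans {E : Type*} [NonUnitalCStarAlgebra E] {a b c : E}
    (hab : CuntzSubeq a b) (hbc : CuntzSubeq b c) : CuntzSubeq a c := by
  obtain ⟨v, hv⟩ := hab
  obtain ⟨w, hw⟩ := hbc
  have h : ∀ n, ∃ m, dist (v n * w m * c * star (v n * w m)) (v n * b * star (v n)) <
      1 / ((n : ℝ) + 1) := by
    intro n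
    have h1 : Tendsto (fun m => v n * (w m * c * star (w m)) * star (v n)) atTop
        (𝓝 (v n * b * star (v n))) := (hw.const_mul (v n)).mul_const _
    obtain ⟨m, hm⟩ := (Metric.tendsto_atTop.1 h1 (1 / ((n : ℝ) + 1)) (by positivity))
    refine ⟨m, ?_⟩
    have := hm m le_rfl
    simpa only [star_mul, mul_assoc] using this
  choose m hm using h
  refine ⟨fun n => v n * w (m n), ?_⟩
  refine hv.congr_dist ?_
  refine squeeze_zero (fun _ => dist_nonneg) (fun n => ?_) tendsto_one_div_add_atTop_nhds_zero_nat
  rw [dist_comm]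
  exact (hm n).le

variable (A : Type*) [CStarAlgebra A]

/-- The positive cone `(A ⊗ K)₊`. -/
def PosStab : Type _ := {x : Stab A // 0 ≤ x}

variable {A}

namespace PosStab

theorem reindex_subeq (σ : ℕ ↪ ℕ) (x : Stab A) : CuntzSubeq (Stab.reindex σ x) x :=
  ⟨_, Stab.tendsto_shift σ x⟩

theorem subeq_reindex (σ : ℕ ↪ ℕ) (x : Stab A) : CuntzSubeq x (Stab.reindex σ x) :=
  ⟨fun n => star (Stab.of (FinMat.shift A σ n)), by
    simpa only [star_star] using Stab.tendsto_star_shift σ x⟩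

/-- `(A ⊗ K)₊` preordered by Cuntz subequivalence over `A`. -/
instance : Preorder (PosStab A) where
  le a b := CuntzSubeq a.1 b.1
  le_refl a := by
    have := reindex_subeq (Function.Embedding.refl ℕ) a.1
    rwa [Stab.reindex_refl] at this
  le_trans _ _ _ h1 h2 := h1.trans h2

theorem le_def {a b : PosStab A} : a ≤ b ↔ CuntzSubeq a.1 b.1 := Iff.rfl

/-- The injection `i ↦ 2 i`. -/
def even : ℕ ↪ ℕ := ⟨fun i => 2 * i, fun i j h => by simpa using h⟩
/-- The injection `i ↦ 2 i + 1`. -/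
def odd : ℕ ↪ ℕ := ⟨fun i => 2 * i + 1, fun i j h => by simpa using h⟩

theorem even_apply (i : ℕ) : even i = 2 * i := rfl
theorem odd_apply (i : ℕ) : odd i = 2 * i + 1 := rfl

theorem disjoint_even_odd : Disjoint (Set.range even) (Set.range odd) := by
  rw [Set.disjoint_left]
  rintro _ ⟨i, rfl⟩ ⟨j, h⟩
  rw [even_apply, odd_apply] at h
  omega

/-- The orthogonal sum `a ⊕ b`, moved back to `A ⊗ K` along the bijection of `ℕ ⊔ ℕ` with `ℕ` given
by the even and the odd numbers. -/
def dsum (a b : PosStab A) : PosStab A :=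
  ⟨Stab.reindex even a.1 + Stab.reindex odd b.1,
    add_nonneg (Stab.reindex_nonneg even a.2) (Stab.reindex_nonneg odd b.2)⟩

theorem dsum_mono {a a' b b' : PosStab A} (ha : a ≤ a') (hb : b ≤ b') :
    dsum a b ≤ dsum a' b' := by
  obtain ⟨v, hv⟩ := ha
  obtain ⟨w, hw⟩ := hb
  refine ⟨fun n => Stab.reindex even (v n) + Stab.reindex odd (w n), ?_⟩
  have h1 := (((Stab.continuous_reindex even).tendsto _).comp hv).add
    (((Stab.continuous_reindex odd).tendsto _).comp hw)
  refine h1.congr fun n => ?_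
  have e1 := Stab.reindex_mul_reindex_of_disjoint (A := A) disjoint_even_odd
  have e2 := Stab.reindex_mul_reindex_of_disjoint (A := A) disjoint_even_odd.symm
  simp only [Function.comp_apply, dsum, star_add, add_mul, mul_add, ← Stab.reindex_star, e1, e2,
    ← Stab.reindex_mul, add_zero, zero_add]

theorem antisymmRel_of_reindex (σ : ℕ ↪ ℕ) {a b : PosStab A} (h : b.1 = Stab.reindex σ a.1) :
    AntisymmRel (· ≤ ·) a b :=
  ⟨le_def.2 (by rw [h]; exact subeq_reindex σ _), le_def.2 (by rw [h]; exact reindex_subeq σ _)⟩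

/-- The zero element. -/
def zero : PosStab A := ⟨0, le_rfl⟩

theorem zero_le (a : PosStab A) : zero ≤ a :=
  ⟨fun _ => 0, by simp [zero]⟩

theorem dsum_zero (a : PosStab A) : AntisymmRel (· ≤ ·) a (dsum a zero) :=
  antisymmRel_of_reindex even (by simp [dsum, zero, Stab.reindex_zero])

/-- The permutation of `ℕ` exchanging `2 i` and `2 i + 1`. -/
def swapEmb : ℕ ↪ ℕ where
  toFun i := if i % 2 = 0 then i + 1 else i - 1
  inj' i j h := by
    simp only at h
    split_ifs at h <;> omega

theorem swapEmb_apply (i : ℕ) : swapEmb i = if i % 2 = 0 then i + 1 else i - 1 := rfl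

theorem dsum_comm (a b : PosStab A) : AntisymmRel (· ≤ ·) (dsum a b) (dsum b a) := by
  refine antisymmRel_of_reindex swapEmb ?_
  have e1 : even.trans swapEmb = odd := by
    ext i
    simp only [even_apply, odd_apply, swapEmb_apply, Function.Embedding.trans_apply]
    split_ifs <;> omega
  have e2 : odd.trans swapEmb = even := by
    ext i
    simp only [even_apply, odd_apply, swapEmb_apply, Function.Embedding.trans_apply]
    split_ifs <;> omega
  simp only [dsum, Stab.reindex_add, Stab.reindex_reindex, e1, e2]
  exact add_comm _ _

/-- The permutation `4 i ↦ 2 i`, `4 i + 2 ↦ 4 i + 1`, `2 i + 1 ↦ 4 i + 3` of `ℕ`. -/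
def assocEmb : ℕ ↪ ℕ where
  toFun i := if i % 4 = 0 then i / 2 else if i % 2 = 0 then i - 1 else 2 * i + 1
  inj' i j h := by
    simp only at h
    split_ifs at h <;> omega

theorem assocEmb_apply (i : ℕ) :
    assocEmb i = if i % 4 = 0 then i / 2 else if i % 2 = 0 then i - 1 else 2 * i + 1 := rfl

theorem dsum_assoc (a b c : PosStab A) :
    AntisymmRel (· ≤ ·) (dsum (dsum a b) c) (dsum a (dsum b c)) := by
  refine antisymmRel_of_reindex assocEmb ?_
  have e1 : (even.trans even).trans assocEmb = even := by
    ext i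
    simp only [even_apply, assocEmb_apply, Function.Embedding.trans_apply]
    split_ifs <;> omega
  have e2 : (odd.trans even).trans assocEmb = even.trans odd := by
    ext i
    simp only [even_apply, odd_apply, assocEmb_apply, Function.Embedding.trans_apply]
    split_ifs <;> omega
  have e3 : odd.trans assocEmb = odd.trans odd := by
    ext i
    simp only [odd_apply, assocEmb_apply, Function.Embedding.trans_apply]
    split_ifs <;> omega
  simp only [dsum, Stab.reindex_add, Stab.reindex_reindex, e1, e2, e3]
  exact (add_assoc _ _ _).symm

end PosStab

variable (A) in
/-- The Cuntz semigroup `Cu(A) = (A ⊗ K)₊ / ∼`, where `a ∼ b` means `a ≾ b` and `b ≾ a`. -/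
def Cu : Type _ := Antisymmetrization (PosStab A) (· ≤ ·)

namespace Cu

/-- The order: `⟨a⟩ ≤ ⟨b⟩` if and only if `a ≾ b`. -/
instance : PartialOrder (Cu A) :=
  inferInstanceAs (PartialOrder (Antisymmetrization (PosStab A) (· ≤ ·)))

/-- The class `⟨a⟩`. -/
def cls (a : PosStab A) : Cu A := toAntisymmetrization (· ≤ ·) a

theorem cls_le_cls {a b : PosStab A} : cls a ≤ cls b ↔ CuntzSubeq a.1 b.1 := Iff.rfl

theorem cls_eq_cls {a b : PosStab A} :
    cls a = cls b ↔ CuntzSubeq a.1 b.1 ∧ CuntzSubeq b.1 a.1 := by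
  rw [le_antisymm_iff, cls_le_cls, cls_le_cls]

theorem cls_eq_of_rel {a b : PosStab A} (h : AntisymmRel (· ≤ ·) a b) : cls a = cls b :=
  Quotient.sound h

theorem exists_cls (ξ : Cu A) : ∃ a, cls a = ξ := Quotient.exists_rep ξ

instance : Zero (Cu A) := ⟨cls PosStab.zero⟩

/-- The addition: `⟨a⟩ + ⟨b⟩ = ⟨a ⊕ b⟩`. -/
instance : Add (Cu A) where
  add := Quotient.map₂ PosStab.dsum fun _ _ ha _ _ hb =>
    ⟨PosStab.dsum_mono ha.1 hb.1, PosStab.dsum_mono ha.2 hb.2⟩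

theorem cls_add (a b : PosStab A) : cls a + cls b = cls (PosStab.dsum a b) := rfl
theorem zero_def : (0 : Cu A) = cls PosStab.zero := rfl

theorem add_comm' (ξ η : Cu A) : ξ + η = η + ξ := by
  obtain ⟨a, rfl⟩ := exists_cls ξ
  obtain ⟨b, rfl⟩ := exists_cls η
  exact cls_eq_of_rel (PosStab.dsum_comm a b)

theorem add_zero' (ξ : Cu A) : ξ + 0 = ξ := by
  obtain ⟨a, rfl⟩ := exists_cls ξ
  exact (cls_eq_of_rel (PosStab.dsum_zero a)).symm

theorem add_assoc' (ξ η ζ : Cu A) : ξ + η + ζ = ξ + (η + ζ) := by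
  obtain ⟨a, rfl⟩ := exists_cls ξ
  obtain ⟨b, rfl⟩ := exists_cls η
  obtain ⟨c, rfl⟩ := exists_cls ζ
  exact cls_eq_of_rel (PosStab.dsum_assoc a b c)

instance : AddCommMonoid (Cu A) where
  add_assoc := add_assoc'
  zero_add ξ := by rw [add_comm', add_zero']
  add_zero := add_zero'
  add_comm := add_comm'
  nsmul := nsmulRec

instance : IsOrderedAddMonoid (Cu A) where
  add_le_add_left ξ η h ζ := by
    obtain ⟨a, rfl⟩ := exists_cls ξ
    obtain ⟨b, rfl⟩ := exists_cls η
    obtain ⟨c, rfl⟩ := exists_cls ζ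
    exact PosStab.dsum_mono h le_rfl

end Cu

/-- `ξ <ₛ η` in an ordered semigroup: `(k + 1) ξ ≤ k η` for some integer `k > 0`. -/
def StablyBelow {S : Type*} [AddCommMonoid S] [PartialOrder S] (ξ η : S) : Prop :=
  ∃ k : ℕ, 0 < k ∧ (k + 1) • ξ ≤ k • η

/-- `n`-comparison for an ordered semigroup: if `ξ <ₛ η_j` for `j = 0, …, n`, then
`ξ ≤ η_0 + ⋯ + η_n`. -/
def OrderedSemigroupHasComparison (S : Type*) [AddCommMonoid S] [PartialOrder S] (n : ℕ) : Prop :=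
  ∀ (ξ : S) (η : Fin (n + 1) → S), (∀ j, StablyBelow ξ (η j)) → ξ ≤ ∑ j, η j

variable (A) in
/-- `n`-comparison for a C⋆-algebra `A`: the Cuntz semigroup `Cu(A)` has `n`-comparison. -/
def HasComparison (n : ℕ) : Prop := OrderedSemigroupHasComparison (Cu A) n

end Cuntz

/-! ### Simplicity, stable finiteness, large subalgebras -/

section Large

variable (A : Type*) [CStarAlgebra A]

/-- A C⋆-algebra is simple if it is nonzero and has no closed two-sided ideals other than `0` and
itself. -/
def IsSimpleCStar : Prop :=
  Nontrivial A ∧ ∀ I : TwoSidedIdeal A, IsClosed (I : Set A) → I = ⊥ ∨ I = ⊤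

/-- A unital C⋆-algebra is stably finite if in every matrix algebra `Mₙ(A)` every isometry is
unitary. -/
def IsStablyFiniteCStar : Prop :=
  ∀ (n : ℕ) (v : Matrix (Fin n) (Fin n) A), star v * v = 1 → v * star v = 1

variable {A}

/-- A closed unital ⋆-subalgebra `B` of `A` is large in `A` if for all `a₁, …, a_m ∈ A`, `ε > 0`,
`x ∈ A₊` of norm `1` and nonzero `y ∈ B₊` there are `c₁, …, c_m ∈ A` and `g ∈ B` with `0 ≤ g ≤ 1`,
`‖c_j - a_j‖ < ε`, `(1 - g) c_j ∈ B`, `g ≾_B y`, `g ≾_A x` and `‖(1 - g) x (1 - g)‖ > 1 - ε`.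
(An element of `B` is positive in `B` if and only if it is positive in `A`.) -/
def IsLarge (B : StarSubalgebra ℂ A) [IsClosed (B : Set A)] : Prop :=
  ∀ (m : ℕ) (a : Fin m → A) (ε : ℝ), 0 < ε → ∀ x : A, 0 ≤ x → ‖x‖ = 1 →
    ∀ y : B, 0 ≤ (y : A) → y ≠ 0 →
    ∃ (c : Fin m → A) (g : B), 0 ≤ (g : A) ∧ (g : A) ≤ 1 ∧
      (∀ j, ‖c j - a j‖ < ε) ∧
      (∀ j, (1 - (g : A)) * c j ∈ B) ∧
      CuntzSubeq g y ∧ CuntzSubeq (g : A) x ∧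
      1 - ε < ‖(1 - (g : A)) * x * (1 - (g : A))‖

end Large

end CuntzCu

end

noncomputable section

namespace CuntzCu

open Filter Topology UniformSpace

attribute [local instance] CStarAlgebra.spectralOrder CStarAlgebra.spectralOrderedRing

/-! ### Cuntz subequivalence, functional calculus and cut-downs -/

section CuntzBasics

variable {E : Type*} [NonUnitalCStarAlgebra E]

/-! Largeness says that finitely many elements of `A` fall into `B`, up to a small error, after
multiplication by `1 - g`, where `g` in `B` may be made Cuntz-smaller than any prescribed nonzero
positive element of `B`. So passing between `Cu(B)` and `Cu(A)` costs only a small class `⟨g⟩`. The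
cost is made precise by an algebraic trick: if `a` lives in an `n × n` corner and `h = 1 - g`
(diagonally), then `a = a(h + g)`, so `a³ = a(h + g)a(h + g)a ≤ 2 ahaha + 2 agaga`. If moreover
`hah` is close to `t`, this yields `⟨(a - ε)₊⟩ ≤ ⟨t⟩ + n⟨g⟩` (`Cu.mk_cut_le_of_compress`).

Two transfer principles follow, each up to cut-downs and an arbitrary nonzero `w` in `Cu(B)`. An
inequality in `Cu(A)` between classes coming from `Cu(B)` already holds in `Cu(B)` after adding `w`
(`IsLargeHom.le_add_of_map_le`). A class of `Cu(A)` is squeezed between one coming from `Cu(B)` and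
that class plus `w` (`IsLargeHom.exists_le_map_add`).

The error `w` must be absorbed on the right-hand side of the comparison. For this,
`Cu.exists_split_of_stablyBelow` shrinks each `η j` to `ζ j` with `ζ j + w j ≤ η j` and `w j ≠ 0`,
while cut-downs of `ξ` stay stably below `ζ j`. The shrinking works because what is removed from `η
j` fits many times into what is left, so that a strict inequality `(k + 1)ξ ≤ kη` survives with a
larger `k`.

This division needs orthogonal elements in every hereditary subalgebra: the algebra must be prime
and have no minimal element, that is, no nonzero `a` with `aEa ⊆ ℂa`. In `A`, a minimal element
together with simplicity would force finite dimension. Simplicity of `B` comes from largeness. A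
minimal element of `B` would be Cuntz-small in `A`, so that the unit would factor approximately
through a few orthogonal elements of `A` with another nonzero one left over; finiteness of `A`
forbids that (`not_exists_small`).

Given all this, comparison in `A` is pulled back to `B` by one application of the first principle,
and comparison in `B` is pushed to `A` by replacing the elements of `Cu(A)` by nearby ones from
`Cu(B)`. -/

theorem cuntzSubeq_iff {a b : E} :
    CuntzSubeq a b ↔ ∀ ε : ℝ, 0 < ε → ∃ v : E, ‖v * b * star v - a‖ < ε := by
  constructor
  · rintro ⟨v, hv⟩ ε hε
    obtain ⟨n, hn⟩ := ((Metric.tendsto_atTop.1 hv) ε hε)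
    exact ⟨v n, by simpa [dist_eq_norm] using hn n le_rfl⟩
  · intro h
    choose v hv using fun n : ℕ => h (1 / ((n : ℝ) + 1)) (by positivity)
    refine ⟨v, tendsto_iff_norm_sub_tendsto_zero.2 ?_⟩
    exact squeeze_zero (fun _ => norm_nonneg _) (fun n => (hv n).le)
      tendsto_one_div_add_atTop_nhds_zero_nat

theorem cuntzSubeq_conj (b x : E) : CuntzSubeq (x * b * star x) b :=
  ⟨fun _ => x, tendsto_const_nhds⟩

theorem cuntzSubeq_conj' (b x : E) : CuntzSubeq (star x * b * x) b := by
  simpa using cuntzSubeq_conj b (star x)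

theorem cuntzSubeq_zero (b : E) : CuntzSubeq 0 b := by simpa using cuntzSubeq_conj b 0

theorem spec_nonneg {a : E} (ha : 0 ≤ a) {t : ℝ} (ht : t ∈ quasispectrum ℝ a) : 0 ≤ t :=
  quasispectrum_nonneg_of_nonneg a ha t ht

theorem spec_le_norm {a : E} (ha : 0 ≤ a) {t : ℝ} (ht : t ∈ quasispectrum ℝ a) : t ≤ ‖a‖ :=
  (le_abs_self t).trans <|
    NonUnitalIsometricContinuousFunctionalCalculus.norm_quasispectrum_le a ht ha.isSelfAdjoint

theorem cfcₙ_nonneg_of {a : E} (ha : 0 ≤ a) {f : ℝ → ℝ} (h : ∀ t, 0 ≤ t → 0 ≤ f t) :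
    0 ≤ cfcₙ f a :=
  cfcₙ_nonneg fun t ht => h t (spec_nonneg ha ht)

/-- Continuous functions vanishing at `0`. -/
structure Vanishing (f : ℝ → ℝ) : Prop where
  continuous : Continuous f
  zero : f 0 = 0

namespace Vanishing

variable {f g : ℝ → ℝ}

theorem id : Vanishing fun t => t := ⟨continuous_id, rfl⟩
theorem mul (hf : Vanishing f) (hg : Vanishing g) : Vanishing fun t => f t * g t :=
  ⟨hf.1.mul hg.1, by rw [hf.2, zero_mul]⟩
theorem sub (hf : Vanishing f) (hg : Vanishing g) : Vanishing fun t => f t - g t :=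
  ⟨hf.1.sub hg.1, by rw [hf.2, hg.2, sub_zero]⟩
theorem const_mul (hf : Vanishing f) (r : ℝ) : Vanishing fun t => r * f t :=
  ⟨hf.1.const_mul r, by rw [hf.2, mul_zero]⟩
theorem comp (hg : Vanishing g) (hf : Vanishing f) : Vanishing fun t => g (f t) :=
  ⟨hg.1.comp hf.1, by rw [hf.2, hg.2]⟩
theorem cut {ε : ℝ} (hε : 0 ≤ ε) : Vanishing fun t => max (t - ε) 0 :=
  ⟨by fun_prop, by simp [hε]⟩

theorem cfc_mul (hf : Vanishing f) (hg : Vanishing g) (a : E) :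
    cfcₙ (fun t => f t * g t) a = cfcₙ f a * cfcₙ g a :=
  cfcₙ_mul f g a hf.1.continuousOn hf.2 hg.1.continuousOn hg.2
theorem cfc_add (hf : Vanishing f) (hg : Vanishing g) (a : E) :
    cfcₙ (fun t => f t + g t) a = cfcₙ f a + cfcₙ g a :=
  cfcₙ_add f g a hf.1.continuousOn hf.2 hg.1.continuousOn hg.2
theorem cfc_sub (hf : Vanishing f) (hg : Vanishing g) (a : E) :
    cfcₙ (fun t => f t - g t) a = cfcₙ f a - cfcₙ g a :=
  cfcₙ_sub f g a hf.1.continuousOn hf.2 hg.1.continuousOn hg.2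
theorem cfc_smul (hf : Vanishing f) (r : ℝ) (a : E) :
    cfcₙ (fun t => r * f t) a = r • cfcₙ f a :=
  cfcₙ_const_mul r f a hf.1.continuousOn hf.2
theorem cfc_comp (hg : Vanishing g) (hf : Vanishing f) {a : E} (ha : 0 ≤ a) :
    cfcₙ (fun t => g (f t)) a = cfcₙ g (cfcₙ f a) :=
  cfcₙ_comp' g f a hg.1.continuousOn hg.2 hf.1.continuousOn hf.2 ha.isSelfAdjoint
theorem cfc_mono (hf : Vanishing f) (hg : Vanishing g) {a : E} (ha : 0 ≤ a)
    (h : ∀ t, 0 ≤ t → t ≤ ‖a‖ → f t ≤ g t) : cfcₙ f a ≤ cfcₙ g a :=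
  cfcₙ_mono (fun t ht => h t (spec_nonneg ha ht) (spec_le_norm ha ht))
    hf.1.continuousOn hg.1.continuousOn hf.2 hg.2

end Vanishing

theorem cfcₙ_self {a : E} (ha : 0 ≤ a) : cfcₙ (fun t : ℝ => t) a = a :=
  cfcₙ_id' ℝ a ha.isSelfAdjoint

theorem cfcₙ_congr_nonneg {a : E} (ha : 0 ≤ a) {f g : ℝ → ℝ} (h : ∀ t, 0 ≤ t → f t = g t) :
    cfcₙ f a = cfcₙ g a :=
  cfcₙ_congr fun t ht => h t (spec_nonneg ha ht)

theorem cfcₙ_mul_mid {a : E} (ha : 0 ≤ a) {f g : ℝ → ℝ} (hf : Vanishing f) (hg : Vanishing g) :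
    cfcₙ f a * a * cfcₙ g a = cfcₙ (fun t => f t * t * g t) a := by
  rw [(hf.mul .id).cfc_mul hg, hf.cfc_mul .id, cfcₙ_self ha]

theorem star_cfcₙ (f : ℝ → ℝ) (a : E) : star (cfcₙ f a) = cfcₙ f a :=
  (cfcₙ_predicate f a : IsSelfAdjoint _).star_eq

/-- An approximate unit `w n` of the algebra generated by `b` also acts on `√a`, because `(1 - w)a(1
- w) ≤ (1 - w)b(1 - w)` in norm. Conjugating `b` by `√a c` with `cbc = w²` then gives `√a w² √a`,
which tends to `a`. -/
theorem CuntzSubeq.of_le {a b : E} (ha : 0 ≤ a) (hab : a ≤ b) : CuntzSubeq a b := by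
  have hb : 0 ≤ b := ha.trans hab
  have hbs := hb.isSelfAdjoint
  have hP : IsSelfAdjoint (CFC.sqrt a) := (CFC.sqrt_nonneg a).isSelfAdjoint
  set P := CFC.sqrt a with hPdef
  have hPP : P * P = a := CFC.sqrt_mul_sqrt_self a
  obtain ⟨y, hy⟩ := CStarAlgebra.nonneg_iff_eq_star_mul_self.1 (sub_nonneg.2 hab)
  let δ : ℕ → ℝ := fun n => 1 / ((n : ℝ) + 1)
  have hδ : ∀ n, 0 < δ n := fun n => by positivity
  -- The absolute value keeps the denominator positive on all of `ℝ`, so that the functions are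
  -- globally continuous; only `t ≥ 0` matters.
  let w : ℕ → E := fun n => cfcₙ (fun t : ℝ => t / (|t| + δ n)) b
  let c : ℕ → E := fun n => cfcₙ (fun t : ℝ => √t / (|t| + δ n)) b
  have hne : ∀ n, ∀ t : ℝ, |t| + δ n ≠ 0 := fun n t => by have := hδ n; positivity
  have hwc : ∀ n, Vanishing (fun t : ℝ => t / (|t| + δ n)) := fun n =>
    ⟨continuous_id.div (by fun_prop) (hne n), zero_div _⟩
  have hcc : ∀ n, Vanishing (fun t : ℝ => √t / (|t| + δ n)) := fun n =>
    ⟨Real.continuous_sqrt.div (by fun_prop) (hne n), by rw [Real.sqrt_zero, zero_div]⟩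
  have hws : ∀ n, star (w n) = w n := fun n => star_cfcₙ _ _
  have hcs : ∀ n, star (c n) = c n := fun n => star_cfcₙ _ _
  have hcw : ∀ n, c n * b * c n = w n * w n := by
    intro n
    have h1 := hcc n
    have h2 := hwc n
    simp only [c, w]
    rw [cfcₙ_mul_mid hb h1 h1, ← h2.cfc_mul h2]
    refine cfcₙ_congr_nonneg hb fun t ht0 => ?_
    have := Real.mul_self_sqrt ht0
    have h3 := hne n t
    show √t / (|t| + δ n) * t * (√t / (|t| + δ n)) = t / (|t| + δ n) * (t / (|t| + δ n))
    field_simp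
    linear_combination t * this
  have hbw : ∀ n, ‖b - b * w n - w n * b + w n * b * w n‖ ≤ δ n := by
    intro n
    have h2 := hwc n
    have e : b - b * w n - w n * b + w n * b * w n =
        cfcₙ (fun t : ℝ => t - t * (t / (|t| + δ n)) - (t / (|t| + δ n)) * t +
          (t / (|t| + δ n)) * t * (t / (|t| + δ n))) b := by
      simp only [w]
      rw [((Vanishing.id.sub (.mul .id h2)).sub (h2.mul .id)).cfc_add ((h2.mul .id).mul h2),
        (Vanishing.id.sub (.mul .id h2)).cfc_sub (h2.mul .id), Vanishing.id.cfc_sub (.mul .id h2),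
        ← cfcₙ_mul_mid hb h2 h2, Vanishing.id.cfc_mul h2, h2.cfc_mul .id, cfcₙ_self hb]
    rw [e]
    refine norm_cfcₙ_le fun t ht => ?_
    have ht0 := spec_nonneg hb ht
    have hd := hδ n
    rw [abs_of_nonneg ht0]
    have e2 : t - t * (t / (t + δ n)) - (t / (t + δ n)) * t + (t / (t + δ n)) * t * (t / (t + δ n))
        = t * (δ n) ^ 2 / (t + δ n) ^ 2 := by
      field_simp
      ring
    rw [e2, Real.norm_of_nonneg (by positivity), div_le_iff₀ (by positivity)]
    nlinarith [mul_nonneg ht0 hd.le, sq_nonneg t, mul_nonneg (mul_nonneg ht0 hd.le) hd.le,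
      mul_nonneg (sq_nonneg t) hd.le, pow_pos hd 3]
  -- By the C⋆-identity the square is the norm of `(1 - w)a(1 - w)`, and the difference from `(1 -
  -- w)b(1 - w)` is positive because `b - a = y*y`.
  have hle : ∀ n, ‖P - P * w n‖ * ‖P - P * w n‖ ≤ δ n := by
    intro n
    rw [← CStarRing.norm_star_mul_self]
    refine (CStarAlgebra.norm_le_norm_of_nonneg_of_le (star_mul_self_nonneg _) ?_).trans (hbw n)
    rw [← sub_nonneg]
    have e : b - b * w n - w n * b + w n * b * w n - star (P - P * w n) * (P - P * w n) =
        star (y - y * w n) * (y - y * w n) := by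
      have e1 : star (P - P * w n) * (P - P * w n) =
          a - a * w n - w n * a + w n * a * w n := by
        simp only [star_sub, star_mul, hws, hP.star_eq, ← hPP]
        noncomm_ring
      have e2 : star (y - y * w n) * (y - y * w n) =
          (b - a) - (b - a) * w n - w n * (b - a) + w n * (b - a) * w n := by
        rw [hy]
        simp only [star_sub, star_mul, hws]
        noncomm_ring
      rw [e1, e2]
      noncomm_ring
    rw [e]
    exact star_mul_self_nonneg _
  have hlim : Tendsto (fun n => P * w n) atTop (𝓝 P) := by
    rw [tendsto_iff_norm_sub_tendsto_zero]
    have h0 : Tendsto (fun n => √(δ n)) atTop (𝓝 0) := by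
      have := (Real.continuous_sqrt.tendsto 0).comp
        (tendsto_one_div_add_atTop_nhds_zero_nat (𝕜 := ℝ))
      rwa [Real.sqrt_zero] at this
    refine squeeze_zero (fun _ => norm_nonneg _) (fun n => ?_) h0
    rw [norm_sub_rev]
    exact Real.le_sqrt_of_sq_le (by rw [sq]; exact hle n)
  refine ⟨fun n => P * c n, ?_⟩
  have h2 := hlim.mul hlim.star
  rw [hP.star_eq, hPP] at h2
  refine h2.congr fun n => ?_
  have := hcw n
  simp only [star_mul, hws, hcs, hP.star_eq]
  calc P * w n * (w n * P) = P * (w n * w n) * P := by noncomm_ring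
    _ = P * (c n * b * c n) * P := by rw [hcw]
    _ = _ := by noncomm_ring

theorem CuntzSubeq.refl {a : E} (ha : 0 ≤ a) : CuntzSubeq a a := .of_le ha le_rfl

theorem cuntzSubeq_smul {a : E} (ha : 0 ≤ a) {r : ℝ} (hr : 0 ≤ r) : CuntzSubeq (r • a) a := by
  obtain ⟨v, hv⟩ := CuntzSubeq.refl ha
  refine ⟨fun n => √r • v n, (hv.const_smul r).congr fun n => ?_⟩
  simp only [star_smul, star_trivial, smul_mul_assoc, mul_smul_comm, smul_smul,
    Real.mul_self_sqrt hr]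

theorem CuntzSubeq.of_le_smul {a b : E} (ha : 0 ≤ a) (hb : 0 ≤ b) {r : ℝ} (hr : 0 ≤ r)
    (h : a ≤ r • b) : CuntzSubeq a b :=
  (CuntzSubeq.of_le ha h).trans (cuntzSubeq_smul hb hr)

/-- Functions of `a` are compared pointwise. -/
theorem cuntzSubeq_cfcₙ {a : E} (ha : 0 ≤ a) {f g : ℝ → ℝ} (hf : Vanishing f) (hg : Vanishing g)
    (hf' : ∀ t, 0 ≤ t → 0 ≤ f t) {r : ℝ} (hr : 0 < r)
    (h : ∀ t, 0 ≤ t → t ≤ ‖a‖ → f t ≤ r * g t) : CuntzSubeq (cfcₙ f a) (cfcₙ g a) := by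
  have hsa := ha.isSelfAdjoint
  refine CuntzSubeq.of_le_smul (cfcₙ_nonneg_of ha hf')
    (cfcₙ_nonneg fun t ht => ?_) hr.le ?_
  · have h0 := spec_nonneg ha ht
    have := (hf' t h0).trans (h t h0 (spec_le_norm ha ht))
    exact nonneg_of_mul_nonneg_right this hr
  · rw [← hg.cfc_smul]
    exact hf.cfc_mono (hg.const_mul r) ha h

theorem cuntzSubeq_mul_self {a : E} (ha : 0 ≤ a) : CuntzSubeq (a * a) a := by
  have h := cuntzSubeq_conj a (CFC.sqrt a)
  rw [(CFC.sqrt_nonneg a).isSelfAdjoint.star_eq] at h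
  have e : CFC.sqrt a * a * CFC.sqrt a = a * a := by
    calc CFC.sqrt a * a * CFC.sqrt a
        = CFC.sqrt a * (CFC.sqrt a * CFC.sqrt a) * CFC.sqrt a := by
          rw [CFC.sqrt_mul_sqrt_self a]
      _ = (CFC.sqrt a * CFC.sqrt a) * (CFC.sqrt a * CFC.sqrt a) := by simp only [mul_assoc]
      _ = a * a := by rw [CFC.sqrt_mul_sqrt_self a]
  rwa [e] at h

/-- The cut-down `(a - ε)₊`. -/
def cut (a : E) (ε : ℝ) : E := cfcₙ (fun t : ℝ => max (t - ε) 0) a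

theorem cut_nonneg {a : E} (ε : ℝ) : 0 ≤ cut a ε :=
  cfcₙ_nonneg fun _ _ => le_max_right _ _

theorem cut_le {a : E} (ha : 0 ≤ a) {ε : ℝ} (hε : 0 ≤ ε) : cut a ε ≤ a := by
  conv_rhs => rw [← cfcₙ_self ha]
  exact (Vanishing.cut hε).cfc_mono .id ha fun t ht _ => max_le (by linarith) ht

theorem norm_sub_cut_le {a : E} (ha : 0 ≤ a) {ε : ℝ} (hε : 0 ≤ ε) : ‖a - cut a ε‖ ≤ ε := by
  have e : a - cut a ε = cfcₙ (fun t : ℝ => t - max (t - ε) 0) a := by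
    rw [Vanishing.id.cfc_sub (.cut hε), cfcₙ_self ha]
    rfl
  rw [e]
  refine norm_cfcₙ_le fun t ht => ?_
  have := spec_nonneg ha ht
  rw [Real.norm_eq_abs, abs_le]
  constructor <;> rcases max_cases (t - ε) 0 with h | h <;> linarith

theorem cut_cut {a : E} (ha : 0 ≤ a) {ε δ : ℝ} (hε : 0 ≤ ε) (hδ : 0 ≤ δ) :
    cut (cut a ε) δ = cut a (ε + δ) := by
  unfold cut
  rw [← (Vanishing.cut hδ).cfc_comp (.cut hε) ha]
  refine cfcₙ_congr fun t _ => ?_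
  show max (max (t - ε) 0 - δ) 0 = max (t - (ε + δ)) 0
  rcases max_cases (t - ε) 0 with h | h <;> rcases max_cases (t - (ε + δ)) 0 with h' | h' <;>
    rcases max_cases (max (t - ε) 0 - δ) 0 with h'' | h'' <;> linarith

theorem cut_subeq {a : E} (ha : 0 ≤ a) {ε : ℝ} (hε : 0 ≤ ε) : CuntzSubeq (cut a ε) a :=
  .of_le (cut_nonneg ε) (cut_le ha hε)

theorem cut_anti {a : E} (ha : 0 ≤ a) {ε δ : ℝ} (hε : 0 ≤ ε) (h : ε ≤ δ) :
    CuntzSubeq (cut a δ) (cut a ε) := by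
  have := cut_subeq (cut_nonneg (a := a) ε) (sub_nonneg.2 h)
  rwa [cut_cut ha hε (sub_nonneg.2 h), add_sub_cancel] at this

/-- A cut-down by `ε` is within `ε` of `a`, so elements implementing the comparison for the
cut-downs also implement it for `a`. -/
theorem CuntzSubeq.of_cut {a b : E} (ha : 0 ≤ a) (h : ∀ ε : ℝ, 0 < ε → CuntzSubeq (cut a ε) b) :
    CuntzSubeq a b := by
  refine cuntzSubeq_iff.2 fun ε hε => ?_
  obtain ⟨v, hv⟩ := cuntzSubeq_iff.1 (h (ε / 2) (half_pos hε)) (ε / 2) (half_pos hε)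
  refine ⟨v, ?_⟩
  have h1 := norm_sub_cut_le ha (half_pos hε).le
  calc _ = ‖(v * b * star v - cut a (ε / 2)) - (a - cut a (ε / 2))‖ := by congr 1; abel
    _ ≤ _ := norm_sub_le _ _
    _ < ε := by linarith

/-- Rørdam's lemma: small perturbations dominate the cut-down. -/
theorem cut_subeq_of_le_of_norm {a c b : E} (ha : 0 ≤ a) (hb : 0 ≤ b) (hac : a ≤ c) {ε : ℝ}
    (h : ‖c - b‖ < ε) : CuntzSubeq (cut a ε) b := by
  have hsa := ha.isSelfAdjoint
  set r := ‖c - b‖ with hr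
  have hr0 : 0 ≤ r := norm_nonneg _
  -- Chosen so that `φ(t)²(t - r) = (t - ε)₊`; the maximum in the denominator changes nothing where
  -- the numerator is nonzero and keeps it positive elsewhere. With `e = φ(a)` the cut-down is `eae
  -- - r e²`, which is at most `ece - r e² ≤ ebe`.
  let φ : ℝ → ℝ := fun t => √(max (t - ε) 0 / max (t - r) (ε - r))
  have hden : ∀ t : ℝ, 0 < max (t - r) (ε - r) := fun t => lt_max_of_lt_right (by linarith)
  have hε0 : 0 ≤ ε := hr0.trans h.le
  have hφ : Vanishing φ := by
    refine ⟨Real.continuous_sqrt.comp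
      ((Vanishing.cut hε0).1.div (by fun_prop) fun t => (hden t).ne'), ?_⟩
    show √(max (0 - ε) 0 / max (0 - r) (ε - r)) = 0
    rw [(Vanishing.cut hε0).2, zero_div, Real.sqrt_zero]
  have hφφ : ∀ t, φ t * φ t * (t - r) = max (t - ε) 0 := by
    intro t
    rw [Real.mul_self_sqrt (div_nonneg (le_max_right _ _) (hden t).le), div_mul_eq_mul_div,
      div_eq_iff (hden t).ne']
    rcases le_total t ε with ht | ht
    · rw [max_eq_right (by linarith : t - ε ≤ 0)]; simp
    · rw [max_eq_left (by linarith : ε - r ≤ t - r)]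
  set e := cfcₙ φ a with he
  have hes : star e = e := star_cfcₙ _ _
  have hcut : cut a ε = e * a * e - r • (e * e) := by
    rw [he, cfcₙ_mul_mid ha hφ hφ, ← hφ.cfc_mul hφ, ← (hφ.mul hφ).cfc_smul r,
      ← ((hφ.mul .id).mul hφ).cfc_sub ((hφ.mul hφ).const_mul r)]
    refine cfcₙ_congr fun t _ => ?_
    rw [← hφφ t]
    ring
  have hcs : IsSelfAdjoint (c - b) := by
    have := (sub_nonneg.2 hac).isSelfAdjoint
    have h2 := (this.add hsa).sub hb.isSelfAdjoint
    simpa using h2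
  have h1 := CStarAlgebra.star_right_conjugate_le_norm_smul (a := e) (b := c - b) hcs
  rw [hes, ← hr] at h1
  have h2 : e * a * e ≤ e * c * e := by
    have := star_right_conjugate_le_conjugate hac e
    rwa [hes] at this
  refine (CuntzSubeq.of_le (cut_nonneg ε) (b := e * b * e) ?_).trans ?_
  · rw [hcut, sub_le_iff_le_add]
    refine h2.trans ?_
    have : e * c * e = e * b * e + e * (c - b) * e := by noncomm_ring
    rw [this]
    gcongr
  · have := cuntzSubeq_conj b e
    rwa [hes] at this

theorem cut_subeq_of_norm_lt {a b : E} (ha : 0 ≤ a) (hb : 0 ≤ b) {ε : ℝ} (h : ‖a - b‖ < ε) :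
    CuntzSubeq (cut a ε) b :=
  cut_subeq_of_le_of_norm ha hb le_rfl h

theorem cut_add_subeq_cut {a b : E} (ha : 0 ≤ a) (hb : 0 ≤ b) {ε δ : ℝ} (hε : 0 ≤ ε)
    (h : ‖a - b‖ < δ) : CuntzSubeq (cut a (ε + δ)) (cut b ε) := by
  refine cut_subeq_of_norm_lt ha (cut_nonneg _) ?_
  have h1 := norm_sub_cut_le hb hε
  calc _ = ‖(a - b) + (b - cut b ε)‖ := by congr 1; abel
    _ ≤ _ := norm_add_le _ _
    _ < _ := by linarith

/-- If `a ≾ b` then every cut-down of `a` is dominated by a cut-down of `b`. -/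
theorem CuntzSubeq.exists_cut {a b : E} (ha : 0 ≤ a) (hb : 0 ≤ b) (h : CuntzSubeq a b) {ε : ℝ}
    (hε : 0 < ε) : ∃ δ : ℝ, 0 < δ ∧ CuntzSubeq (cut a ε) (cut b δ) := by
  obtain ⟨v, hv⟩ := cuntzSubeq_iff.1 h (ε / 2) (half_pos hε)
  have hpos : 0 < ‖v‖ * ‖v‖ + 1 := by positivity
  -- Makes `‖v‖² δ ≤ ε / 2`, so cutting `b` by `δ` moves `v b v*` by at most `ε / 2`.
  let δ := ε / 2 / (‖v‖ * ‖v‖ + 1)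
  have hδ : 0 < δ := by positivity
  refine ⟨δ, hδ, (cut_subeq_of_norm_lt ha (star_right_conjugate_nonneg (cut_nonneg δ) v)
    ?_).trans (cuntzSubeq_conj _ v)⟩
  have h1 := norm_sub_cut_le hb hδ.le
  have h2 : ‖v * (b - cut b δ) * star v‖ ≤ ε / 2 := by
    calc _ ≤ ‖v‖ * ‖b - cut b δ‖ * ‖star v‖ := norm_mul₃_le
      _ ≤ ‖v‖ * δ * ‖v‖ := by rw [norm_star]; gcongr
      _ = δ * (‖v‖ * ‖v‖) := by ring
      _ ≤ δ * (‖v‖ * ‖v‖ + 1) := by gcongr; linarith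
      _ = ε / 2 := div_mul_cancel₀ _ hpos.ne'
  rw [norm_sub_rev] at hv
  calc _ = ‖(a - v * b * star v) + v * (b - cut b δ) * star v‖ := by congr 1; noncomm_ring
    _ ≤ _ := norm_add_le _ _
    _ < ε := by linarith

/-- By compactness `f` has a positive minimum on `[ε, ‖a‖]`, so `(t - ε)₊` is bounded there by a
multiple of `f`; the cut-down ignores the rest of the spectrum. -/
theorem cuntzSubeq_of_cfcₙ {a : E} (ha : 0 ≤ a) {f : ℝ → ℝ} (hf : Vanishing f)
    (hpos : ∀ t, 0 < t → 0 < f t) : CuntzSubeq a (cfcₙ f a) := by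
  have hf' : ∀ t, 0 ≤ t → 0 ≤ f t := fun t ht => by
    rcases ht.eq_or_lt with rfl | h
    · exact hf.2.ge
    · exact (hpos t h).le
  refine .of_cut ha fun ε hε => ?_
  rcases le_or_gt ε ‖a‖ with hle | hlt
  · obtain ⟨x, hx, hmin⟩ := (isCompact_Icc (a := ε) (b := ‖a‖)).exists_isMinOn
      (Set.nonempty_Icc.2 hle) hf.1.continuousOn
    have hfx : 0 < f x := hpos x (hε.trans_le hx.1)
    refine cuntzSubeq_cfcₙ ha (.cut hε.le) hf
      (fun _ _ => le_max_right _ _) (r := (‖a‖ + 1) / f x) (by positivity) fun t ht ht' => ?_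
    rcases le_total t ε with h | h
    · rw [max_eq_right (by linarith)]
      have := hf' t ht
      positivity
    · have h1 : f x ≤ f t := hmin ⟨h, ht'⟩
      calc max (t - ε) 0 ≤ ‖a‖ + 1 := max_le (by linarith) (by positivity)
        _ = (‖a‖ + 1) / f x * f x := (div_mul_cancel₀ _ hfx.ne').symm
        _ ≤ _ := by gcongr
  · have : cut a ε = 0 := by
      unfold cut
      rw [← cfcₙ_const_zero ℝ a]
      refine cfcₙ_congr fun t ht => max_eq_right ?_
      have := spec_le_norm ha ht
      linarith
    rw [this]
    exact cuntzSubeq_zero _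

theorem Vanishing.cube : Vanishing fun t => t * t * t := (Vanishing.id.mul .id).mul .id

theorem cfcₙ_cube {a : E} (ha : 0 ≤ a) : cfcₙ (fun t : ℝ => t * t * t) a = a * a * a := by
  rw [(Vanishing.id.mul .id).cfc_mul .id, Vanishing.id.cfc_mul .id, cfcₙ_self ha]

theorem cuntzSubeq_cube {a : E} (ha : 0 ≤ a) : CuntzSubeq a (a * a * a) := by
  rw [← cfcₙ_cube ha]
  exact cuntzSubeq_of_cfcₙ ha .cube fun t ht => by positivity

theorem cube_nonneg {a : E} (ha : 0 ≤ a) : 0 ≤ a * a * a := by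
  have := star_right_conjugate_nonneg ha a
  rwa [ha.isSelfAdjoint.star_eq] at this

/-- Where `t ≥ ε`, the function `(t³ - δ)₊` is at least `ε³ - δ > 0`. -/
theorem cut_subeq_cut_cube {a : E} (ha : 0 ≤ a) {ε δ : ℝ} (hδ : 0 ≤ δ) (hε : 0 < ε)
    (h : δ < ε ^ 3) : CuntzSubeq (cut a ε) (cut (a * a * a) δ) := by
  have e : cut (a * a * a) δ = cfcₙ (fun t : ℝ => max (t * t * t - δ) 0) a := by
    rw [cut, ← cfcₙ_cube ha, ← (Vanishing.cut hδ).cfc_comp .cube ha]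
  rw [e]
  have hpos : 0 < ε ^ 3 - δ := by linarith
  refine cuntzSubeq_cfcₙ ha (.cut hε.le) ((Vanishing.cut hδ).comp .cube)
    (fun _ _ => le_max_right _ _) (r := (‖a‖ + 1) / (ε ^ 3 - δ))
    (by positivity) fun t ht ht' => ?_
  rcases le_total t ε with h1 | h1
  · rw [max_eq_right (by linarith)]
    positivity
  · have h2 : ε ^ 3 ≤ t * t * t := by
      calc ε ^ 3 ≤ t ^ 3 := by gcongr
        _ = _ := by ring
    calc max (t - ε) 0 ≤ ‖a‖ + 1 := max_le (by linarith) (by positivity)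
      _ = (‖a‖ + 1) / (ε ^ 3 - δ) * (ε ^ 3 - δ) := (div_mul_cancel₀ _ hpos.ne').symm
      _ ≤ _ := by
        gcongr
        exact le_max_of_le_left (by linarith)

/-- A parallelogram identity: with `a³ = a(h + g)a(h + g)a`, the right side minus the left is the
positive element `a(h - g) a (h - g)a`. Cubing puts a copy of `a` between the two factors `h + g`.
-/
theorem cube_le {a h g : E} (ha : 0 ≤ a) (hh : star h = h) (hg : star g = g)
    (hhg : a * (h + g) = a) :
    a * a * a ≤ (2 : ℝ) • (a * h * a * h * a) + (2 : ℝ) • (a * g * a * g * a) := by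
  have hsa := ha.isSelfAdjoint.star_eq
  have hhg' : (h + g) * a = a := by
    have := congrArg star hhg
    rwa [star_mul, star_add, hh, hg, hsa] at this
  rw [← sub_nonneg]
  have key : (2 : ℝ) • (a * h * a * h * a) + (2 : ℝ) • (a * g * a * g * a) - a * a * a =
      (a * (h - g)) * a * star (a * (h - g)) := by
    have e1 : a * a * a = a * (h + g) * a * ((h + g) * a) := by rw [hhg, hhg']
    rw [e1, star_mul, star_sub, hh, hg, hsa, two_smul, two_smul]
    noncomm_ring
  rw [key]
  exact star_right_conjugate_nonneg ha _

/-- A positive element `a` with `a (h + g) = a` is dominated by `h a h` and `g`. -/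
theorem cut_subeq_of_compress {a h g t : E} (ha : 0 ≤ a) (ht : 0 ≤ t) (hh : star h = h)
    (hg : star g = g) (hhg : a * (h + g) = a) {ε r : ℝ} (hε : 0 < ε)
    (hr : ‖h * a * h - t‖ ≤ r) (hrε : 2 * r * ‖a‖ ^ 2 < ε ^ 3 / 2) :
    CuntzSubeq (cut a ε) ((2 : ℝ) • (a * t * a) + (2 : ℝ) • (a * g * a * g * a)) := by
  have hsa := ha.isSelfAdjoint.star_eq
  have h3 : 0 < ε ^ 3 := by positivity
  -- Half of `ε³` is the tolerance for replacing `hah` by `t` inside `2 ahaha`; that replacement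
  -- costs at most `2r‖a‖²`.
  refine (cut_subeq_cut_cube ha (δ := ε ^ 3 / 2) (by positivity) hε (by linarith)).trans ?_
  refine cut_subeq_of_le_of_norm (cube_nonneg ha) ?_ (cube_le ha hh hg hhg) ?_
  · have h1 := star_right_conjugate_nonneg ht a
    have h2 := star_right_conjugate_nonneg ha (a * g)
    rw [hsa] at h1
    rw [star_mul, hsa, hg] at h2
    have h2' : 0 ≤ a * g * a * g * a := by simpa only [mul_assoc] using h2
    exact add_nonneg (smul_nonneg (by norm_num) h1) (smul_nonneg (by norm_num) h2')
  · calc _ = ‖(2 : ℝ) • (a * (h * a * h - t) * a)‖ := by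
          congr 1
          simp only [mul_sub, sub_mul, smul_sub, mul_assoc]
          abel
      _ ≤ 2 * (‖a‖ * ‖h * a * h - t‖ * ‖a‖) := by
          rw [norm_smul]
          simp only [Real.norm_ofNat]
          gcongr
          exact norm_mul₃_le
      _ ≤ 2 * (‖a‖ * r * ‖a‖) := by gcongr
      _ = 2 * r * ‖a‖ ^ 2 := by ring
      _ < _ := hrε

end CuntzBasics

/-! ### Matrix units, diagonal embeddings and orthogonal sums in the stabilization -/

section Singles

variable {A : Type*} [CStarAlgebra A]

namespace FinMat

/-- The matrix with `(i, j)` entry `a` and all other entries zero. -/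
def single (i j : ℕ) (a : A) : FinMat A :=
  mk (fun k l => if k = i ∧ l = j then a else 0)
    ⟨max (i + 1) (j + 1), fun k l h => if_neg (by omega)⟩

theorem entry_single (i j : ℕ) (a : A) (k l : ℕ) :
    (single i j a).entry k l = if k = i ∧ l = j then a else 0 := rfl

theorem entry_single_mul (i j : ℕ) (a : A) (M : FinMat A) (k l : ℕ) :
    (single i j a * M).entry k l = if k = i then a * M.entry j l else 0 := by
  rw [entry_mul, finsum_eq_single _ j]
  · by_cases h : k = i <;> simp [entry_single, h]
  · intro m hm
    simp [entry_single, hm]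

theorem single_add (i j : ℕ) (a b : A) : single i j (a + b) = single i j a + single i j b :=
  ext' fun k l => by by_cases h : k = i ∧ l = j <;> simp [entry_single, h]

theorem single_zero (i j : ℕ) : single i j (0 : A) = 0 :=
  ext' fun k l => by simp [entry_single]

theorem single_smul (i j : ℕ) (c : ℂ) (a : A) : single i j (c • a) = c • single i j a :=
  ext' fun k l => by by_cases h : k = i ∧ l = j <;> simp [entry_single, h]

theorem star_single (i j : ℕ) (a : A) : star (single i j a) = single j i (star a) :=
  ext' fun k l => by
    by_cases h : l = i ∧ k = j
    · simp [entry_single, h]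
    · rw [entry_star, entry_single, if_neg h, entry_single, if_neg (by tauto), star_zero]

theorem single_mul_single (i j k : ℕ) (a b : A) :
    single i j a * single j k b = single i k (a * b) :=
  ext' fun p q => by
    rw [entry_single_mul]
    by_cases h1 : p = i <;> by_cases h2 : q = k <;> simp [entry_single, h1, h2]

/-- The diagonal matrix `a ⊕ ⋯ ⊕ a ⊕ 0 ⊕ ⋯` with `n` entries equal to `a`. -/
def diag (n : ℕ) (a : A) : FinMat A :=
  mk (fun k l => if k = l ∧ k < n then a else 0) ⟨n, fun k l h => if_neg (by omega)⟩

theorem entry_diag (n : ℕ) (a : A) (k l : ℕ) :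
    (diag n a).entry k l = if k = l ∧ k < n then a else 0 := rfl

theorem entry_diag_mul (n : ℕ) (a : A) (M : FinMat A) (k l : ℕ) :
    (diag n a * M).entry k l = if k < n then a * M.entry k l else 0 := by
  rw [entry_mul, finsum_eq_single _ k]
  · by_cases h : k < n <;> simp [entry_diag, h]
  · intro m hm
    simp [entry_diag, hm.symm]

theorem diag_add (n : ℕ) (a b : A) : diag n (a + b) = diag n a + diag n b :=
  ext' fun k l => by
    rw [entry_add, entry_diag, entry_diag, entry_diag]
    split_ifs <;> simp

theorem diag_zero (n : ℕ) : diag n (0 : A) = 0 :=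
  ext' fun k l => by simp [entry_diag]

theorem diag_smul (n : ℕ) (c : ℂ) (a : A) : diag n (c • a) = c • diag n a :=
  ext' fun k l => by by_cases h : k = l ∧ k < n <;> simp [entry_diag, h]

theorem diag_star (n : ℕ) (a : A) : diag n (star a) = star (diag n a) :=
  ext' fun k l => by
    by_cases h : k = l
    · subst h; by_cases h' : k < n <;> simp [entry_diag, h']
    · simp [entry_diag, h, Ne.symm h]

theorem diag_mul (n : ℕ) (a b : A) : diag n (a * b) = diag n a * diag n b :=
  ext' fun k l => by
    rw [entry_diag_mul, entry_diag, entry_diag]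
    by_cases h2 : k < n <;> simp [h2]

theorem diag_succ (n : ℕ) (a : A) : diag (n + 1) a = diag n a + single n n a :=
  ext' fun k l => by
    rw [entry_add, entry_diag, entry_diag, entry_single]
    by_cases h1 : k = l
    · subst h1
      rcases lt_trichotomy k n with h | h | h
      · simp [h, h.ne, h.trans (Nat.lt_succ_self n)]
      · simp [h]
      · rw [if_neg (by omega), if_neg (by omega), if_neg (by omega), add_zero]
    · rw [if_neg (by tauto), if_neg (by tauto), if_neg (by omega), add_zero]

theorem diag_one_mul {n : ℕ} {M : FinMat A} (hM : SuppLE n M) : diag n 1 * M = M :=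
  ext' fun k l => by
    rw [entry_diag_mul]
    split_ifs with h
    · rw [one_mul]
    · exact (hM k l (Or.inl (by omega))).symm

theorem diag_one (n : ℕ) : diag n (1 : A) = shift A (Function.Embedding.refl ℕ) n :=
  ext' fun k l => by
    rw [entry_diag, entry_shift]
    congr 1
    simp only [Function.Embedding.refl_apply, eq_iff_iff]
    constructor <;> rintro ⟨h1, h2⟩ <;> constructor <;> omega

theorem star_shift_mul_reindex {σ τ : ℕ ↪ ℕ} (h : Disjoint (Set.range σ) (Set.range τ)) (n : ℕ)
    (M : FinMat A) : star (shift A σ n) * reindex τ M = 0 := by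
  refine ext' fun i j => ?_
  rw [entry_mul]
  refine finsum_eq_zero_of_forall_eq_zero fun k => ?_
  by_cases hk : k = σ i
  · rw [entry_reindex_left τ M, mul_zero]
    rw [hk]
    exact Set.disjoint_left.1 h ⟨i, rfl⟩
  · simp [entry_shift, hk]

end FinMat

namespace Stab

/-- The elementary tensor `a ⊗ e_{ij}`. -/
def single (i j : ℕ) (a : A) : Stab A := of (FinMat.single i j a)

theorem of_injective : Function.Injective (of : FinMat A → Stab A) := isometry_of.injective

theorem single_add (i j : ℕ) (a b : A) : single i j (a + b) = single i j a + single i j b := by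
  rw [single, FinMat.single_add, of_add]; rfl

theorem single_zero (i j : ℕ) : single i j (0 : A) = 0 := by
  rw [single, FinMat.single_zero, of_zero]

theorem single_smul (i j : ℕ) (c : ℂ) (a : A) : single i j (c • a) = c • single i j a := by
  rw [single, FinMat.single_smul, of_smul]; rfl

theorem star_single (i j : ℕ) (a : A) : star (single i j a) = single j i (star a) := by
  rw [single, ← of_star, FinMat.star_single]; rfl

theorem single_mul_single (i j k : ℕ) (a b : A) :
    single i j a * single j k b = single i k (a * b) := by
  rw [single, single, ← of_mul, FinMat.single_mul_single]; rfl

theorem single_injective (i j : ℕ) : Function.Injective (single i j : A → Stab A) := by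
  intro a b h
  have := congrArg (fun M => M.entry i j) (of_injective h)
  simpa [FinMat.entry_single] using this

/-- The embedding `a ↦ a ⊗ e_{ii}`. -/
def singleHom (i : ℕ) : A →⋆ₙₐ[ℂ] Stab A where
  toFun := single i i
  map_smul' := single_smul i i
  map_zero' := single_zero i i
  map_add' := single_add i i
  map_mul' a b := (single_mul_single i i i a b).symm
  map_star' a := (star_single i i a).symm

theorem norm_single (i j : ℕ) (a : A) : ‖single i j a‖ = ‖a‖ := by
  have h : ∀ b : A, ‖single j j b‖ = ‖b‖ :=
    NonUnitalStarAlgHom.norm_map (singleHom j) (single_injective j j)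
  have h1 : ‖single i j a‖ * ‖single i j a‖ = ‖a‖ * ‖a‖ := by
    rw [← CStarRing.norm_star_mul_self, star_single, single_mul_single, h,
      CStarRing.norm_star_mul_self]
  exact (mul_self_inj (norm_nonneg _) (norm_nonneg _)).1 h1

theorem continuous_single (i j : ℕ) : Continuous (single i j : A → Stab A) :=
  (AddMonoidHomClass.isometry_of_norm
    (⟨⟨single i j, single_zero i j⟩, single_add i j⟩ : A →+ Stab A) (norm_single i j)).continuous

theorem single_nonneg (i : ℕ) {a : A} (ha : 0 ≤ a) : 0 ≤ single i i a := by
  obtain ⟨y, rfl⟩ := CStarAlgebra.nonneg_iff_eq_star_mul_self.1 ha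
  rw [← single_mul_single i i i, ← star_single]
  exact star_mul_self_nonneg _

/-- The embedding `a ↦ a ⊗ (e_{00} + ⋯ + e_{n-1,n-1})`. -/
def diagHom (n : ℕ) : A →⋆ₙₐ[ℂ] Stab A where
  toFun a := of (FinMat.diag n a)
  map_smul' c a := by rw [FinMat.diag_smul, of_smul]; rfl
  map_zero' := by rw [FinMat.diag_zero, of_zero]
  map_add' a b := by rw [FinMat.diag_add, of_add]
  map_mul' a b := by rw [FinMat.diag_mul, of_mul]
  map_star' a := by rw [FinMat.diag_star, of_star]

theorem diagHom_apply (n : ℕ) (a : A) : diagHom n a = of (FinMat.diag n a) := rfl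

theorem diagHom_succ (n : ℕ) (a : A) : diagHom (n + 1) a = diagHom n a + single n n a := by
  rw [diagHom_apply, FinMat.diag_succ, of_add]; rfl

theorem norm_diagHom_le (n : ℕ) (a : A) : ‖diagHom n a‖ ≤ ‖a‖ :=
  NonUnitalStarAlgHom.norm_apply_le (diagHom n) a

theorem diagHom_nonneg (n : ℕ) {a : A} (ha : 0 ≤ a) : 0 ≤ diagHom n a := by
  obtain ⟨y, rfl⟩ := CStarAlgebra.nonneg_iff_eq_star_mul_self.1 ha
  rw [map_mul, map_star]
  exact star_mul_self_nonneg _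

theorem tendsto_diagHom (x : Stab A) :
    Tendsto (fun n => diagHom n (1 : A) * x * diagHom n (1 : A)) atTop (𝓝 x) := by
  have h := tendsto_shift (Function.Embedding.refl ℕ) x
  rw [reindex_refl] at h
  refine h.congr fun n => ?_
  rw [diagHom_apply, FinMat.diag_one, ← of_star, FinMat.star_shift_refl]

/-- If all columns of `x` vanished, then `x` would kill every finite diagonal unit, and `x*x`, the
limit of its compressions by these units, would be zero. -/
theorem exists_mul_single_ne_zero {x : Stab A} (hx : x ≠ 0) :
    ∃ i, x * single i 0 1 ≠ 0 := by
  by_contra! h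
  have h1 : ∀ n, x * diagHom n (1 : A) = 0 := by
    intro n
    induction n with
    | zero =>
      have : diagHom 0 (1 : A) = 0 := by
        rw [diagHom_apply, ← of_zero]
        exact congrArg of (FinMat.ext' fun k l => if_neg (by omega))
      rw [this, mul_zero]
    | succ n ih =>
      rw [diagHom_succ, mul_add, ih, zero_add]
      have : single n n (1 : A) = single n 0 1 * single 0 n 1 := by
        rw [single_mul_single, one_mul]
      rw [this, ← mul_assoc, h, zero_mul]
  have h2 := tendsto_diagHom (star x * x)
  have h3 : ∀ n, diagHom n (1 : A) * (star x * x) * diagHom n (1 : A) = 0 := fun n => by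
    rw [mul_assoc, mul_assoc, h1, mul_zero, mul_zero]
  simp only [h3] at h2
  exact hx (CStarRing.star_mul_self_eq_zero_iff _ |>.1 (tendsto_nhds_unique h2 tendsto_const_nhds))

theorem of_eq_sum {n : ℕ} {M : FinMat A} (hM : M.SuppLE n) :
    of M = ∑ i : Fin n, ∑ j : Fin n, single i j (M.entry i j) := by
  have h : M = ∑ i : Fin n, ∑ j : Fin n, FinMat.single (i : ℕ) (j : ℕ) (M.entry i j) := by
    let F (k l : ℕ) : FinMat A →+ A := ⟨⟨fun N => N.entry k l, rfl⟩, fun _ _ => rfl⟩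
    refine FinMat.ext' fun k l => ?_
    have e : (∑ i : Fin n, ∑ j : Fin n, FinMat.single (i : ℕ) (j : ℕ) (M.entry i j)).entry k l =
        ∑ i : Fin n, ∑ j : Fin n, (FinMat.single (i : ℕ) (j : ℕ) (M.entry i j)).entry k l := by
      show F k l (∑ i : Fin n, ∑ j : Fin n, FinMat.single (i : ℕ) (j : ℕ) (M.entry i j)) =
        ∑ i : Fin n, ∑ j : Fin n, F k l (FinMat.single (i : ℕ) (j : ℕ) (M.entry i j))
      simp only [map_sum]
    rw [e]
    simp only [FinMat.entry_single]
    by_cases hk : n ≤ k ∨ n ≤ l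
    · rw [hM k l hk]
      symm
      refine Finset.sum_eq_zero fun i _ => Finset.sum_eq_zero fun j _ => if_neg ?_
      have := i.2
      have := j.2
      omega
    · push Not at hk
      rw [Finset.sum_eq_single ⟨k, hk.1⟩, Finset.sum_eq_single ⟨l, hk.2⟩]
      · simp
      · intro j _ hj
        exact if_neg fun h => hj (Fin.ext h.2.symm)
      · simp
      · intro i _ hi
        exact Finset.sum_eq_zero fun j _ => if_neg fun h => hi (Fin.ext h.1.symm)
      · simp
  let G : FinMat A →+ Stab A := ⟨⟨of, of_zero⟩, of_add⟩
  have h2 := congrArg G h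
  simp only [map_sum] at h2
  exact h2

/-- The corner embedding is isometric, so its range is closed and finitely supported matrices
suffice. This extracts the `(i, j)` entry of an arbitrary element of the stabilization. -/
theorem exists_corner (i j : ℕ) (x : Stab A) :
    ∃ a : A, single 0 i 1 * x * single j 0 1 = single 0 0 a := by
  have hiso : Isometry (single 0 0 : A → Stab A) := AddMonoidHomClass.isometry_of_norm
    (⟨⟨single 0 0, single_zero 0 0⟩, single_add 0 0⟩ : A →+ Stab A) (norm_single 0 0)
  have hcl : IsClosed (Set.range (single 0 0 : A → Stab A)) := hiso.isClosedEmbedding.isClosed_range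
  suffices h : single 0 i 1 * x * single j 0 1 ∈ Set.range (single 0 0 : A → Stab A) by
    obtain ⟨a, ha⟩ := h
    exact ⟨a, ha.symm⟩
  induction x using ind with
  | hc => exact hcl.preimage (by fun_prop)
  | h M =>
    refine ⟨M.entry i j, ?_⟩
    rw [single, single, single, ← of_mul, ← of_mul]
    congr 1
    refine FinMat.ext' fun k l => ?_
    rw [mul_assoc, FinMat.entry_single_mul, FinMat.entry_mul, finsum_eq_single _ j]
    · by_cases h1 : k = 0 <;> by_cases h2 : l = 0 <;> simp [FinMat.entry_single, h1, h2]
    · intro m hm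
      simp [FinMat.entry_single, hm]

theorem star_shift_mul_reindex {σ τ : ℕ ↪ ℕ} (h : Disjoint (Set.range σ) (Set.range τ)) (n : ℕ)
    (x : Stab A) : star (of (FinMat.shift A σ n)) * reindex τ x = 0 := by
  induction x using ind with
  | hc => exact isClosed_eq (by fun_prop) (by fun_prop)
  | h M => rw [← of_star, ← of_reindex, ← of_mul, FinMat.star_shift_mul_reindex h, of_zero]

theorem reindex_mul_shift {σ τ : ℕ ↪ ℕ} (h : Disjoint (Set.range σ) (Set.range τ)) (n : ℕ)
    (x : Stab A) : reindex τ x * of (FinMat.shift A σ n) = 0 := by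
  rw [← star_star (reindex τ x * _), star_mul, ← reindex_star, star_shift_mul_reindex h, star_zero]

end Stab

namespace PosStab

open Stab

/-- The sum of the adjoints of the two shifts folds both blocks onto the same place; the cross terms
vanish because the ranges are disjoint. -/
theorem add_subeq_dsum (a b : PosStab A) : CuntzSubeq (a.1 + b.1) (dsum a b).1 := by
  refine ⟨fun n => star (of (FinMat.shift A even n)) + star (of (FinMat.shift A odd n)), ?_⟩
  refine ((tendsto_star_shift even a.1).add (tendsto_star_shift odd b.1)).congr fun n => ?_
  have hd := disjoint_even_odd
  simp only [dsum, star_add, star_star, add_mul, mul_add, star_shift_mul_reindex hd,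
    star_shift_mul_reindex hd.symm, add_zero, zero_add, mul_assoc,
    reindex_mul_shift hd, reindex_mul_shift hd.symm, mul_zero]

/-- Conjugating `a + b` by `S_even a + S_odd b` sends the two orthogonal summands to different
blocks and leaves `a³ ⊕ b³`, which dominates `a ⊕ b`. -/
theorem dsum_subeq_add (a b : PosStab A) (h : a.1 * b.1 = 0) :
    CuntzSubeq (dsum a b).1 (a.1 + b.1) := by
  have ha := a.2.isSelfAdjoint.star_eq
  have hb := b.2.isSelfAdjoint.star_eq
  have h' : b.1 * a.1 = 0 := by
    rw [← star_star (b.1 * a.1), star_mul, ha, hb, h, star_zero]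
  have h1 : dsum a b ≤ dsum ⟨_, cube_nonneg a.2⟩ ⟨_, cube_nonneg b.2⟩ :=
    dsum_mono (cuntzSubeq_cube a.2) (cuntzSubeq_cube b.2)
  refine CuntzSubeq.trans h1 ?_
  refine ⟨fun n => of (FinMat.shift A even n) * a.1 + of (FinMat.shift A odd n) * b.1, ?_⟩
  refine ((tendsto_shift even (a.1 * a.1 * a.1)).add
    (tendsto_shift odd (b.1 * b.1 * b.1))).congr fun n => ?_
  have hab : ∀ z, a.1 * (b.1 * z) = 0 := fun z => by rw [← mul_assoc, h, zero_mul]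
  have hba : ∀ z, b.1 * (a.1 * z) = 0 := fun z => by rw [← mul_assoc, h', zero_mul]
  simp only [star_add, star_mul, ha, hb, add_mul, mul_add, mul_assoc, hab, hba, mul_zero,
    add_zero, zero_add]

end PosStab

end Singles

/-! ### Cut-downs and Cuntz comparison under ⋆-homomorphisms -/

section MapCut

variable {E F : Type*} [NonUnitalCStarAlgebra E] [NonUnitalCStarAlgebra F]

theorem continuous_starHom (φ : E →⋆ₙₐ[ℂ] F) : Continuous φ :=
  AddMonoidHomClass.continuous_of_bound φ 1 fun x => by
    rw [one_mul]; exact NonUnitalStarAlgHom.norm_apply_le φ x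

theorem map_nonneg_starHom (φ : E →⋆ₙₐ[ℂ] F) {a : E} (ha : 0 ≤ a) : 0 ≤ φ a := by
  obtain ⟨y, rfl⟩ := CStarAlgebra.nonneg_iff_eq_star_mul_self.1 ha
  rw [map_mul, map_star]
  exact star_mul_self_nonneg _

theorem map_cut (φ : E →⋆ₙₐ[ℂ] F) {a : E} (ha : 0 ≤ a) {ε : ℝ} (hε : 0 ≤ ε) :
    φ (cut a ε) = cut (φ a) ε :=
  NonUnitalStarAlgHom.map_cfcₙ φ _ _ (Vanishing.cut hε).1.continuousOn (Vanishing.cut hε).2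
    (continuous_starHom φ) ha.isSelfAdjoint (ha.isSelfAdjoint.map φ)

theorem CuntzSubeq.map (φ : E →⋆ₙₐ[ℂ] F) {a b : E} (h : CuntzSubeq a b) :
    CuntzSubeq (φ a) (φ b) := by
  obtain ⟨v, hv⟩ := h
  refine ⟨fun n => φ (v n), (((continuous_starHom φ).tendsto _).comp hv).congr fun n => ?_⟩
  simp only [Function.comp_apply, map_mul, map_star]

end MapCut

/-! ### Compact containment in the Cuntz semigroup -/

section WayBelow

variable {A : Type*} [CStarAlgebra A]

open Stab

/-- `(x, y) ↦ x ⊕ y` as a ⋆-homomorphism. -/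
def dsumHom : Stab A × Stab A →⋆ₙₐ[ℂ] Stab A where
  toFun p := reindex PosStab.even p.1 + reindex PosStab.odd p.2
  map_smul' c p := by
    have h (σ : ℕ ↪ ℕ) (x : Stab A) : reindex σ (c • x) = c • reindex σ x := by
      induction x using ind with
      | hc => exact isClosed_eq (by fun_prop) (by fun_prop)
      | h M =>
        rw [← of_smul, ← of_reindex, ← of_reindex, ← of_smul]
        congr 1
        refine FinMat.reindex_ext σ (fun i j => ?_) (fun i j h => ?_) (fun i j h => ?_)
        · rw [FinMat.entry_smul, FinMat.entry_reindex, FinMat.entry_smul]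
        · rw [FinMat.entry_smul, FinMat.entry_reindex_left _ _ h, smul_zero]
        · rw [FinMat.entry_smul, FinMat.entry_reindex_right _ _ _ h, smul_zero]
    simp only [Prod.smul_fst, Prod.smul_snd, h, smul_add, MonoidHom.id_apply]
  map_zero' := by simp [reindex_zero]
  map_add' p q := by
    simp only [Prod.fst_add, Prod.snd_add, reindex_add]
    abel
  map_mul' p q := by
    have h := PosStab.disjoint_even_odd
    simp only [Prod.fst_mul, Prod.snd_mul, reindex_mul, mul_add, add_mul,
      reindex_mul_reindex_of_disjoint h, reindex_mul_reindex_of_disjoint h.symm, add_zero, zero_add]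
  map_star' p := by simp only [Prod.fst_star, Prod.snd_star, reindex_star, star_add]

/-- The orthogonal sum is a ⋆-homomorphism on the product algebra, and functional calculus commutes
with it and acts componentwise on products. -/
theorem cut_dsum (a b : PosStab A) {ε : ℝ} (hε : 0 ≤ ε) :
    cut (PosStab.dsum a b).1 ε =
      (PosStab.dsum ⟨cut a.1 ε, cut_nonneg ε⟩ ⟨cut b.1 ε, cut_nonneg ε⟩).1 := by
  have hc := (Vanishing.cut hε).1
  have h0 := (Vanishing.cut hε).2
  have ha := a.2.isSelfAdjoint
  have hb := b.2.isSelfAdjoint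
  have hab : IsSelfAdjoint ((a.1, b.1) : Stab A × Stab A) := Prod.ext ha.star_eq hb.star_eq
  have h1 := map_cut dsumHom (a := ((a.1, b.1) : Stab A × Stab A)) ?_ hε
  · unfold cut at h1
    rw [cfcₙ_map_prod (S := ℂ) _ a.1 b.1 hc.continuousOn hab ha hb] at h1
    exact h1.symm
  · obtain ⟨x, hx⟩ := CStarAlgebra.nonneg_iff_eq_star_mul_self.1 a.2
    obtain ⟨y, hy⟩ := CStarAlgebra.nonneg_iff_eq_star_mul_self.1 b.2
    have e : ((a.1, b.1) : Stab A × Stab A) = star (x, y) * (x, y) := Prod.ext hx hy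
    rw [e]
    -- The positivity asked for by `map_cut` is in the spectral order of the product algebra, so the
    -- order is given explicitly.
    exact @star_mul_self_nonneg (Stab A × Stab A) _ (CStarAlgebra.spectralOrder _) _
      (CStarAlgebra.spectralOrderedRing _) _

namespace Cu

/-- The class of a positive element. -/
def mk (x : Stab A) (hx : 0 ≤ x) : Cu A := cls ⟨x, hx⟩

theorem mk_le_mk {x y : Stab A} {hx : 0 ≤ x} {hy : 0 ≤ y} : mk x hx ≤ mk y hy ↔ CuntzSubeq x y :=
  Iff.rfl

theorem exists_mk (ξ : Cu A) : ∃ x hx, mk x hx = ξ := by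
  obtain ⟨a, rfl⟩ := exists_cls ξ
  exact ⟨a.1, a.2, rfl⟩

theorem mk_zero : mk (0 : Stab A) le_rfl = 0 := rfl

theorem zero_le (ξ : Cu A) : 0 ≤ ξ := by
  obtain ⟨x, hx, rfl⟩ := exists_mk ξ
  exact cuntzSubeq_zero x

theorem mk_eq_zero_iff {x : Stab A} {hx : 0 ≤ x} : mk x hx = 0 ↔ x = 0 := by
  constructor
  · intro h
    obtain ⟨v, hv⟩ := mk_le_mk.1 (h.le.trans_eq mk_zero.symm)
    simp only [mul_zero, zero_mul] at hv
    exact tendsto_nhds_unique hv tendsto_const_nhds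
  · rintro rfl
    rfl

theorem mk_add_le {x y : Stab A} (hx : 0 ≤ x) (hy : 0 ≤ y) :
    mk (x + y) (add_nonneg hx hy) ≤ mk x hx + mk y hy :=
  PosStab.add_subeq_dsum ⟨x, hx⟩ ⟨y, hy⟩

theorem add_le_mk {x y : Stab A} (hx : 0 ≤ x) (hy : 0 ≤ y) (h : x * y = 0) :
    mk x hx + mk y hy ≤ mk (x + y) (add_nonneg hx hy) :=
  PosStab.dsum_subeq_add ⟨x, hx⟩ ⟨y, hy⟩ h

/-- `ξ'` is dominated by a cut-down of a representative of `ξ`. -/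
def WayBelow (ξ' ξ : Cu A) : Prop :=
  ∃ x hx, ∃ ε : ℝ, 0 < ε ∧ mk x hx = ξ ∧ ξ' ≤ mk (cut x ε) (cut_nonneg ε)

/-- Makes the relation independent of the representative: a cut-down of one representative lies
below a cut-down of any dominating element. -/
theorem WayBelow.exists_cut {ξ' : Cu A} {y : Stab A} {hy : 0 ≤ y} {η : Cu A}
    (h : WayBelow ξ' η) (hη : η ≤ mk y hy) :
    ∃ δ : ℝ, 0 < δ ∧ ξ' ≤ mk (cut y δ) (cut_nonneg δ) := by
  obtain ⟨x, hx, ε, hε, rfl, h1⟩ := h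
  obtain ⟨δ, hδ, h2⟩ := CuntzSubeq.exists_cut hx hy (mk_le_mk.1 hη) hε
  exact ⟨δ, hδ, h1.trans (mk_le_mk.2 h2)⟩

theorem wayBelow_cut {x : Stab A} (hx : 0 ≤ x) {ε : ℝ} (hε : 0 < ε) :
    WayBelow (mk (cut x ε) (cut_nonneg ε)) (mk x hx) :=
  ⟨x, hx, ε, hε, rfl, le_rfl⟩

theorem WayBelow.le {ξ' ξ : Cu A} (h : WayBelow ξ' ξ) : ξ' ≤ ξ := by
  obtain ⟨x, hx, ε, hε, rfl, h1⟩ := h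
  exact h1.trans (mk_le_mk.2 (cut_subeq hx hε.le))

theorem WayBelow.trans_le {ξ' ξ η : Cu A} (h : WayBelow ξ' ξ) (h' : ξ ≤ η) : WayBelow ξ' η := by
  obtain ⟨y, hy, rfl⟩ := exists_mk η
  obtain ⟨δ, hδ, h2⟩ := h.exists_cut h'
  exact ⟨y, hy, δ, hδ, rfl, h2⟩

/-- Reduces the comparison property to cut-downs of `ξ`, which leaves room for the approximations.
-/
theorem le_of_wayBelow {ξ η : Cu A} (h : ∀ ξ', WayBelow ξ' ξ → ξ' ≤ η) : ξ ≤ η := by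
  obtain ⟨x, hx, rfl⟩ := exists_mk ξ
  obtain ⟨y, hy, rfl⟩ := exists_mk η
  exact mk_le_mk.2 (.of_cut hx fun ε hε => mk_le_mk.1 (h _ (wayBelow_cut hx hε)))

theorem WayBelow.interpolate {ξ' ξ : Cu A} (h : WayBelow ξ' ξ) :
    ∃ ζ, WayBelow ξ' ζ ∧ WayBelow ζ ξ := by
  obtain ⟨x, hx, ε, hε, rfl, h1⟩ := h
  refine ⟨_, ⟨cut x (ε / 2), cut_nonneg _, ε / 2, half_pos hε, rfl, ?_⟩,
    wayBelow_cut hx (half_pos hε)⟩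
  refine h1.trans (mk_le_mk.2 ?_)
  rw [cut_cut hx (half_pos hε).le (half_pos hε).le, add_halves]
  exact .refl (cut_nonneg _)

theorem WayBelow.directed {ξ₁ ξ₂ η : Cu A} (h₁ : WayBelow ξ₁ η) (h₂ : WayBelow ξ₂ η) :
    ∃ ζ, WayBelow ζ η ∧ ξ₁ ≤ ζ ∧ ξ₂ ≤ ζ := by
  obtain ⟨y, hy, rfl⟩ := exists_mk η
  obtain ⟨δ₁, hδ₁, h₁⟩ := h₁.exists_cut le_rfl
  obtain ⟨δ₂, hδ₂, h₂⟩ := h₂.exists_cut le_rfl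
  have h0 : 0 < min δ₁ δ₂ := lt_min hδ₁ hδ₂
  exact ⟨_, wayBelow_cut hy h0, h₁.trans (mk_le_mk.2 (cut_anti hy h0.le (min_le_left _ _))),
    h₂.trans (mk_le_mk.2 (cut_anti hy h0.le (min_le_right _ _)))⟩

theorem mk_cut_add {x y : Stab A} (hx : 0 ≤ x) (hy : 0 ≤ y) {ε : ℝ} (hε : 0 ≤ ε) :
    mk (cut (PosStab.dsum ⟨x, hx⟩ ⟨y, hy⟩).1 ε) (cut_nonneg ε) =
      mk (cut x ε) (cut_nonneg ε) + mk (cut y ε) (cut_nonneg ε) :=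
  congrArg cls (Subtype.ext (cut_dsum ⟨x, hx⟩ ⟨y, hy⟩ hε))

theorem WayBelow.add {ξ' ξ η' η : Cu A} (h₁ : WayBelow ξ' ξ) (h₂ : WayBelow η' η) :
    WayBelow (ξ' + η') (ξ + η) := by
  obtain ⟨x, hx, ε, hε, rfl, h₁⟩ := h₁
  obtain ⟨y, hy, δ, hδ, rfl, h₂⟩ := h₂
  have h0 : 0 < min ε δ := lt_min hε hδ
  refine ⟨(PosStab.dsum ⟨x, hx⟩ ⟨y, hy⟩).1, (PosStab.dsum ⟨x, hx⟩ ⟨y, hy⟩).2, min ε δ, h0, rfl, ?_⟩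
  rw [mk_cut_add hx hy h0.le]
  exact add_le_add (h₁.trans (mk_le_mk.2 (cut_anti hx h0.le (min_le_left _ _))))
    (h₂.trans (mk_le_mk.2 (cut_anti hy h0.le (min_le_right _ _))))

/-- A cut-down of an orthogonal sum is the sum of the cut-downs. -/
theorem WayBelow.exists_add {ζ ξ η : Cu A} (h : WayBelow ζ (ξ + η)) :
    ∃ ξ' η', WayBelow ξ' ξ ∧ WayBelow η' η ∧ ζ ≤ ξ' + η' := by
  obtain ⟨x, hx, rfl⟩ := exists_mk ξ
  obtain ⟨y, hy, rfl⟩ := exists_mk η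
  obtain ⟨δ, hδ, h⟩ := h.exists_cut
    (y := (PosStab.dsum ⟨x, hx⟩ ⟨y, hy⟩).1) (hy := (PosStab.dsum ⟨x, hx⟩ ⟨y, hy⟩).2) le_rfl
  rw [mk_cut_add hx hy hδ.le] at h
  exact ⟨_, _, wayBelow_cut hx hδ, wayBelow_cut hy hδ, h⟩

theorem wayBelow_zero (ξ : Cu A) : WayBelow 0 ξ := by
  obtain ⟨x, hx, rfl⟩ := exists_mk ξ
  exact ⟨x, hx, 1, one_pos, rfl, zero_le _⟩

theorem WayBelow.nsmul {ξ' ξ : Cu A} (h : WayBelow ξ' ξ) (k : ℕ) : WayBelow (k • ξ') (k • ξ) := by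
  induction k with
  | zero => rw [zero_nsmul, zero_nsmul]; exact wayBelow_zero 0
  | succ k ih => rw [succ_nsmul, succ_nsmul]; exact ih.add h

/-- Splitting along the sum gives a separate cut-down for each copy of `η`; directedness merges them
into one. -/
theorem WayBelow.exists_nsmul {ζ η : Cu A} {k : ℕ} (h : WayBelow ζ (k • η)) :
    ∃ η', WayBelow η' η ∧ ζ ≤ k • η' := by
  induction k generalizing ζ with
  | zero =>
    rw [zero_nsmul] at h
    exact ⟨0, wayBelow_zero _, by rw [zero_nsmul]; exact h.le⟩
  | succ k ih =>
    rw [succ_nsmul] at h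
    obtain ⟨ξ₁, ξ₂, h1, h2, h3⟩ := h.exists_add
    obtain ⟨ξ₃, h4, h5⟩ := ih h1
    obtain ⟨η', h6, h7, h8⟩ := h4.directed h2
    refine ⟨η', h6, h3.trans ?_⟩
    rw [succ_nsmul]
    exact add_le_add (h5.trans (nsmul_le_nsmul_right h7 k)) h8

theorem mk_single_eq (i : ℕ) {a : A} (ha : 0 ≤ a) :
    mk (single i i a) (single_nonneg i ha) = mk (single 0 0 a) (single_nonneg 0 ha) := by
  have h (i j : ℕ) : CuntzSubeq (single i i a) (single j j a) := by
    have := cuntzSubeq_conj (single j j a) (single i j 1)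
    rwa [star_single, star_one, single_mul_single, single_mul_single, one_mul, mul_one] at this
  exact le_antisymm (mk_le_mk.2 (h _ _)) (mk_le_mk.2 (h _ _))

theorem mk_diagHom_le (n : ℕ) {a : A} (ha : 0 ≤ a) :
    mk (diagHom n a) (diagHom_nonneg n ha) ≤ n • mk (single 0 0 a) (single_nonneg 0 ha) := by
  induction n with
  | zero =>
    have : diagHom 0 a = 0 := congrArg of (FinMat.ext' fun k l => if_neg (by omega))
    rw [zero_nsmul, mk_eq_zero_iff.2 this]
  | succ n ih =>
    have e : mk (diagHom (n + 1) a) (diagHom_nonneg _ ha) =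
        mk (diagHom n a + single n n a)
          (add_nonneg (diagHom_nonneg n ha) (single_nonneg n ha)) := by
      congr 1
      exact diagHom_succ n a
    rw [e, succ_nsmul]
    refine (mk_add_le (diagHom_nonneg n ha) (single_nonneg n ha)).trans ?_
    rw [mk_single_eq n ha]
    gcongr

end Cu

end WayBelow

/-! ### Orthogonal elements in hereditary subalgebras -/

section Orthogonal

variable {E : Type*} [NonUnitalCStarAlgebra E]

/-- `a` is a minimal element: `a ≠ 0` and `a E a ⊆ ℂ a`. -/
def IsMinimalElt (a : E) : Prop := a ≠ 0 ∧ ∀ x : E, ∃ c : ℂ, a * x * a = c • a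

/-- Nonzero elements have nonzero products up to an intermediate factor. -/
def IsPrimeAlg (E : Type*) [NonUnitalCStarAlgebra E] : Prop :=
  ∀ p q : E, p ≠ 0 → q ≠ 0 → ∃ z, p * z * q ≠ 0

theorem cfcₙ_eq_zero_imp {a : E} (ha : 0 ≤ a) {f : ℝ → ℝ} (hf : Vanishing f)
    (h : cfcₙ f a = 0) {t : ℝ} (ht : t ∈ quasispectrum ℝ a) : f t = 0 := by
  have := norm_apply_le_norm_cfcₙ f a ht hf.1.continuousOn hf.2 ha.isSelfAdjoint
  rw [h, norm_zero] at this
  exact norm_le_zero_iff.1 this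

/-- A spectral value strictly between `0` and `‖a‖` could be separated from `‖a‖` by two functions
with disjoint supports, giving nonzero orthogonal positive elements of `aEa`. So the spectrum lies
in `{0, ‖a‖}` and `a` is a multiple of a projection. -/
theorem mul_self_eq_of_no_orthogonal {a : E} (ha : 0 ≤ a)
    (H : ∀ b c : E, 0 ≤ a * b * a → 0 ≤ a * c * a → (a * b * a) * (a * c * a) = 0 →
      a * b * a = 0 ∨ a * c * a = 0) : a * a = ‖a‖ • a := by
  have h1 : ∀ t ∈ quasispectrum ℝ a, t * t = ‖a‖ * t := by
    intro t ht
    have ht0 := spec_nonneg ha ht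
    have htN := spec_le_norm ha ht
    by_contra hne
    have htpos : 0 < t := ht0.lt_of_ne fun h => hne (by rw [← h]; ring)
    have htlt : t < ‖a‖ := htN.lt_of_ne fun h => hne (by rw [← h])
    -- One function lives below the midpoint `m` and sees `t`; the other lives above it and sees the
    -- top of the spectrum.
    set m := (t + ‖a‖) / 2 with hm
    have hκ₁ : Vanishing fun s : ℝ => s * max (m - s) 0 := ⟨by fun_prop, by simp⟩
    have hκ₂ : Vanishing fun s : ℝ => s * max (s - m) 0 := ⟨by fun_prop, by simp⟩
    have e : ∀ {κ : ℝ → ℝ}, Vanishing κ → a * cfcₙ κ a * a = cfcₙ (fun s => s * κ s * s) a := by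
      intro κ hκ
      rw [(Vanishing.id.mul hκ).cfc_mul .id, Vanishing.id.cfc_mul hκ, cfcₙ_self ha]
    have hf₁ := (Vanishing.id.mul hκ₁).mul .id
    have hf₂ := (Vanishing.id.mul hκ₂).mul .id
    have h := H (cfcₙ (fun s : ℝ => s * max (m - s) 0) a) (cfcₙ (fun s : ℝ => s * max (s - m) 0) a)
    rw [e hκ₁, e hκ₂] at h
    have h0 := h (cfcₙ_nonneg_of ha fun s hs => by positivity)
      (cfcₙ_nonneg_of ha fun s hs => by positivity) (by
        rw [← hf₁.cfc_mul hf₂, ← cfcₙ_const_zero ℝ a]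
        refine cfcₙ_congr_nonneg ha fun s _ => ?_
        rcases le_total s m with h | h
        · rw [max_eq_right (by linarith : s - m ≤ 0)]; ring
        · rw [max_eq_right (by linarith : m - s ≤ 0)]; ring)
    rcases h0 with h0 | h0
    · have := cfcₙ_eq_zero_imp ha hf₁ h0 ht
      have h2 : 0 < m - t := by linarith
      rw [max_eq_left h2.le] at this
      have : 0 < t * (t * (m - t)) * t := by positivity
      linarith
    · have hle : ‖cfcₙ (fun s : ℝ => s) a‖ ≤ m := by
        refine norm_cfcₙ_le fun s hs => ?_
        have hs0 := spec_nonneg ha hs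
        rw [Real.norm_of_nonneg hs0]
        by_contra! hlt
        have := cfcₙ_eq_zero_imp ha hf₂ h0 hs
        have h2 : 0 < s - m := by linarith
        have h3 : 0 < s := by linarith
        rw [max_eq_left h2.le] at this
        have : 0 < s * (s * (s - m)) * s := by positivity
        linarith
      rw [cfcₙ_self ha] at hle
      linarith
  calc a * a = cfcₙ (fun t : ℝ => t * t) a := by rw [Vanishing.id.cfc_mul .id, cfcₙ_self ha]
    _ = cfcₙ (fun t : ℝ => ‖a‖ * t) a := cfcₙ_congr h1
    _ = ‖a‖ • a := by rw [Vanishing.id.cfc_smul, cfcₙ_self ha]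

/-- Without positive minimal elements, every hereditary subalgebra contains two nonzero
orthogonal positive elements. -/
theorem exists_orthogonal_pair (hmin : ∀ p : E, 0 ≤ p → ¬ IsMinimalElt p) {h : E} (hh : 0 ≤ h)
    (h0 : h ≠ 0) : ∃ b c : E, 0 ≤ h * b * h ∧ 0 ≤ h * c * h ∧ h * b * h ≠ 0 ∧ h * c * h ≠ 0 ∧
      (h * b * h) * (h * c * h) = 0 := by
  by_contra! H
  have H' : ∀ b c : E, 0 ≤ h * b * h → 0 ≤ h * c * h → (h * b * h) * (h * c * h) = 0 →
      h * b * h = 0 ∨ h * c * h = 0 := fun b c hb hc hbc => by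
    by_contra! hne
    exact H b c hb hc hne.1 hne.2 hbc
  -- Without an orthogonal pair, every positive element of `hEh` is a multiple of a projection.
  have hsq : ∀ b : E, 0 ≤ h * b * h →
      (h * b * h) * (h * b * h) = ‖h * b * h‖ • (h * b * h) := by
    intro b hb
    refine mul_self_eq_of_no_orthogonal hb fun x y hx hy hxy => ?_
    have e : ∀ x, h * b * h * x * (h * b * h) = h * (b * h * x * (h * b)) * h := fun x => by
      simp only [mul_assoc]
    rw [e] at hx hxy ⊢
    rw [e] at hy hxy ⊢
    exact H' _ _ hx hy hxy
  have hp : 0 ≤ h * h * h := cube_nonneg hh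
  have hp0 : h * h * h ≠ 0 := by
    intro hz
    have := cuntzSubeq_cube hh
    rw [hz] at this
    obtain ⟨v, hv⟩ := this
    simp only [mul_zero, zero_mul] at hv
    exact h0 (tendsto_nhds_unique hv tendsto_const_nhds)
  set p := h * h * h with hpdef
  refine hmin p hp ⟨hp0, fun x => ?_⟩
  have hN : ‖p‖ ≠ 0 := norm_ne_zero_iff.2 hp0
  have hpp := hsq h hp
  rw [← hpdef] at hpp
  have hps := hp.isSelfAdjoint.star_eq
  -- Minimality of `p = h³` is a linear condition on `x`, and positive elements span the algebra.
  have hx : x ∈ Submodule.span ℂ {a : E | 0 ≤ a} := by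
    rw [CStarAlgebra.span_nonneg]; trivial
  induction hx using Submodule.span_induction with
  | mem b hb =>
    have hb : 0 ≤ b := hb
    set r := p * b * p with hr
    have hr0 : 0 ≤ r := by
      have := star_right_conjugate_nonneg hb p
      rwa [hps] at this
    have hre : r = h * (h * h * b * (h * h)) * h := by simp only [hr, hpdef, mul_assoc]
    by_cases hz : r = 0
    · exact ⟨0, by rw [hz, zero_smul]⟩
    have hM : ‖r‖ ≠ 0 := norm_ne_zero_iff.2 hz
    have hrr : r * r = ‖r‖ • r := by
      have := hsq (h * h * b * (h * h))
      rw [← hre] at this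
      exact this hr0
    have hpr : p * r = ‖p‖ • r := by
      calc p * r = (p * p) * (b * p) := by rw [hr, mul_assoc p p, mul_assoc p b p]
        _ = ‖p‖ • r := by rw [hpp, smul_mul_assoc, hr, mul_assoc p b p]
    have hrp : r * p = ‖p‖ • r := by
      calc r * p = (p * b) * (p * p) := by rw [hr]; simp only [mul_assoc]
        _ = ‖p‖ • r := by rw [hpp, mul_smul_comm, hr]
    -- The normalised `r = pbp` is a subprojection of the normalised `p`, so `q` is a projection
    -- orthogonal to `r`. The absence of orthogonal pairs forces `q = 0`, and `r` is a multiple of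
    -- `p`.
    set q := ‖p‖⁻¹ • p - ‖r‖⁻¹ • r with hq
    have hqr : q * r = 0 := by
      rw [hq, sub_mul, smul_mul_assoc, smul_mul_assoc, hpr, hrr, smul_smul, smul_smul,
        inv_mul_cancel₀ hN, inv_mul_cancel₀ hM, sub_self]
    have hqs : star q = q := by
      rw [hq, star_sub, star_smul, star_smul, hps, hr0.isSelfAdjoint.star_eq, star_trivial,
        star_trivial]
    have hqp : q * p = ‖p‖ • q := by
      rw [hq, sub_mul, smul_mul_assoc, smul_mul_assoc, hpp, hrp, smul_sub, smul_smul, smul_smul,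
        smul_smul, smul_smul, mul_comm ‖p‖, mul_comm ‖p‖]
    have hqq : q * q = q := by
      nth_rw 2 [hq]
      rw [mul_sub, mul_smul_comm, mul_smul_comm, hqr, smul_zero, sub_zero, hqp, smul_smul,
        inv_mul_cancel₀ hN, one_smul]
    have hq0 : 0 ≤ q := by
      have := star_mul_self_nonneg q
      rwa [hqs, hqq] at this
    have hqe : q = h * (‖p‖⁻¹ • h - ‖r‖⁻¹ • (h * h * b * (h * h))) * h := by
      rw [mul_sub, sub_mul, mul_smul_comm, mul_smul_comm, smul_mul_assoc, smul_mul_assoc, ← hre]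
    have := H' (‖p‖⁻¹ • h - ‖r‖⁻¹ • (h * h * b * (h * h))) (h * h * b * (h * h))
    rw [← hqe, ← hre] at this
    rcases this hq0 hr0 hqr with h1 | h1
    · refine ⟨((‖r‖ * ‖p‖⁻¹ : ℝ) : ℂ), ?_⟩
      rw [hq, sub_eq_zero] at h1
      rw [Complex.coe_smul, mul_smul, h1, smul_smul, mul_inv_cancel₀ hM, one_smul]
    · exact absurd h1 hz
  | zero => exact ⟨0, by simp⟩
  | add b c _ _ hb hc =>
    obtain ⟨s, hs⟩ := hb
    obtain ⟨t, ht⟩ := hc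
    exact ⟨s + t, by rw [mul_add, add_mul, hs, ht, add_smul]⟩
  | smul c b _ hb =>
    obtain ⟨s, hs⟩ := hb
    exact ⟨c * s, by rw [mul_smul_comm, smul_mul_assoc, hs, smul_smul]⟩

/-- One piece of an orthogonal pair is kept and the other is split again; the form `h b h` keeps all
pieces in the hereditary subalgebra of `h`. -/
theorem exists_orthogonal_family (hmin : ∀ p : E, 0 ≤ p → ¬ IsMinimalElt p) (n : ℕ) {h : E}
    (hh : 0 ≤ h) (h0 : h ≠ 0) : ∃ b : Fin (n + 1) → E, (∀ i, 0 ≤ h * b i * h) ∧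
      (∀ i, h * b i * h ≠ 0) ∧ ∀ i j, i ≠ j → (h * b i * h) * (h * b j * h) = 0 := by
  induction n generalizing h with
  | zero =>
    have hs := hh.isSelfAdjoint.star_eq
    obtain ⟨b, -, hb, -, hb0, -⟩ := exists_orthogonal_pair hmin hh h0
    exact ⟨fun _ => b, fun _ => hb, fun _ => hb0,
      fun i j hij => (hij (Fin.ext (by omega))).elim⟩
  | succ n ih =>
    obtain ⟨b, c, hb, hc, hb0, hc0, hbc⟩ := exists_orthogonal_pair hmin hh h0
    obtain ⟨d, hd, hd0, hdd⟩ := ih hc hc0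
    have e : ∀ i, h * c * h * d i * (h * c * h) = h * (c * h * d i * (h * c)) * h := fun i => by
      simp only [mul_assoc]
    have hcb : (h * c * h) * (h * b * h) = 0 := by
      rw [← star_star ((h * c * h) * (h * b * h)), star_mul, hb.isSelfAdjoint.star_eq,
        hc.isSelfAdjoint.star_eq, hbc, star_zero]
    refine ⟨Fin.cons b fun i => c * h * d i * (h * c), ?_, ?_, ?_⟩
    · intro i
      refine Fin.cases ?_ (fun i => ?_) i
      · simpa using hb
      · simpa [e] using hd i
    · intro i
      refine Fin.cases ?_ (fun i => ?_) i
      · simpa using hb0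
      · simpa [e] using hd0 i
    · intro i j
      refine Fin.cases ?_ (fun i => ?_) i <;> refine Fin.cases ?_ (fun j => ?_) j
      · simp
      · intro _
        rw [Fin.cons_zero, Fin.cons_succ, ← e]
        calc h * b * h * (h * c * h * d j * (h * c * h))
            = (h * b * h * (h * c * h)) * (d j * (h * c * h)) := by simp only [mul_assoc]
          _ = 0 := by rw [hbc, zero_mul]
      · intro _
        rw [Fin.cons_zero, Fin.cons_succ, ← e]
        calc h * c * h * d i * (h * c * h) * (h * b * h)
            = (h * c * h * d i) * (h * c * h * (h * b * h)) := by simp only [mul_assoc]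
          _ = 0 := by rw [hcb, mul_zero]
      · intro hij
        rw [Fin.cons_succ, Fin.cons_succ, ← e, ← e]
        exact hdd i j fun h => hij (by rw [h])

theorem conj_subeq {x d : E} (hx : 0 ≤ x) (hd : 0 ≤ d) : CuntzSubeq (x * d * x) x := by
  have hs := hx.isSelfAdjoint.star_eq
  have h1 := star_right_conjugate_nonneg hd x
  have h2 := CStarAlgebra.star_right_conjugate_le_norm_smul (a := x) (b := d) hd.isSelfAdjoint
  rw [hs] at h1 h2
  refine (CuntzSubeq.of_le_smul h1 ?_ (norm_nonneg d) h2).trans (cuntzSubeq_mul_self hx)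
  have := star_mul_self_nonneg x
  rwa [hs] at this

/-- Primeness gives `v = u z w ≠ 0` for `u` one of the `y i` and `w` the element found so far. Then
`v*v` lies below `w`, hence below the squares already treated, and is also a conjugate of `u²`. -/
theorem exists_subeq_family (hprime : IsPrimeAlg E) (n : ℕ) {x : E} (hx : 0 ≤ x) (hx0 : x ≠ 0)
    (y : Fin n → E) (hy : ∀ i, 0 ≤ y i) (hy0 : ∀ i, y i ≠ 0) :
    ∃ d, 0 ≤ x * d * x ∧ x * d * x ≠ 0 ∧ ∀ i, CuntzSubeq (x * d * x) (y i * y i) := by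
  have hs := hx.isSelfAdjoint.star_eq
  induction n with
  | zero =>
    refine ⟨x, cube_nonneg hx, fun h => ?_, fun i => i.elim0⟩
    obtain ⟨v, hv⟩ := cuntzSubeq_cube hx
    rw [h] at hv
    simp only [mul_zero, zero_mul] at hv
    exact hx0 (tendsto_nhds_unique hv tendsto_const_nhds)
  | succ n ih =>
    obtain ⟨d, hd, hd0, hdy⟩ := ih (fun i => y i.castSucc) (fun i => hy _) fun i => hy0 _
    obtain ⟨z, hz⟩ := hprime (y (Fin.last n)) (x * d * x) (hy0 _) hd0
    set w := x * d * x with hw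
    set u := y (Fin.last n) with hu
    have hus : star u = u := (hy (Fin.last n)).isSelfAdjoint.star_eq
    have hws := hd.isSelfAdjoint.star_eq
    have he : star (u * z * w) * (u * z * w) = w * (star (u * z) * (u * z)) * w := by
      simp only [star_mul, hws, mul_assoc]
    have he2 : star (u * z * w) * (u * z * w) = x * (d * x * (star (u * z) * (u * z)) * (x * d)) * x := by
      rw [he, hw]
      simp only [mul_assoc]
    refine ⟨d * x * (star (u * z) * (u * z)) * (x * d), ?_, ?_, fun i => ?_⟩
    · rw [← he2]
      exact star_mul_self_nonneg _
    · rw [← he2]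
      exact fun h => hz (CStarRing.star_mul_self_eq_zero_iff _ |>.1 h)
    · rw [← he2]
      refine Fin.lastCases ?_ (fun i => ?_) i
      · have := cuntzSubeq_conj' (u * u) (z * w)
        convert this using 1
        simp only [star_mul, hus, mul_assoc]
      · rw [he]
        exact (conj_subeq hd (star_mul_self_nonneg _)).trans (hdy i)

/-- A positive element `h` splits: up to a small orthogonal piece `w`, it is `s`, and `x ≾ s`
with multiplicity `n`, while `s + x` still dominates the given cut-down of `h`. -/
theorem exists_splitting (hprime : IsPrimeAlg E) (hmin : ∀ p : E, 0 ≤ p → ¬ IsMinimalElt p)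
    {h : E} (hh : 0 ≤ h) (h0 : h ≠ 0) {ε : ℝ} (hε : 0 < ε) (n : ℕ) :
    ∃ s x w : E, 0 ≤ s ∧ 0 ≤ x ∧ 0 ≤ w ∧ w ≠ 0 ∧ s * w = 0 ∧ CuntzSubeq (s + w) h ∧
      CuntzSubeq (cut h ε) (s + x) ∧ CuntzSubeq w x ∧
      ∃ y : Fin n → E, (∀ i, 0 ≤ y i) ∧ (∀ i j, i ≠ j → y i * y j = 0) ∧
        (∀ i, CuntzSubeq x (y i * y i)) ∧ CuntzSubeq (∑ i, y i * y i) s := by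
  have hN : 0 < ‖h‖ := norm_pos_iff.2 h0
  -- The bound by `‖h‖ / 2` keeps the cut-down `k` nonzero even when `ε` is large.
  set δ := min ε (‖h‖ / 2) with hδdef
  have hδ : 0 < δ := lt_min hε (by positivity)
  set k := cut h δ with hk
  have hk0 : k ≠ 0 := by
    intro hz
    have := norm_sub_cut_le hh hδ.le
    rw [← hk, hz, sub_zero] at this
    have := this.trans (min_le_right _ _)
    linarith
  have hkpos : 0 ≤ k := cut_nonneg δ
  -- the local unit
  let φ : ℝ → ℝ := fun t => min (max (2 * t / δ - 1) 0) 1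
  have hφ : Vanishing φ := ⟨by fun_prop, by simp [φ]⟩
  have hφ1 : ∀ t, δ ≤ t → φ t = 1 := fun t ht => by
    refine min_eq_right (le_max_of_le_left ?_)
    have : 2 ≤ 2 * t / δ := by rw [le_div_iff₀ hδ]; linarith
    linarith
  have hφ0 : ∀ t, 0 ≤ φ t := fun t => le_min (le_max_right _ _) zero_le_one
  set e := cfcₙ φ h with he
  have hes : star e = e := star_cfcₙ _ _
  have hepos : 0 ≤ e := cfcₙ_nonneg_of hh fun t _ => hφ0 t
  have hcong : ∀ t : ℝ, φ t * max (t - δ) 0 = max (t - δ) 0 := fun t => by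
    rcases le_total δ t with ht | ht
    · rw [hφ1 t ht, one_mul]
    · rw [max_eq_right (by linarith), mul_zero]
  have hek : e * k = k := by
    rw [he, hk, cut, ← hφ.cfc_mul (.cut hδ.le)]
    exact congrArg (fun f => cfcₙ f h) (funext hcong)
  have hke : k * e = k := by
    have := congrArg star hek
    rwa [star_mul, hes, hkpos.isSelfAdjoint.star_eq] at this
  have hesub : CuntzSubeq (e * e) h := by
    refine (cuntzSubeq_mul_self hepos).trans ?_
    conv_rhs => rw [← cfcₙ_self hh]
    refine cuntzSubeq_cfcₙ hh hφ .id (fun t _ => hφ0 t) (r := 2 / δ) (by positivity)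
      fun t ht _ => ?_
    have : 0 ≤ 2 / δ * t := by positivity
    refine min_le_of_left_le (max_le ?_ this)
    rw [mul_comm_div, mul_div_assoc' 2 t δ]
    linarith
  have hee : 0 ≤ e * e := by
    have := star_mul_self_nonneg e
    rwa [hes] at this
  have hkle : k ≤ ‖k‖ • (e * e) := by
    have := CStarAlgebra.star_right_conjugate_le_norm_smul (a := e) (b := k) hkpos.isSelfAdjoint
    rwa [hes, hek, hke] at this
  -- Of the `n + 1` orthogonal pieces of `kEk`, piece `0` will contain `x` and `w`; the other `n`
  -- are the `y i`, which will show that `x` fits `n` times into `s`.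
  obtain ⟨b, hb, hb0, hbb⟩ := exists_orthogonal_family hmin n hkpos hk0
  obtain ⟨d, hd, hd0, hdy⟩ := exists_subeq_family hprime n (hb 0) (hb0 0)
    (fun i => k * b i.succ * k) (fun i => hb _) fun i => hb0 _
  set y : Fin n → E := fun i => k * b i.succ * k with hy
  set x₀ := k * b 0 * k * d * (k * b 0 * k) with hx₀
  have hM : 0 < ‖x₀‖ := norm_pos_iff.2 hd0
  set M := ‖x₀‖ with hMdef
  have hex₀ : e * x₀ = x₀ := by
    calc e * x₀ = (e * k) * (b 0 * k * d * (k * b 0 * k)) := by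
          rw [hx₀]; simp only [mul_assoc]
      _ = x₀ := by rw [hek, hx₀]; simp only [mul_assoc]
  have hye : ∀ i, y i * e = y i := fun i => by rw [hy]; simp only [mul_assoc, hke]
  have hyx₀ : ∀ i, y i * x₀ = 0 := fun i => by
    calc y i * x₀ = (k * b i.succ * k) * (k * b 0 * k) * (d * (k * b 0 * k)) := by
          rw [hx₀]; simp only [mul_assoc, hy]
      _ = 0 := by rw [hbb _ _ (Fin.succ_ne_zero i), zero_mul]
  -- functions of `x₀`
  let κ : ℝ → ℝ := fun t => min (max (4 * t / M - 1) 0) 1 / max t (M / 4)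
  let ψ : ℝ → ℝ := fun t => t * κ t
  have hκ : Vanishing κ := by
    refine ⟨Continuous.div (by fun_prop) (by fun_prop) fun t => ?_, by simp [κ]⟩
    exact (lt_max_of_lt_right (by positivity)).ne'
  have hψ : Vanishing ψ := .mul .id hκ
  have hκ0 : ∀ t, 0 ≤ κ t := fun t => div_nonneg (le_min (le_max_right _ _) zero_le_one)
    (le_max_of_le_right (by positivity))
  have hψ1 : ∀ t, M / 2 ≤ t → ψ t = 1 := fun t ht => by
    have h1 : 1 ≤ 4 * t / M - 1 := by
      have : 2 ≤ 4 * t / M := by rw [le_div_iff₀ hM]; linarith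
      linarith
    have h2 : 0 < t := by linarith
    show t * (min (max (4 * t / M - 1) 0) 1 / max t (M / 4)) = 1
    rw [min_eq_right (le_max_of_le_left h1), max_eq_left (by linarith), mul_one_div_cancel h2.ne']
  have hψle : ∀ t, 0 ≤ t → ψ t ≤ 1 := fun t ht => by
    show t * (min (max (4 * t / M - 1) 0) 1 / max t (M / 4)) ≤ 1
    rw [mul_div_assoc', div_le_one (lt_max_of_lt_right (by positivity))]
    calc t * _ ≤ t * 1 := mul_le_mul_of_nonneg_left (min_le_right _ _) ht
      _ ≤ _ := by rw [mul_one]; exact le_max_left _ _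
  set x := cfcₙ ψ x₀ with hx
  -- Since `ψ` equals `1` from `M / 2` on, `x` acts as a unit on `w`. This makes `w` orthogonal to
  -- `s = e² - x`.
  set w := cut x₀ (M / 2) with hw
  have hM2 : 0 < M / 2 := by positivity
  have hxpos : 0 ≤ x := cfcₙ_nonneg_of hd fun t ht => mul_nonneg ht (hκ0 t)
  have hwpos : 0 ≤ w := cut_nonneg _
  have hxκ : x = x₀ * cfcₙ κ x₀ := by rw [hx, Vanishing.id.cfc_mul hκ, cfcₙ_self hd]
  have hex : e * x = x := by rw [hxκ, ← mul_assoc, hex₀]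
  have hxe : x * e = x := by
    have := congrArg star hex
    rwa [star_mul, hes, hxpos.isSelfAdjoint.star_eq] at this
  have hxw : x * w = w := by
    rw [hx, hw, cut, ← hψ.cfc_mul (.cut hM2.le)]
    refine congrArg (fun f => cfcₙ f x₀) (funext fun t => ?_)
    rcases le_total (M / 2) t with ht | ht
    · rw [hψ1 t ht, one_mul]
    · rw [max_eq_right (by linarith), mul_zero]
  have hew : e * w = w := by rw [← hxw, ← mul_assoc, hex]
  have hwe : w * e = w := by
    have := congrArg star hew
    rwa [star_mul, hes, hwpos.isSelfAdjoint.star_eq] at this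
  have hw0 : w ≠ 0 := by
    intro hz
    have := norm_sub_cut_le hd hM2.le
    rw [← hw, hz, sub_zero] at this
    linarith
  have hxnorm : ‖x‖ ≤ 1 := norm_cfcₙ_le fun t ht => by
    have := spec_nonneg hd ht
    rw [Real.norm_of_nonneg (mul_nonneg this (hκ0 t))]
    exact hψle t this
  have hxle : x ≤ e * e := by
    have := CStarAlgebra.star_right_conjugate_le_norm_smul (a := e) (b := x) hxpos.isSelfAdjoint
    rw [hes, hex, hxe] at this
    calc x ≤ ‖x‖ • (e * e) := this
      _ ≤ (1 : ℝ) • (e * e) := smul_le_smul_of_nonneg_right hxnorm hee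
      _ = _ := one_smul _ _
  have hwle : w ≤ ‖w‖ • (e * e) := by
    have := CStarAlgebra.star_right_conjugate_le_norm_smul (a := e) (b := w) hwpos.isSelfAdjoint
    rwa [hes, hew, hwe] at this
  -- Removing `x` from the local unit `e²` makes room for `w`, while `s + x = e²` dominates a
  -- multiple of `k`.
  refine ⟨e * e - x, x, w, sub_nonneg.2 hxle, hxpos, hwpos, hw0, ?_, ?_, ?_, ?_, y, fun i => hb _,
    fun i j hij => hbb _ _ fun h => hij (Fin.succ_injective _ h), fun i => ?_, ?_⟩
  · rw [sub_mul, mul_assoc, hew, hew, hxw, sub_self]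
  · refine (CuntzSubeq.of_le_smul (add_nonneg (sub_nonneg.2 hxle) hwpos) hee (r := 1 + ‖w‖)
      (by positivity) ?_).trans hesub
    rw [add_smul, one_smul]
    exact add_le_add (sub_le_self _ hxpos) hwle
  · rw [sub_add_cancel]
    exact (cut_anti hh hδ.le (min_le_left _ _)).trans
      (CuntzSubeq.of_le_smul hkpos hee (norm_nonneg _) hkle)
  · refine cuntzSubeq_cfcₙ hd (.cut hM2.le) hψ (fun _ _ => le_max_right _ _) hM
      fun t ht ht' => ?_
    rcases le_total (M / 2) t with h | h
    · rw [hψ1 t h, mul_one]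
      exact max_le (by linarith) hM.le
    · rw [max_eq_right (by linarith)]
      exact mul_nonneg hM.le (mul_nonneg ht (hκ0 t))
  · refine CuntzSubeq.trans ?_ (hdy i)
    conv_rhs => rw [← cfcₙ_self hd]
    refine cuntzSubeq_cfcₙ hd hψ .id (fun t ht => mul_nonneg ht (hκ0 t)) (r := 4 / M)
      (by positivity) fun t ht _ => ?_
    show t * (min (max (4 * t / M - 1) 0) 1 / max t (M / 4)) ≤ 4 / M * t
    rw [mul_comm]
    refine mul_le_mul_of_nonneg_right ?_ ht
    rw [div_le_div_iff₀ (lt_max_of_lt_right (by positivity)) hM]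
    have h1 : min (max (4 * t / M - 1) 0) 1 ≤ 1 := min_le_right _ _
    have h2 : M / 4 ≤ max t (M / 4) := le_max_right _ _
    nlinarith
  -- `Y` is fixed by `e` and kills `x`, so `Y s Y* = Y² = ∑ (y i)²`.
  · set Y := ∑ i, y i with hY
    have hYs : star Y = Y := by
      rw [hY, star_sum]
      exact Finset.sum_congr rfl fun i _ => (hb i.succ).isSelfAdjoint.star_eq
    have hYe : Y * e = Y := by rw [hY, Finset.sum_mul]; simp only [hye]
    have hYx : Y * x = 0 := by
      rw [hY, Finset.sum_mul]
      exact Finset.sum_eq_zero fun i _ => by rw [hxκ, ← mul_assoc, hyx₀, zero_mul]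
    have hYY : Y * Y = ∑ i, y i * y i := by
      rw [hY, Finset.sum_mul]
      refine Finset.sum_congr rfl fun i _ => ?_
      rw [Finset.mul_sum]
      exact Finset.sum_eq_single i
        (fun j _ hj => hbb _ _ fun h => hj (Fin.succ_injective _ h).symm) (by simp)
    have heq : Y * (e * e - x) * star Y = ∑ i, y i * y i := by
      rw [mul_sub, hYx, sub_zero, ← mul_assoc, hYe, hYe, hYs, hYY]
    rw [← heq]
    exact cuntzSubeq_conj _ _

end Orthogonal

/-! ### Simplicity, minimal elements and finiteness -/

section Simple

variable {A : Type*} [CStarAlgebra A]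

/-- The two-sided ideal generated by `b`, as a subspace. -/
def idealSpan (b : A) : Submodule ℂ A := Submodule.span ℂ {x | ∃ y z, y * b * z = x}

/-- Every nonzero element generates `A` as a two-sided ideal. -/
def IsFullAlg (A : Type*) [CStarAlgebra A] : Prop := ∀ b : A, b ≠ 0 → (1 : A) ∈ idealSpan b

theorem mul_mem_idealSpan {b x : A} (hx : x ∈ idealSpan b) (u v : A) :
    u * x * v ∈ idealSpan b := by
  induction hx using Submodule.span_induction with
  | mem x hx =>
    obtain ⟨y, z, rfl⟩ := hx
    exact Submodule.subset_span ⟨u * y, z * v, by simp only [mul_assoc]⟩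
  | zero => simp
  | add x y _ _ hx hy =>
    rw [mul_add, add_mul]
    exact add_mem hx hy
  | smul c x _ hx =>
    rw [mul_smul_comm, smul_mul_assoc]
    exact Submodule.smul_mem _ _ hx

theorem exists_sum_of_mem_idealSpan {b x : A} (hx : x ∈ idealSpan b) :
    ∃ (n : ℕ) (y z : Fin n → A), ∑ i, y i * b * z i = x := by
  obtain ⟨n, f, g, hfg⟩ := Submodule.mem_span_set'.1 hx
  choose y z hyz using fun i => (g i).2
  refine ⟨n, fun i => f i • y i, z, ?_⟩
  rw [← hfg]
  refine Finset.sum_congr rfl fun i _ => ?_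
  rw [smul_mul_assoc, smul_mul_assoc, hyz]

/-- An element of the ideal at distance less than `1` from the unit is invertible. This turns
topological simplicity into an algebraic statement. -/
theorem one_mem_idealSpan_of_closure {b : A} (h : (1 : A) ∈ closure (idealSpan b : Set A)) :
    (1 : A) ∈ idealSpan b := by
  obtain ⟨u, hu, hd⟩ := Metric.mem_closure_iff.1 h 1 one_pos
  rw [dist_eq_norm] at hd
  have hunit := isUnit_one_sub_of_norm_lt_one hd
  rw [sub_sub_cancel] at hunit
  obtain ⟨v, hv⟩ := hunit
  have := mul_mem_idealSpan hu (↑v⁻¹ : A) 1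
  rwa [← hv, Units.inv_mul, mul_one] at this

theorem IsSimpleCStar.isFullAlg (h : IsSimpleCStar A) : IsFullAlg A := by
  intro b hb
  obtain ⟨_, h⟩ := h
  refine one_mem_idealSpan_of_closure ?_
  let J := (idealSpan b).topologicalClosure
  have hmul : ∀ u v x : A, x ∈ J → u * x * v ∈ J := fun u v x hx =>
    map_mem_closure (f := fun x => u * x * v) (by fun_prop) hx fun y hy => mul_mem_idealSpan hy u v
  let I : TwoSidedIdeal A := .mk' (J : Set A) J.zero_mem J.add_mem J.neg_mem
    (fun {x y} hy => by simpa using hmul x 1 y hy) (fun {x y} hx => by simpa using hmul 1 y x hx)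
  have hI : (I : Set A) = J := by
    ext x
    exact TwoSidedIdeal.mem_mk' _ _ _ _ _ _ _
  have hbI : b ∈ (I : Set A) := by
    rw [hI]
    exact subset_closure (Submodule.subset_span ⟨1, 1, by simp⟩)
  rcases h I (by rw [hI]; exact isClosed_closure) with h | h
  · rw [h] at hbI
    exact absurd ((TwoSidedIdeal.mem_bot A).1 hbI) hb
  · have : (1 : A) ∈ (I : Set A) := by rw [h]; trivial
    rw [hI] at this
    exact this

/-- Writing `1 = ∑ y q z` expands `p` as `∑ (p y q) z`, so some `p y q` is nonzero. -/
theorem IsFullAlg.isPrimeAlg (h : IsFullAlg A) : IsPrimeAlg A := by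
  intro p q hp hq
  by_contra! hz
  obtain ⟨n, y, z, hyz⟩ := exists_sum_of_mem_idealSpan (h q hq)
  apply hp
  calc p = p * ∑ i, y i * q * z i := by rw [hyz, mul_one]
    _ = ∑ i, (p * y i * q) * z i := by
      rw [Finset.mul_sum]
      simp only [mul_assoc]
    _ = 0 := Finset.sum_eq_zero fun i _ => by rw [hz, zero_mul]

/-- Inserting `1 = ∑ y a z` on both sides of `x` puts each inner factor in `aAa`, hence in `ℂa`. So
the finitely many `y i * a * z j` span. -/
theorem IsFullAlg.finiteDimensional (h : IsFullAlg A) {a : A} (ha : IsMinimalElt a) :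
    FiniteDimensional ℂ A := by
  obtain ⟨n, y, z, hyz⟩ := exists_sum_of_mem_idealSpan (h a ha.1)
  refine Module.finite_def.2 (Submodule.fg_def.2
    ⟨Set.range fun p : Fin n × Fin n => y p.1 * a * z p.2, Set.finite_range _, ?_⟩)
  refine eq_top_iff.2 fun x _ => ?_
  have hx : x = ∑ i, ∑ j, y i * (a * (z i * x * y j) * a) * z j := by
    calc x = (∑ i, y i * a * z i) * x * ∑ j, y j * a * z j := by rw [hyz, one_mul, mul_one]
      _ = _ := by
        rw [Finset.sum_mul, Finset.sum_mul]
        refine Finset.sum_congr rfl fun i _ => ?_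
        rw [Finset.mul_sum]
        simp only [mul_assoc]
  rw [hx]
  refine sum_mem fun i _ => sum_mem fun j _ => ?_
  obtain ⟨c, hc⟩ := ha.2 (z i * x * y j)
  rw [hc, mul_smul_comm, smul_mul_assoc]
  exact Submodule.smul_mem _ _ (Submodule.subset_span ⟨(i, j), rfl⟩)

/-- In a finite C⋆-algebra right invertible elements are left cancellable. -/
theorem eq_zero_of_mul_eq_zero (hfin : ∀ v : A, star v * v = 1 → v * star v = 1) {w v x : A}
    (hwv : ‖w * v - 1‖ < 1) (hx : w * x = 0) : x = 0 := by
  have hu : IsUnit (w * v) := by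
    rw [norm_sub_rev] at hwv
    have := isUnit_one_sub_of_norm_lt_one hwv
    rwa [sub_sub_cancel] at this
  obtain ⟨u, hu⟩ := hu
  -- `w` has a right inverse, so `w w*` is invertible
  set r := v * (↑u⁻¹ : A) with hr
  have hwr : w * r = 1 := by rw [hr, ← mul_assoc, ← hu, Units.mul_inv]
  have hrw : star r * star w = 1 := by rw [← star_mul, hwr, star_one]
  -- Conjugate `r r* ≤ ‖r‖²` by `w` and use `w r = 1`.
  have hle : (1 : A) ≤ (‖r‖ ^ 2) • (w * star w) := by
    have h1 : r * star r ≤ algebraMap ℝ A (‖r‖ ^ 2) := CStarAlgebra.mul_star_le_algebraMap_norm_sq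
    have h2 := star_right_conjugate_le_conjugate h1 w
    have e1 : w * (r * star r) * star w = 1 := by
      calc _ = (w * r) * (star r * star w) := by simp only [mul_assoc]
        _ = 1 := by rw [hwr, hrw, mul_one]
    rw [e1, Algebra.algebraMap_eq_smul_one, mul_smul_comm, mul_one, smul_mul_assoc] at h2
    exact h2
  set c := ‖r‖ ^ 2 • (w * star w) with hc
  have h1 : (0 : A) ≤ 1 := by simp
  have hsp : IsStrictlyPositive c :=
    IsStrictlyPositive.of_le (IsStrictlyPositive.iff_of_unital.2 ⟨h1, isUnit_one⟩) hle
  set s := c ^ (-(1 / 2) : ℝ) with hs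
  have hss : star s = s := (CFC.rpow_nonneg (a := c)).isSelfAdjoint.star_eq
  have hscs : s * c * s = 1 := CFC.conjugate_rpow_neg_one_half c hsp
  -- Polar decomposition of `w*`: this element is an isometry because `s c s = 1`. By finiteness it
  -- is a unitary, so `1` ends in a factor `w` on the right, and `w x = 0` gives `x = 0`.
  have h2 := hfin (‖r‖ • (star w * s)) (by
    rw [star_smul, star_trivial ‖r‖, smul_mul_smul_comm, ← sq, star_mul, star_star, hss, ← hscs, hc,
      mul_smul_comm, smul_mul_assoc]
    simp only [mul_assoc])
  rw [star_smul, star_trivial ‖r‖, smul_mul_smul_comm, star_mul, star_star, hss] at h2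
  calc x = (‖r‖ * ‖r‖) • (star w * s * (s * w)) * x := by rw [h2, one_mul]
    _ = (‖r‖ * ‖r‖) • (star w * s * s * (w * x)) := by
      rw [smul_mul_assoc]; simp only [mul_assoc]
    _ = 0 := by rw [hx, mul_zero, smul_zero]

/-- If minimal elements of the unital `B` were small in the finite algebra `A`, then `A` could not
contain many orthogonal elements. -/
theorem not_exists_small (hfin : ∀ v : A, star v * v = 1 → v * star v = 1)
    (hmin : ∀ p : A, 0 ≤ p → ¬ IsMinimalElt p) [Nontrivial A] {q : A} {n : ℕ} (y z : Fin n → A)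
    (hyz : ∑ i, y i * q * z i = 1)
    (hq : ∀ x : A, 0 ≤ x → x ≠ 0 → q ∈ closure {c | ∃ r r' : A, r * x * r' = c}) : False := by
  have h1 : (0 : A) ≤ 1 := by simp
  -- One orthogonal element more than the number of terms in the expansion of the unit: `b 0` is the
  -- spare one.
  obtain ⟨b, hb, hb0, hbb⟩ := exists_orthogonal_family hmin n h1 one_ne_zero
  simp only [one_mul, mul_one] at hb hb0 hbb
  have hsq : ∀ i, 0 ≤ b i * b i := fun i => by
    have := star_mul_self_nonneg (b i)
    rwa [(hb i).isSelfAdjoint.star_eq] at this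
  have hsq0 : ∀ i, b i * b i ≠ 0 := fun i h => hb0 i <| by
    rw [← CStarRing.star_mul_self_eq_zero_iff, (hb i).isSelfAdjoint.star_eq, h]
  have hcont : Continuous fun p : Fin n → A => ∑ i, y i * p i * z i := by fun_prop
  obtain ⟨δ, hδ, hlt⟩ := Metric.continuous_iff.1 hcont (fun _ => q) 1 one_pos
  have hex : ∀ i : Fin n, ∃ r r' : A, dist q (r * (b i.succ * b i.succ) * r') < δ := fun i => by
    obtain ⟨c, ⟨r, r', rfl⟩, hc⟩ := Metric.mem_closure_iff.1 (hq _ (hsq i.succ) (hsq0 i.succ)) δ hδ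
    exact ⟨r, r', hc⟩
  choose r r' hr using hex
  have h2 := hlt (fun i => r i * (b i.succ * b i.succ) * r' i)
    ((dist_pi_lt_iff hδ).2 fun i => by rw [dist_comm]; exact hr i)
  rw [hyz, dist_eq_norm] at h2
  -- Orthogonality removes the cross terms of the product, which therefore approximates `∑ y q z =
  -- 1`; the left factor kills the spare `b 0`.
  refine hb0 0 (eq_zero_of_mul_eq_zero hfin (w := ∑ i, y i * r i * b i.succ)
    (v := ∑ i : Fin n, b i.succ * r' i * z i) ?_ ?_)
  · have e : (∑ i, y i * r i * b i.succ) * ∑ i : Fin n, b i.succ * r' i * z i =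
        ∑ i, y i * (r i * (b i.succ * b i.succ) * r' i) * z i := by
      rw [Finset.sum_mul]
      refine Finset.sum_congr rfl fun i _ => ?_
      rw [Finset.mul_sum, Finset.sum_eq_single i]
      · simp only [mul_assoc]
      · intro j _ hj
        calc y i * r i * b i.succ * (b j.succ * r' j * z j)
            = y i * r i * (b i.succ * b j.succ) * (r' j * z j) := by simp only [mul_assoc]
          _ = 0 := by
            rw [hbb _ _ fun h => hj (Fin.succ_injective _ h).symm, mul_zero, zero_mul]
      · simp
    rw [e]
    exact h2
  · rw [Finset.sum_mul]
    exact Finset.sum_eq_zero fun i _ => by rw [mul_assoc, hbb _ _ (Fin.succ_ne_zero i), mul_zero]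

end Simple

/-! ### Primeness and absence of minimal elements in the stabilization -/

section StabSimple

variable {A : Type*} [CStarAlgebra A]

open Stab

/-- Nonzero elements have nonzero diagonal corners of `p*p` and `q q*`. Primeness of `A` joins these
corners, and matrix units carry the joining element back. -/
theorem isPrimeAlg_stab (h : IsPrimeAlg A) : IsPrimeAlg (Stab A) := by
  have key : ∀ p : Stab A, p ≠ 0 → ∃ i a, a ≠ 0 ∧
      single 0 i 1 * (star p * p) * single i 0 1 = single 0 0 a := by
    intro p hp
    obtain ⟨i, hi⟩ := exists_mul_single_ne_zero hp
    obtain ⟨a, ha⟩ := exists_corner i i (star p * p)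
    refine ⟨i, a, ?_, ha⟩
    rintro rfl
    apply hi
    rw [← CStarRing.star_mul_self_eq_zero_iff, star_mul, star_single, star_one, ← single_zero 0 0,
      ← ha]
    simp only [mul_assoc]
  intro p q hp hq
  obtain ⟨i, a, ha, hia⟩ := key p hp
  obtain ⟨j, b, hb, hjb⟩ := key (star q) (star_ne_zero.2 hq)
  obtain ⟨c, hc⟩ := h a b ha hb
  refine ⟨single i 0 1 * single 0 0 c * single 0 j 1, fun hz => hc ?_⟩
  apply single_injective 0 0
  rw [single_zero, ← single_mul_single 0 0 0, ← single_mul_single 0 0 0, ← hia, ← hjb, star_star]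
  calc _ = single 0 i 1 * star p * (p * (single i 0 1 * single 0 0 c * single 0 j 1) * q) *
        star q * single j 0 1 := by simp only [mul_assoc]
    _ = 0 := by rw [hz]; simp

/-- A nonzero diagonal entry of a minimal positive element is minimal in `A`; such an entry exists
because some column of `√p` is nonzero. -/
theorem not_isMinimalElt_stab (h : ∀ p : A, ¬ IsMinimalElt p) (p : Stab A) (hp : 0 ≤ p) :
    ¬ IsMinimalElt p := by
  rintro ⟨hp0, hmin⟩
  set s := CFC.sqrt p with hs
  have hss : star s = s := (CFC.sqrt_nonneg p).isSelfAdjoint.star_eq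
  have hsp : s * s = p := CFC.sqrt_mul_sqrt_self p
  have hs0 : s ≠ 0 := fun h => hp0 (by rw [← hsp, h, mul_zero])
  obtain ⟨i, hi⟩ := exists_mul_single_ne_zero hs0
  obtain ⟨a, ha⟩ := exists_corner i i p
  refine h a ⟨?_, fun x => ?_⟩
  · rintro rfl
    apply hi
    rw [← CStarRing.star_mul_self_eq_zero_iff, star_mul, star_single, star_one, ← single_zero 0 0,
      ← ha, ← hsp, hss]
    simp only [mul_assoc]
  · obtain ⟨c, hc⟩ := hmin (single i 0 1 * single 0 0 x * single 0 i 1)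
    refine ⟨c, single_injective 0 0 ?_⟩
    rw [single_smul, ← single_mul_single 0 0 0, ← single_mul_single 0 0 0, ← ha]
    calc _ = single 0 i 1 * (p * (single i 0 1 * single 0 0 x * single 0 i 1) * p) *
          single i 0 1 := by simp only [mul_assoc]
      _ = _ := by rw [hc, mul_smul_comm, smul_mul_assoc]

end StabSimple

/-! ### Dividing and splitting classes in the Cuntz semigroup -/

section CuSplitting

variable {A : Type*} [CStarAlgebra A]

namespace Cu

theorem sum_mk_le {n : ℕ} {x : Stab A} (hx : 0 ≤ x) (y : Fin n → Stab A) (hy : ∀ i, 0 ≤ y i)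
    (hyy : ∀ i j, i ≠ j → y i * y j = 0) (hxy : ∀ i, CuntzSubeq x (y i)) :
    n • mk x hx ≤ mk (∑ i, y i) (Finset.sum_nonneg fun i _ => hy i) := by
  induction n with
  | zero => rw [zero_nsmul]; exact zero_le _
  | succ n ih =>
    have h1 := ih (fun i => y i.castSucc) (fun i => hy _)
      (fun i j hij => hyy _ _ fun h => hij (Fin.castSucc_injective _ h)) fun i => hxy _
    have h2 : mk x hx ≤ mk (y (Fin.last n)) (hy _) := mk_le_mk.2 (hxy _)
    have h0 : (∑ i : Fin n, y i.castSucc) * y (Fin.last n) = 0 := by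
      rw [Finset.sum_mul]
      exact Finset.sum_eq_zero fun i _ => hyy _ _ (Fin.castSucc_lt_last i).ne
    have h3 := add_le_mk (Finset.sum_nonneg fun i _ => hy (Fin.castSucc i)) (hy (Fin.last n)) h0
    rw [succ_nsmul]
    refine (add_le_add h1 h2).trans (h3.trans ?_)
    rw [mk_le_mk, Fin.sum_univ_castSucc]
    exact .refl (add_nonneg (Finset.sum_nonneg fun i _ => hy _) (hy _))

/-- The hypotheses on `A` under which nonzero elements of `Cu(A)` can be divided. -/
def Divisible (A : Type*) [CStarAlgebra A] : Prop := IsPrimeAlg A ∧ ∀ p : A, ¬ IsMinimalElt p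

/-- `exists_splitting` in semigroup terms: `η` gives up the nonzero part `w`, and the remainder `ζ`
misses `η'` by at most `x`, which fits `n` times into `ζ`. -/
theorem exists_split (hA : Divisible A) {η η' : Cu A} (h : WayBelow η' η) (hη : η ≠ 0) (n : ℕ) :
    ∃ ζ x w : Cu A, w ≠ 0 ∧ ζ + w ≤ η ∧ η' ≤ ζ + x ∧ w ≤ x ∧ n • x ≤ ζ := by
  obtain ⟨h, hh, ε, hε, rfl, hη'⟩ := h
  obtain ⟨s, x, w, hs, hx, hw, hw0, hsw, h1, h2, h3, y, hy, hyy, hxy, hys⟩ :=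
    exists_splitting (isPrimeAlg_stab hA.1) (not_isMinimalElt_stab hA.2) hh
      (fun h0 => hη (mk_eq_zero_iff.2 h0)) hε n
  refine ⟨mk s hs, mk x hx, mk w hw, fun h0 => hw0 (mk_eq_zero_iff.1 h0),
    (add_le_mk hs hw hsw).trans (mk_le_mk.2 h1),
    hη'.trans ((mk_le_mk.2 h2).trans (mk_add_le hs hx)), mk_le_mk.2 h3, ?_⟩
  have hyn : ∀ i, 0 ≤ y i * y i := fun i => by
    have := star_mul_self_nonneg (y i)
    rwa [(hy i).isSelfAdjoint.star_eq] at this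
  refine (sum_mk_le hx (fun i => y i * y i) hyn (fun i j hij => ?_) hxy).trans (mk_le_mk.2 hys)
  calc y i * y i * (y j * y j) = y i * (y i * y j) * y j := by simp only [mul_assoc]
    _ = 0 := by rw [hyy i j hij, mul_zero, zero_mul]

theorem exists_divide (hA : Divisible A) {η : Cu A} (hη : η ≠ 0) (n : ℕ) :
    ∃ w : Cu A, w ≠ 0 ∧ n • w ≤ η := by
  obtain ⟨ζ, x, w, hw, h1, -, h2, h3⟩ := exists_split hA (wayBelow_zero η) hη n
  exact ⟨w, hw, (nsmul_le_nsmul_right h2 n).trans (h3.trans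
    ((le_add_of_nonneg_right (zero_le w)).trans h1))⟩

theorem eq_zero_of_le_zero {ξ : Cu A} (h : ξ ≤ 0) : ξ = 0 := le_antisymm h (zero_le ξ)

theorem _root_.CuntzCu.StablyBelow.ne_zero {ξ η : Cu A} (h : StablyBelow ξ η) (hξ : ξ ≠ 0) :
    η ≠ 0 := by
  rintro rfl
  obtain ⟨k, -, hk⟩ := h
  rw [smul_zero, succ_nsmul] at hk
  exact hξ (eq_zero_of_le_zero ((le_add_of_nonneg_left (nsmul_nonneg (zero_le ξ) k)).trans hk))

/-- The source of room on the right: `η` sheds a nonzero `w`, yet the strict inequality for a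
cut-down of `ξ` persists with a larger multiplier. -/
theorem exists_split_of_stablyBelow (hA : Divisible A) {ξ ξ' η : Cu A} (h : StablyBelow ξ η)
    (h' : WayBelow ξ' ξ) (hη : η ≠ 0) : ∃ ζ w : Cu A, w ≠ 0 ∧ ζ + w ≤ η ∧ StablyBelow ξ' ζ := by
  obtain ⟨k, hk, hle⟩ := h
  obtain ⟨η', h1, h2⟩ := ((h'.nsmul (k + 1)).trans_le hle).exists_nsmul
  -- Doubling `(k + 1)ξ' ≤ kη'` gives `(2k + 2)ξ' ≤ 2kζ + 2kx`, and `2kx ≤ ζ` turns the right side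
  -- into `(2k + 1)ζ`.
  obtain ⟨ζ, x, w, hw, h3, h4, -, h5⟩ := exists_split hA h1 hη (2 * k)
  refine ⟨ζ, w, hw, h3, 2 * k + 1, by omega, ?_⟩
  calc (2 * k + 1 + 1) • ξ' = 2 • ((k + 1) • ξ') := by rw [← mul_nsmul']; congr 1
    _ ≤ 2 • (k • η') := nsmul_le_nsmul_right h2 2
    _ ≤ 2 • (k • (ζ + x)) := nsmul_le_nsmul_right (nsmul_le_nsmul_right h4 k) 2
    _ = (2 * k) • ζ + (2 * k) • x := by rw [← mul_nsmul', nsmul_add]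
    _ ≤ (2 * k) • ζ + ζ := by gcongr
    _ = _ := (succ_nsmul ζ (2 * k)).symm

end Cu

end CuSplitting

/-! ### Maps of Cuntz semigroups induced by injective homomorphisms -/

section Functoriality

variable {D A : Type*} [CStarAlgebra D] [CStarAlgebra A] (φ : D →⋆ₙₐ[ℂ] A)

/-- Functional calculus gives `φ(|a|) = |φ(a)| = φ(a)`, and injectivity gives `a = |a|`. -/
theorem nonneg_of_map_nonneg {E F : Type*} [NonUnitalCStarAlgebra E] [NonUnitalCStarAlgebra F]
    (φ : E →⋆ₙₐ[ℂ] F) (hφ : Function.Injective φ) {a : E} (h : 0 ≤ φ a) : 0 ≤ a := by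
  have hsa : IsSelfAdjoint a := hφ (by rw [map_star]; exact h.isSelfAdjoint.star_eq)
  have habs : Vanishing fun t => |t| := ⟨continuous_abs, abs_zero⟩
  have e : φ (cfcₙ (fun t : ℝ => |t|) a) = φ a := by
    rw [NonUnitalStarAlgHom.map_cfcₙ φ _ _ habs.1.continuousOn habs.2
      (continuous_starHom φ) hsa (hsa.map φ), cfcₙ_congr_nonneg h fun t ht => abs_of_nonneg ht,
      cfcₙ_self h]
  rw [← hφ e]
  exact cfcₙ_nonneg fun t _ => abs_nonneg t

namespace FinMat

/-- Applying a homomorphism to the entries of a matrix. -/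
def map (M : FinMat D) : FinMat A :=
  mk (fun i j => φ (M.entry i j)) <| by
    obtain ⟨n, hn⟩ := M.exists_suppLE
    exact ⟨n, fun i j h => by rw [hn i j h, map_zero]⟩

theorem entry_map (M : FinMat D) (i j : ℕ) : (map φ M).entry i j = φ (M.entry i j) := rfl

theorem map_zero' : map φ (0 : FinMat D) = 0 := ext' fun i j => by simp [entry_map]

theorem map_add' (M N : FinMat D) : map φ (M + N) = map φ M + map φ N :=
  ext' fun i j => by simp [entry_map]

theorem map_smul' (c : ℂ) (M : FinMat D) : map φ (c • M) = c • map φ M :=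
  ext' fun i j => by simp [entry_map]

theorem map_star' (M : FinMat D) : map φ (star M) = star (map φ M) :=
  ext' fun i j => by rw [entry_map, entry_star, entry_star, entry_map, map_star]

theorem SuppLE.map {n : ℕ} {M : FinMat D} (hM : SuppLE n M) : SuppLE n (map φ M) :=
  fun i j h => by rw [entry_map, hM i j h, map_zero]

theorem map_mul' (M N : FinMat D) : map φ (M * N) = map φ M * map φ N := by
  obtain ⟨n, hn⟩ := M.exists_suppLE
  refine ext' fun i j => ?_
  rw [entry_map, entry_mul, entry_mul, finsum_eq hn, finsum_eq (hn.map φ), map_sum]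
  simp only [map_mul, entry_map]

/-- Entrywise application is an injective ⋆-homomorphism of matrix algebras, hence isometric; this
is what allows the extension to the completion. -/
theorem norm_map (hφ : Function.Injective φ) (M : FinMat D) : ‖map φ M‖ = ‖M‖ := by
  obtain ⟨n, hn⟩ := M.exists_suppLE
  rw [norm_eq hn, norm_eq (hn.map φ)]
  refine NonUnitalStarAlgHom.norm_map (CStarMatrix.mapₙₐ (n := Fin n) φ) ?_ (trunc n M)
  intro x y hxy
  ext i j
  exact hφ (congrFun (congrFun hxy i) j)

theorem map_reindex (σ : ℕ ↪ ℕ) (M : FinMat D) : map φ (reindex σ M) = reindex σ (map φ M) :=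
  (reindex_ext σ (fun i j => by rw [entry_map, entry_reindex, entry_map])
    (fun i j h => by rw [entry_map, entry_reindex_left _ _ h, map_zero])
    (fun i j h => by rw [entry_map, entry_reindex_right _ _ _ h, map_zero])).symm

theorem map_single (i j : ℕ) (a : D) : map φ (single i j a) = single i j (φ a) :=
  ext' fun k l => by
    rw [entry_map, entry_single, entry_single]
    split_ifs <;> simp

theorem map_diag (n : ℕ) (a : D) : map φ (diag n a) = diag n (φ a) :=
  ext' fun k l => by
    rw [entry_map, entry_diag, entry_diag]
    split_ifs <;> simp

theorem uniformContinuous_map (hφ : Function.Injective φ) :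
    UniformContinuous (map φ : FinMat D → FinMat A) :=
  AddMonoidHomClass.uniformContinuous_of_bound
    (⟨⟨map φ, map_zero' φ⟩, map_add' φ⟩ : FinMat D →+ FinMat A) 1
    fun M => by rw [one_mul]; exact (norm_map φ hφ M).le

end FinMat

namespace Stab

theorem continuous_completionMap : Continuous
    (Completion.map (FinMat.map φ) : Completion (FinMat D) → Completion (FinMat A)) :=
  Completion.continuous_map

/-- The map `φ ⊗ id` between stabilizations. -/
def mapFun : Stab D → Stab A := Completion.map (FinMat.map φ)

theorem continuous_mapFun : Continuous (mapFun φ) := continuous_completionMap φ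

variable {φ} in
theorem mapFun_of (hφ : Function.Injective φ) (M : FinMat D) :
    mapFun φ (of M) = of (M.map φ) :=
  Completion.map_coe (FinMat.uniformContinuous_map φ hφ) M

variable {φ} in
/-- The ⋆-homomorphism `φ ⊗ id` for injective `φ`. -/
def map (hφ : Function.Injective φ) : Stab D →⋆ₙₐ[ℂ] Stab A where
  toFun := mapFun φ
  map_smul' c x := by
    have := continuous_mapFun φ
    induction x using ind with
    | hc => exact isClosed_eq (by fun_prop) (by simp only [MonoidHom.id_apply]; fun_prop)
    | h M =>
      rw [← of_smul, mapFun_of hφ, mapFun_of hφ, FinMat.map_smul', of_smul]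
      rfl
  map_zero' := by rw [← of_zero, mapFun_of hφ, FinMat.map_zero']; rfl
  map_add' x y := by
    have := continuous_mapFun φ
    induction x, y using ind₂ with
    | hc => exact isClosed_eq (by fun_prop) (by fun_prop)
    | h M N =>
      rw [← of_add, mapFun_of hφ, mapFun_of hφ, mapFun_of hφ, FinMat.map_add', of_add]
  map_mul' x y := by
    have := continuous_mapFun φ
    induction x, y using ind₂ with
    | hc => exact isClosed_eq (by fun_prop) (by fun_prop)
    | h M N =>
      rw [← of_mul, mapFun_of hφ, mapFun_of hφ, mapFun_of hφ, FinMat.map_mul', of_mul]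
  map_star' x := by
    have := continuous_mapFun φ
    induction x using ind with
    | hc => exact isClosed_eq (by fun_prop) (by fun_prop)
    | h M => rw [← of_star, mapFun_of hφ, mapFun_of hφ, FinMat.map_star', of_star]

variable {φ} (hφ : Function.Injective φ)

theorem map_of (M : FinMat D) : map hφ (of M) = of (M.map φ) := mapFun_of hφ M

theorem norm_map (x : Stab D) : ‖map hφ x‖ = ‖x‖ := by
  have := continuous_starHom (map hφ)
  induction x using ind with
  | hc => exact isClosed_eq (by fun_prop) (by fun_prop)
  | h M => rw [map_of, norm_of, norm_of, FinMat.norm_map φ hφ]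

theorem map_single (i j : ℕ) (a : D) : map hφ (single i j a) = single i j (φ a) := by
  rw [single, map_of, FinMat.map_single]; rfl

theorem map_diagHom (n : ℕ) (a : D) : map hφ (diagHom n a) = diagHom n (φ a) := by
  rw [diagHom_apply, map_of, FinMat.map_diag]; rfl

theorem map_reindex (σ : ℕ ↪ ℕ) (x : Stab D) :
    map hφ (reindex σ x) = reindex σ (map hφ x) := by
  have := continuous_starHom (map hφ)
  induction x using ind with
  | hc => exact isClosed_eq (by fun_prop) (by fun_prop)
  | h M => rw [← of_reindex, map_of, map_of, FinMat.map_reindex, of_reindex]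

end Stab

namespace Cu

variable {φ} (hφ : Function.Injective φ)

/-- The map between Cuntz semigroups induced by an injective homomorphism. -/
def map : Cu D →+ Cu A where
  toFun := Quotient.map (fun a => ⟨Stab.map hφ a.1, map_nonneg_starHom _ a.2⟩)
    fun _ _ h => ⟨CuntzSubeq.map (Stab.map hφ) h.1, CuntzSubeq.map (Stab.map hφ) h.2⟩
  map_zero' := congrArg cls (Subtype.ext (map_zero (Stab.map hφ)))
  map_add' ξ η := by
    obtain ⟨a, rfl⟩ := exists_cls ξ
    obtain ⟨b, rfl⟩ := exists_cls η
    refine congrArg cls (Subtype.ext ?_)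
    show Stab.map hφ (Stab.reindex PosStab.even a.1 + Stab.reindex PosStab.odd b.1) =
      Stab.reindex PosStab.even (Stab.map hφ a.1) + Stab.reindex PosStab.odd (Stab.map hφ b.1)
    rw [_root_.map_add, Stab.map_reindex, Stab.map_reindex]

theorem map_mk {x : Stab D} (hx : 0 ≤ x) :
    map hφ (mk x hx) = mk (Stab.map hφ x) (map_nonneg_starHom _ hx) := rfl

theorem map_mono {ξ η : Cu D} (h : ξ ≤ η) : map hφ ξ ≤ map hφ η := by
  obtain ⟨x, hx, rfl⟩ := exists_mk ξ
  obtain ⟨y, hy, rfl⟩ := exists_mk η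
  exact mk_le_mk.2 (CuntzSubeq.map (Stab.map hφ) (mk_le_mk.1 h))

theorem map_mk_cut {x : Stab D} (hx : 0 ≤ x) {ε : ℝ} (hε : 0 ≤ ε) :
    map hφ (mk (cut x ε) (cut_nonneg ε)) = mk (cut (Stab.map hφ x) ε) (cut_nonneg ε) :=
  congrArg cls (Subtype.ext (map_cut (Stab.map hφ) hx hε))

theorem WayBelow.map {ξ' ξ : Cu D} (h : WayBelow ξ' ξ) : WayBelow (map hφ ξ') (map hφ ξ) := by
  obtain ⟨x, hx, ε, hε, rfl, h1⟩ := h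
  refine ⟨_, _, ε, hε, (map_mk hφ hx).symm, ?_⟩
  rw [← map_mk_cut hφ hx hε.le]
  exact map_mono hφ h1

/-- Cut-downs of the image are images of cut-downs. -/
theorem WayBelow.exists_map {β : Cu A} {ξ : Cu D} (h : WayBelow β (Cu.map hφ ξ)) :
    ∃ ξ', WayBelow ξ' ξ ∧ β ≤ Cu.map hφ ξ' := by
  obtain ⟨x, hx, rfl⟩ := exists_mk ξ
  obtain ⟨δ, hδ, h1⟩ := h.exists_cut (map_mk hφ hx).le
  exact ⟨_, wayBelow_cut hx hδ, by rwa [map_mk_cut hφ hx hδ.le]⟩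

end Cu

end Functoriality

/-! ### Large subalgebras as injective homomorphisms -/

variable {D A : Type*} [CStarAlgebra D] [CStarAlgebra A] {φ : D →⋆ₙₐ[ℂ] A}

/-- An injective unital homomorphism with large range. -/
structure IsLargeHom (φ : D →⋆ₙₐ[ℂ] A) : Prop where
  inj : Function.Injective φ
  one : φ 1 = 1
  exists_fin : ∀ (m : ℕ) (a : Fin m → A) (ε : ℝ), 0 < ε → ∀ x : A, 0 ≤ x → ‖x‖ = 1 →
    ∀ y : D, 0 ≤ y → y ≠ 0 → ∃ (c : Fin m → A) (t : Fin m → D) (g : D), 0 ≤ g ∧ g ≤ 1 ∧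
      (∀ j, ‖c j - a j‖ < ε) ∧ (∀ j, φ (t j) = φ (1 - g) * c j) ∧
      CuntzSubeq g y ∧ CuntzSubeq (φ g) x ∧ 1 - ε < ‖φ (1 - g) * x * φ (1 - g)‖

theorem le_one_of_map_le_one (hφ : Function.Injective φ) (hφ1 : φ 1 = 1) {g : D} (h : φ g ≤ 1) :
    g ≤ 1 :=
  sub_nonneg.1 (nonneg_of_map_nonneg φ hφ (by rw [map_sub, hφ1]; exact sub_nonneg.2 h))

/-- Treats `B` as an algebra in its own right, with its own order; injectivity of the inclusion
carries positivity back from `A`. -/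
theorem IsLarge.isLargeHom {B : StarSubalgebra ℂ A} [IsClosed (B : Set A)] (hB : IsLarge B) :
    IsLargeHom (B.subtype : B →⋆ₙₐ[ℂ] A) where
  inj := Subtype.val_injective
  one := rfl
  exists_fin m a ε hε x hx hx1 y hy hy0 := by
    have hinj : Function.Injective (B.subtype : B →⋆ₙₐ[ℂ] A) := Subtype.val_injective
    obtain ⟨c, g, h0, h1, hc, ht, hgy, hgx, hn⟩ :=
      hB m a ε hε x hx hx1 y (map_nonneg_starHom (B.subtype : B →⋆ₙₐ[ℂ] A) hy) hy0
    refine ⟨c, fun j => ⟨_, ht j⟩, g, nonneg_of_map_nonneg _ hinj h0,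
      le_one_of_map_le_one hinj rfl h1, hc, fun j => rfl, hgy, hgx, hn⟩

theorem norm_one_sub_le {g : D} (h0 : 0 ≤ g) (h1 : g ≤ 1) : ‖1 - g‖ ≤ 1 :=
  (CStarAlgebra.norm_le_one_iff_of_nonneg _ (sub_nonneg.2 h1)).2 (sub_le_self _ h0)

namespace IsLargeHom

variable (h : IsLargeHom φ)
include h

theorem norm_map (x : D) : ‖φ x‖ = ‖x‖ := NonUnitalStarAlgHom.norm_map φ h.inj x

theorem map_ne_zero {x : D} (hx : x ≠ 0) : φ x ≠ 0 := fun e => hx (h.inj (by rw [e, map_zero]))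

theorem map_one_sub (g : D) : φ (1 - g) = 1 - φ g := by rw [map_sub, h.one]

/-- Closeness is restated as membership in a neighbourhood, so that any open condition on the whole
tuple can be imposed directly. -/
theorem exists_approx {κ : Type*} [Fintype κ] {a : κ → A} {s : Set (κ → A)} (hs : s ∈ 𝓝 a) {ε : ℝ}
    (hε : 0 < ε) {x : A} (hx : 0 ≤ x) (hx1 : ‖x‖ = 1) {y : D} (hy : 0 ≤ y) (hy0 : y ≠ 0) :
    ∃ (c : κ → A) (t : κ → D) (g : D), 0 ≤ g ∧ g ≤ 1 ∧ c ∈ s ∧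
      (∀ j, φ (t j) = φ (1 - g) * c j) ∧ CuntzSubeq g y ∧ CuntzSubeq (φ g) x ∧
      1 - ε < ‖φ (1 - g) * x * φ (1 - g)‖ := by
  obtain ⟨δ, hδ, hball⟩ := Metric.mem_nhds_iff.1 hs
  let e := Fintype.equivFin κ
  obtain ⟨c, t, g, h0, h1, hc, ht, hgy, hgx, hn⟩ :=
    h.exists_fin _ (a ∘ e.symm) (min δ ε) (lt_min hδ hε) x hx hx1 y hy hy0
  refine ⟨c ∘ e, t ∘ e, g, h0, h1, hball ?_, fun j => ht _, hgy, hgx, ?_⟩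
  · rw [Metric.mem_ball, dist_pi_lt_iff hδ]
    intro k
    have := hc (e k)
    rw [Function.comp_apply, e.symm_apply_apply] at this
    rw [dist_eq_norm]
    exact this.trans_le (min_le_left _ _)
  · linarith [min_le_right δ ε]

theorem nontrivial [Nontrivial A] : Nontrivial D :=
  ⟨1, 0, fun e => one_ne_zero (by rw [← h.one, e, map_zero] : (1 : A) = 0)⟩

/-- Approximate `√x` by `c` with `(1 - g)c = φ(t)`. Then `t t*` maps close to `(1 - g)x(1 - g)`,
which lies below `x` and has norm near `1`, so a fixed cut-down of `t t*` is nonzero and below `x`.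
-/
theorem exists_subeq {x : A} (hx : 0 ≤ x) (hx0 : x ≠ 0) :
    ∃ b : D, 0 ≤ b ∧ b ≠ 0 ∧ CuntzSubeq (φ b) x := by
  have : Nontrivial A := ⟨x, 0, hx0⟩
  have := h.nontrivial
  wlog hx1 : ‖x‖ = 1 generalizing x
  · have hn : 0 < ‖x‖ := norm_pos_iff.2 hx0
    obtain ⟨b, hb, hb0, hbx⟩ := this (x := ‖x‖⁻¹ • x) (smul_nonneg (by positivity) hx)
      (smul_ne_zero (by positivity) hx0) (by rw [norm_smul, norm_inv, norm_norm]; field_simp)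
    exact ⟨b, hb, hb0, hbx.trans (cuntzSubeq_smul hx (by positivity))⟩
  set s := CFC.sqrt x with hs
  have hss : s * star s = x := by
    rw [(CFC.sqrt_nonneg x).isSelfAdjoint.star_eq, CFC.sqrt_mul_sqrt_self x hx]
  have hF : Continuous fun c : Fin 1 → A => c 0 * star (c 0) := by fun_prop
  have hnh : {c : Fin 1 → A | ‖c 0 * star (c 0) - x‖ < 1 / 4} ∈ 𝓝 fun _ => s := by
    refine (isOpen_lt (f := fun c : Fin 1 → A => ‖c 0 * star (c 0) - x‖) (by fun_prop)
      continuous_const).mem_nhds ?_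
    simp [hss]
  obtain ⟨c, t, g, h0, h1, hc, ht, -, -, hn⟩ :=
    h.exists_approx hnh (ε := 1 / 4) (by norm_num) hx hx1 zero_le_one one_ne_zero
  have hg : star (φ (1 - g)) = φ (1 - g) :=
    (map_nonneg_starHom φ (sub_nonneg.2 h1)).isSelfAdjoint.star_eq
  have hgn : ‖φ (1 - g)‖ ≤ 1 := (h.norm_map _).trans_le (norm_one_sub_le h0 h1)
  have hb0 : 0 ≤ t 0 * star (t 0) := mul_star_self_nonneg _
  have e : φ (t 0 * star (t 0)) = φ (1 - g) * (c 0 * star (c 0)) * φ (1 - g) := by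
    rw [map_mul, map_star, ht, star_mul, hg]
    noncomm_ring
  have hd : ‖φ (t 0 * star (t 0)) - φ (1 - g) * x * φ (1 - g)‖ < 1 / 4 := by
    rw [e, ← sub_mul, ← mul_sub]
    refine lt_of_le_of_lt ?_ hc
    calc _ ≤ ‖φ (1 - g)‖ * ‖c 0 * star (c 0) - x‖ * ‖φ (1 - g)‖ := norm_mul₃_le
      _ ≤ 1 * ‖c 0 * star (c 0) - x‖ * 1 := by gcongr
      _ = _ := by ring
  have hxg : CuntzSubeq (φ (1 - g) * x * φ (1 - g)) x := by
    have := cuntzSubeq_conj x (φ (1 - g))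
    rwa [hg] at this
  have hxg0 : 0 ≤ φ (1 - g) * x * φ (1 - g) := by
    have := star_left_conjugate_nonneg hx (φ (1 - g))
    rwa [hg] at this
  -- The compression has norm above `3/4` and `φ(t t*)` differs from it by less than `1/4`, so its
  -- norm exceeds `1/2` and the cut by `1/4` survives.
  refine ⟨cut (t 0 * star (t 0)) (1 / 4), cut_nonneg _, fun h0 => ?_, ?_⟩
  · have h2 := norm_sub_cut_le hb0 (ε := 1 / 4) (by norm_num)
    rw [h0, sub_zero, ← h.norm_map] at h2
    have h3 := norm_sub_norm_le (φ (1 - g) * x * φ (1 - g)) (φ (t 0 * star (t 0)))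
    rw [norm_sub_rev] at h3
    linarith
  · rw [map_cut φ hb0 (by norm_num)]
    exact (cut_subeq_of_norm_lt (map_nonneg_starHom φ hb0) hxg0 hd).trans hxg

/-- An expansion `1 = ∑ y p z` in `A`, compressed by `1 - g` on both sides, puts `(1 - g)²` close to
the ideal generated by `p` in `D`. The complement `1 - (1 - g)² = g(2 - g)` lies in its closure
because `g ≾ p`. -/
theorem isFullAlg [Nontrivial A] (hA : IsFullAlg A) : IsFullAlg D := by
  intro b hb
  set p := star b * b with hp
  have hp0 : 0 ≤ p := star_mul_self_nonneg b
  have hpne : p ≠ 0 := fun e => hb (CStarRing.star_mul_self_eq_zero_iff b |>.1 e)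
  suffices hp1 : (1 : D) ∈ idealSpan p by
    refine Submodule.span_mono ?_ hp1
    rintro _ ⟨y, z, rfl⟩
    exact ⟨y * star b, z, by rw [hp]; noncomm_ring⟩
  refine one_mem_idealSpan_of_closure ?_
  obtain ⟨n, y, z, hyz⟩ := exists_sum_of_mem_idealSpan (hA (φ p) (h.map_ne_zero hpne))
  rw [← Submodule.topologicalClosure_coe, ← (Submodule.isClosed_topologicalClosure _).closure_eq,
    Metric.mem_closure_iff]
  intro r hr
  -- The right factors enter through their adjoints, because largeness multiplies by `1 - g` only
  -- from the left.
  let F : (Fin n ⊕ Fin n → A) → A := fun c => ∑ i, c (.inl i) * φ p * star (c (.inr i))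
  have hnh : {c | ‖F c - 1‖ < r} ∈ 𝓝 (Sum.elim y (star z)) := by
    refine (isOpen_lt (f := fun c => ‖F c - 1‖) (by fun_prop) continuous_const).mem_nhds ?_
    simpa [F, hyz] using hr
  obtain ⟨c, t, g, h0, h1, hc, ht, hgy, -, -⟩ :=
    h.exists_approx hnh (ε := 1) one_pos (x := 1) zero_le_one norm_one hp0 hpne
  have hg : star (φ (1 - g)) = φ (1 - g) :=
    (map_nonneg_starHom φ (sub_nonneg.2 h1)).isSelfAdjoint.star_eq
  have hgn : ‖φ (1 - g)‖ ≤ 1 := (h.norm_map _).trans_le (norm_one_sub_le h0 h1)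
  have hgmem : g ∈ (idealSpan p).topologicalClosure := by
    obtain ⟨v, hv⟩ := hgy
    exact mem_closure_of_tendsto hv (.of_forall fun k => Submodule.subset_span ⟨_, _, rfl⟩)
  have hg2 : g * (2 - g) ∈ (idealSpan p).topologicalClosure :=
    map_mem_closure (f := fun x => x * (2 - g)) (by fun_prop) hgmem fun x hx => by
      simpa using mul_mem_idealSpan hx 1 (2 - g)
  refine ⟨∑ i, t (.inl i) * p * star (t (.inr i)) + g * (2 - g),
    add_mem (sum_mem fun i _ => Submodule.le_topologicalClosure _
      (Submodule.subset_span ⟨_, _, rfl⟩)) hg2, ?_⟩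
  rw [dist_comm, dist_eq_norm, ← h.norm_map]
  have e : φ (∑ i, t (.inl i) * p * star (t (.inr i)) + g * (2 - g) - 1) =
      φ (1 - g) * (F c - 1) * φ (1 - g) := by
    have e1 : g * (2 - g) - 1 = - ((1 - g) * (1 - g)) := by noncomm_ring
    rw [add_sub_assoc, e1, map_add, map_neg, map_mul, map_sum, mul_sub, sub_mul, mul_one,
      ← sub_eq_add_neg, Finset.mul_sum, Finset.sum_mul]
    refine congrArg₂ _ (Finset.sum_congr rfl fun i _ => ?_) rfl
    rw [map_mul, map_mul, map_star, ht, ht, star_mul, hg]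
    noncomm_ring
  rw [e]
  refine lt_of_le_of_lt ?_ hc
  calc _ ≤ ‖φ (1 - g)‖ * ‖F c - 1‖ * ‖φ (1 - g)‖ := norm_mul₃_le
    _ ≤ 1 * ‖F c - 1‖ * 1 := by gcongr
    _ = _ := by ring

/-- A minimal `q` of `D` factors through any nonzero `b` in `D`, and every nonzero positive `x` of
`A` dominates such a `b`. So `φ(q)` is a limit of products `r x r'`, which `not_exists_small`
excludes. -/
theorem divisible [Nontrivial A] (hA : IsFullAlg A) (hmin : ∀ p : A, ¬ IsMinimalElt p)
    (hfin : ∀ v : A, star v * v = 1 → v * star v = 1) : Cu.Divisible D := by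
  have hD := h.isFullAlg hA
  refine ⟨hD.isPrimeAlg, fun q hq => ?_⟩
  obtain ⟨n, y, z, hyz⟩ := exists_sum_of_mem_idealSpan (hD q hq.1)
  refine not_exists_small hfin (fun p _ => hmin p) (q := φ q) (fun i => φ (y i))
    (fun i => φ (z i)) ?_ fun x hx hx0 => ?_
  · simp only [← map_mul, ← map_sum, hyz, h.one]
  · obtain ⟨b, hb, hb0, v, hv⟩ := h.exists_subeq hx hx0
    obtain ⟨u, hu⟩ := hD.isPrimeAlg q b hq.1 hb0
    -- Primeness twice makes `q u b w q` nonzero; by minimality it is a nonzero multiple of `q`.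
    obtain ⟨w, hw⟩ := hD.isPrimeAlg (q * u * b) q hu hq.1
    obtain ⟨c, hc⟩ := hq.2 (u * b * w)
    have hc0 : c ≠ 0 := by
      rintro rfl
      apply hw
      rw [zero_smul] at hc
      rw [← hc]; noncomm_ring
    have e : φ q = c⁻¹ • (φ (q * u) * φ b * φ (w * q)) := by
      rw [← map_mul, ← map_mul, ← map_smul, show q * u * b * (w * q) = c • q by
        rw [← hc]; noncomm_ring, smul_smul, inv_mul_cancel₀ hc0, one_smul]
    rw [e]
    refine map_mem_closure (f := fun s => c⁻¹ • (φ (q * u) * s * φ (w * q))) (by fun_prop)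
      (mem_closure_of_tendsto hv (.of_forall fun k => Set.mem_range_self k)) ?_
    rintro _ ⟨k, rfl⟩
    exact ⟨c⁻¹ • (φ (q * u) * v k), star (v k) * φ (w * q), by
      simp only [smul_mul_assoc, mul_assoc]⟩

end IsLargeHom

/-! ### Approximation by finite matrices and the compression inequality -/

section Approximation

variable {A : Type*} [CStarAlgebra A]

open Stab

theorem Stab.exists_of_mul_star {a : Stab A} (ha : 0 ≤ a) {δ : ℝ} (hδ : 0 < δ) :
    ∃ M : FinMat A, ‖a - of M * star (of M)‖ < δ := by
  have ho : IsOpen {x : Stab A | ‖a - x * star x‖ < δ} :=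
    isOpen_lt (by fun_prop) continuous_const
  refine denseRange_of.exists_mem_open ho ⟨CFC.sqrt a, ?_⟩
  simpa [(CFC.sqrt_nonneg a).isSelfAdjoint.star_eq, CFC.sqrt_mul_sqrt_self a ha] using hδ

theorem Stab.diagHom_mul_single {n i : ℕ} (hi : i < n) (j : ℕ) (a b : A) :
    diagHom n a * single i j b = single i j (a * b) := by
  rw [diagHom_apply, single, single, ← of_mul]
  refine congrArg of (FinMat.ext' fun k l => ?_)
  rw [FinMat.entry_diag_mul, FinMat.entry_single, FinMat.entry_single]
  by_cases hk : k = i ∧ l = j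
  · simp [hk, hi]
  · simp [hk]

theorem Stab.singleHom_apply (i : ℕ) (a : A) : singleHom i a = single i i a := rfl

theorem CuntzSubeq.single {a b : A} (h : CuntzSubeq a b) (i : ℕ) :
    CuntzSubeq (Stab.single i i a) (Stab.single i i b) := by
  have h' := CuntzSubeq.map (singleHom i) h
  rw [singleHom_apply, singleHom_apply] at h'
  exact h'

theorem Stab.mul_star_mul_diagHom_one {n : ℕ} {M : FinMat A} (hM : M.SuppLE n) :
    of M * star (of M) * diagHom n 1 = of M * star (of M) := by
  have e : diagHom n 1 * of M = of M := by
    rw [diagHom_apply, ← of_mul, FinMat.diag_one_mul hM]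
  have e' := congrArg star e
  rw [star_mul, ← map_star, star_one] at e'
  rw [mul_assoc, e']

/-- Fixes the tolerance required by `cut_subeq_of_compress` before the approximant `b` of `a` is
chosen. -/
theorem exists_radius {E : Type*} [NonUnitalCStarAlgebra E] (a : E) {ε : ℝ} (hε : 0 < ε) :
    ∃ r : ℝ, 0 < r ∧ r ≤ ε ∧ ∀ b : E, ‖a - b‖ < r → 2 * r * ‖b‖ ^ 2 < ε ^ 3 / 2 := by
  have h3 : 0 < ε ^ 3 := by positivity
  have hN : 0 < (‖a‖ + 1) ^ 2 := by positivity
  have hr : 0 < min ε (min 1 (ε ^ 3 / (8 * (‖a‖ + 1) ^ 2))) :=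
    lt_min hε (lt_min one_pos (by positivity))
  refine ⟨_, hr, min_le_left _ _, fun b hb => ?_⟩
  set r := min ε (min 1 (ε ^ 3 / (8 * (‖a‖ + 1) ^ 2)))
  have h1 : r ≤ 1 := (min_le_right _ _).trans (min_le_left _ _)
  have h2 : r ≤ ε ^ 3 / (8 * (‖a‖ + 1) ^ 2) := (min_le_right _ _).trans (min_le_right _ _)
  have hb1 : ‖b‖ ≤ ‖a‖ + 1 := by
    have := norm_sub_norm_le b a
    rw [norm_sub_rev] at this
    linarith
  rw [le_div_iff₀ (by positivity)] at h2
  calc 2 * r * ‖b‖ ^ 2 ≤ 2 * r * (‖a‖ + 1) ^ 2 := by gcongr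
    _ < ε ^ 3 / 2 := by nlinarith

namespace Cu

/-- A nonzero column of `x` gives a nonzero diagonal entry of `x²`. Largeness then applies, since it
only controls `g` against elements of the algebra itself. -/
theorem exists_single_le {w : Cu A} (hw : w ≠ 0) :
    ∃ (y : A) (hy : 0 ≤ y), y ≠ 0 ∧ mk (single 0 0 y) (single_nonneg 0 hy) ≤ w := by
  obtain ⟨x, hx, rfl⟩ := exists_mk w
  obtain ⟨i, hi⟩ := exists_mul_single_ne_zero fun e => hw (mk_eq_zero_iff.2 e)
  obtain ⟨a, ha⟩ := exists_corner (A := A) i i (x * x)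
  have e : star (x * single i 0 1) * (x * single i 0 1) = single 0 0 a := by
    rw [← ha, star_mul, star_single, hx.isSelfAdjoint.star_eq, star_one]
    noncomm_ring
  have ha0 : 0 ≤ a := nonneg_of_map_nonneg (singleHom 0) (single_injective 0 0) <| by
    show 0 ≤ single 0 0 a
    rw [← e]
    exact star_mul_self_nonneg _
  refine ⟨a, ha0, ?_, mk_le_mk.2 ?_⟩
  · rintro rfl
    rw [single_zero] at e
    exact hi ((CStarRing.star_mul_self_eq_zero_iff _).1 e)
  · have := cuntzSubeq_conj (x * x) (single 0 i (1 : A))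
    rw [star_single, star_one, ha] at this
    exact this.trans (cuntzSubeq_mul_self hx)

/-- The price of compressing by `1 - g`: the term `2 ata` lies below `t`, and `2 agaga` lies below
the diagonal copy of `g`, hence below `n⟨g⟩`. -/
theorem mk_cut_le_of_compress {a t : Stab A} (ha : 0 ≤ a) (ht : 0 ≤ t) {n : ℕ}
    (hn : a * diagHom n 1 = a) {g : A} (hg : 0 ≤ g) {ε r : ℝ} (hε : 0 < ε)
    (hr : ‖diagHom n (1 - g) * a * diagHom n (1 - g) - t‖ ≤ r)
    (hrε : 2 * r * ‖a‖ ^ 2 < ε ^ 3 / 2) :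
    mk (cut a ε) (cut_nonneg ε) ≤ mk t ht + n • mk (single 0 0 g) (single_nonneg 0 hg) := by
  have hsa := ha.isSelfAdjoint.star_eq
  have hG : 0 ≤ diagHom n g := diagHom_nonneg n hg
  have hGs := hG.isSelfAdjoint.star_eq
  have hhs : star (diagHom n (1 - g)) = diagHom n (1 - g) := by
    rw [← map_star, star_sub, star_one, hg.isSelfAdjoint.star_eq]
  have key := cut_subeq_of_compress ha ht hhs hGs
    (by rw [← map_add, sub_add_cancel, hn]) hε hr hrε
  have h1 : 0 ≤ a * t * a := by
    have := star_left_conjugate_nonneg ht a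
    rwa [hsa] at this
  have h2 : 0 ≤ diagHom n g * a * diagHom n g := by
    have := star_left_conjugate_nonneg ha (diagHom n g)
    rwa [hGs] at this
  have e3 : a * diagHom n g * a * diagHom n g * a =
      a * (diagHom n g * a * diagHom n g) * a := by noncomm_ring
  have h3 : 0 ≤ a * diagHom n g * a * diagHom n g * a := by
    have := star_left_conjugate_nonneg h2 a
    rwa [hsa, ← e3] at this
  have h4 : CuntzSubeq ((2 : ℝ) • (a * t * a)) t := by
    have := cuntzSubeq_conj t a
    rw [hsa] at this
    exact (cuntzSubeq_smul h1 two_pos.le).trans this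
  have h5 : CuntzSubeq ((2 : ℝ) • (a * diagHom n g * a * diagHom n g * a)) (diagHom n g) := by
    have h6 := cuntzSubeq_conj (diagHom n g * a * diagHom n g) a
    rw [hsa, ← e3] at h6
    have h7 := CStarAlgebra.star_left_conjugate_le_norm_smul (a := diagHom n g) (b := a)
      ha.isSelfAdjoint
    rw [hGs] at h7
    have h8 : 0 ≤ diagHom n g * diagHom n g := by
      have := star_mul_self_nonneg (diagHom n g)
      rwa [hGs] at this
    exact (cuntzSubeq_smul h3 two_pos.le).trans (h6.trans
      ((CuntzSubeq.of_le_smul h2 h8 (norm_nonneg a) h7).trans (cuntzSubeq_mul_self hG)))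
  have h6 : 0 ≤ (2 : ℝ) • (a * t * a) := smul_nonneg two_pos.le h1
  have h7 : 0 ≤ (2 : ℝ) • (a * diagHom n g * a * diagHom n g * a) := smul_nonneg two_pos.le h3
  have h8 : mk (cut a ε) (cut_nonneg ε) ≤ mk _ (add_nonneg h6 h7) := mk_le_mk.2 key
  have h9 : mk _ h6 ≤ mk t ht := mk_le_mk.2 h4
  have h10 : mk _ h7 ≤ mk (diagHom n g) hG := mk_le_mk.2 h5
  exact h8.trans ((mk_add_le h6 h7).trans
    (add_le_add h9 (h10.trans (mk_diagHom_le n hg))))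

end Cu

end Approximation

/-! ### Passing between the Cuntz semigroups of a large subalgebra and the algebra -/

section Comparison

variable {D A : Type*} [CStarAlgebra D] [CStarAlgebra A] {φ : D →⋆ₙₐ[ℂ] A}

namespace IsLargeHom

open Stab

variable (h : IsLargeHom φ)

include h in
-- Largeness applied to all entries of an `n × n` matrix at once, with one common `g`. As `g` is
-- repeated `n` times on the diagonal, it is chosen below an `n`-th part of `w`.
theorem exists_approx_stab [Nontrivial A] (hD : Cu.Divisible D) {w : Cu D} (hw : w ≠ 0) {n : ℕ}
    {M : FinMat A} (hM : M.SuppLE n) {s : Set (Stab A)} (hs : s ∈ 𝓝 (of M)) :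
    ∃ C ∈ s, ∃ (T : Stab D) (g : D) (hg : 0 ≤ g), g ≤ 1 ∧
      Stab.map h.inj T = diagHom n (φ (1 - g)) * C ∧
      n • Cu.mk (single 0 0 g) (single_nonneg 0 hg) ≤ w := by
  obtain ⟨w', hw', hle⟩ := Cu.exists_divide hD hw n
  obtain ⟨y, hy, hy0, hyw⟩ := Cu.exists_single_le hw'
  obtain ⟨Φ, hΦ, hΦM, hΦc⟩ : ∃ Φ : (Fin n × Fin n → A) → Stab A, Continuous Φ ∧
      Φ (fun p => M.entry p.1 p.2) = of M ∧
      ∀ c, Φ c = ∑ i : Fin n, ∑ j : Fin n, single i j (c (i, j)) := by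
    refine ⟨_, ?_, (of_eq_sum hM).symm, fun c => rfl⟩
    refine continuous_finsetSum _ fun i _ => continuous_finsetSum _ fun j _ => ?_
    exact (continuous_single (A := A) i j).comp (continuous_apply (i, j))
  rw [← hΦM] at hs
  have hs' := hΦ.continuousAt.preimage_mem_nhds hs
  obtain ⟨c, t, g, h0, h1, hc, ht, hgy, -, -⟩ := h.exists_approx hs'
    (ε := 1) one_pos (x := 1) zero_le_one norm_one hy hy0
  have hgw := (nsmul_le_nsmul_right ((Cu.mk_le_mk (hx := single_nonneg 0 h0)
    (hy := single_nonneg 0 hy)).2 (hgy.single 0)) n).trans ((nsmul_le_nsmul_right hyw n).trans hle)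
  refine ⟨Φ c, hc, ∑ i : Fin n, ∑ j : Fin n, single i j (t (i, j)), g, h0, h1, ?_, hgw⟩
  simp only [hΦc, map_sum, map_single, ht, Finset.mul_sum]
  exact Finset.sum_congr rfl fun i _ => Finset.sum_congr rfl fun j _ =>
    (diagHom_mul_single i.2 _ _ _).symm

theorem norm_compress_le {n : ℕ} {g : D} (h0 : 0 ≤ g) (h1 : g ≤ 1) (x : Stab A) :
    ‖diagHom n (φ (1 - g)) * x * diagHom n (φ (1 - g))‖ ≤ ‖x‖ := by
  have hn : ‖diagHom n (φ (1 - g))‖ ≤ 1 := (norm_diagHom_le _ _).trans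
    ((NonUnitalStarAlgHom.norm_apply_le φ _).trans (norm_one_sub_le h0 h1))
  calc _ ≤ ‖diagHom n (φ (1 - g))‖ * ‖x‖ * ‖diagHom n (φ (1 - g))‖ := norm_mul₃_le
    _ ≤ 1 * ‖x‖ * 1 := by gcongr
    _ = _ := by ring

theorem star_compress {n : ℕ} {g : D} (h0 : 0 ≤ g) :
    star (diagHom n (φ (1 - g))) = diagHom n (φ (1 - g)) := by
  rw [← map_star, ← map_star, star_sub, star_one, h0.isSelfAdjoint.star_eq]

/-- If `C` in `A ⊗ K` satisfies `C b C* ≈ a`, then compressing by `1 - g` replaces `C` by `T` over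
`D` with `T b T* ≈ (1 - g)a(1 - g)`. The compression inequality then bounds a cut-down of `a` by
`⟨b⟩ + n⟨g⟩` inside `D`. -/
theorem le_add_of_map_le [Nontrivial A] (hD : Cu.Divisible D) {ξ ξ' η w : Cu D}
    (hle : Cu.map h.inj ξ ≤ Cu.map h.inj η) (hξ : Cu.WayBelow ξ' ξ) (hw : w ≠ 0) :
    ξ' ≤ η + w := by
  obtain ⟨a, ha, rfl⟩ := Cu.exists_mk ξ
  obtain ⟨b, hb, rfl⟩ := Cu.exists_mk η
  obtain ⟨ε, hε, hξ'⟩ := hξ.exists_cut le_rfl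
  have hab : CuntzSubeq (Stab.map h.inj a) (Stab.map h.inj b) := hle
  obtain ⟨r, hr, hrε, hrr⟩ := exists_radius a (half_pos hε)
  obtain ⟨a₁, ha₁0, hd, n₁, hn₁⟩ : ∃ a₁ : Stab D, 0 ≤ a₁ ∧ ‖a - a₁‖ < r / 2 ∧
      ∃ n₁, ∀ n, n₁ ≤ n → a₁ * diagHom n 1 = a₁ := by
    obtain ⟨d, hd⟩ := exists_of_mul_star ha (half_pos hr)
    obtain ⟨n₁, hn₁⟩ := d.exists_suppLE
    exact ⟨_, mul_star_self_nonneg _, hd, n₁, fun n hn => mul_star_mul_diagHom_one (hn₁.mono hn)⟩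
  have ho : IsOpen {C : Stab A | ‖Stab.map h.inj a₁ - C * Stab.map h.inj b * star C‖ < r} :=
    isOpen_lt (by fun_prop) continuous_const
  obtain ⟨M, hM⟩ : ∃ M : FinMat A, of M ∈
      {C : Stab A | ‖Stab.map h.inj a₁ - C * Stab.map h.inj b * star C‖ < r} := by
    obtain ⟨v, hv⟩ := cuntzSubeq_iff.1 hab (r / 2) (half_pos hr)
    refine denseRange_of.exists_mem_open ho ⟨v, ?_⟩
    have h1 : ‖Stab.map h.inj a₁ - Stab.map h.inj a‖ < r / 2 := by
      rw [← map_sub, Stab.norm_map, norm_sub_rev]; exact hd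
    rw [norm_sub_rev] at hv
    have := norm_sub_le_norm_sub_add_norm_sub (Stab.map h.inj a₁) (Stab.map h.inj a)
      (v * Stab.map h.inj b * star v)
    show _ < r
    linarith
  obtain ⟨n₂, hn₂⟩ := M.exists_suppLE
  -- One corner size serves both `a₁` and `M`: the compression inequality needs `a₁` to be supported
  -- in it, largeness needs `M`.
  obtain ⟨C, hC, T, g, h0, h1, hT, hgw⟩ := h.exists_approx_stab hD hw
    (hn₂.mono (le_max_right n₁ n₂)) (ho.mem_nhds hM)
  set n := max n₁ n₂
  have hcut := Cu.mk_cut_le_of_compress (t := T * b * star T) (n := n) (g := g) (r := r) ha₁0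
    (star_right_conjugate_nonneg hb T)
    (hn₁ n (le_max_left n₁ n₂)) h0 (half_pos hε) (by
      rw [← Stab.norm_map h.inj]
      have e : ∀ k : D, star k = k → Stab.map h.inj T = diagHom n (φ k) * C →
          Stab.map h.inj (diagHom n k * a₁ * diagHom n k - T * b * star T) = diagHom n (φ k) *
            (Stab.map h.inj a₁ - C * Stab.map h.inj b * star C) * diagHom n (φ k) := by
        intro k hk hT
        simp only [map_sub, map_mul, map_star, hT, map_diagHom, star_mul]
        rw [← map_star (diagHom n), ← map_star φ, hk]
        noncomm_ring
      rw [e _ (by rw [star_sub, star_one, h0.isSelfAdjoint.star_eq]) hT]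
      exact (norm_compress_le h0 h1 _).trans hC.le) (hrr _ (by linarith))
  calc ξ' ≤ _ := hξ'
    _ ≤ Cu.mk (cut a₁ (ε / 2)) (cut_nonneg _) := Cu.mk_le_mk.2 (by
      have := cut_add_subeq_cut ha ha₁0 (half_pos hε).le (δ := ε / 2) (by linarith)
      rwa [add_halves] at this)
    _ ≤ _ := hcut
    _ ≤ _ := add_le_add (Cu.mk_le_mk.2 (cuntzSubeq_conj b T)) hgw

/-- Write `a ≈ C C*` with `(1 - g)C` coming from `T` over `D`. Then `T T*` is close to `(1 - g)a(1 -
g)`, which lies below `a` and differs from it by at most `n⟨g⟩` in the Cuntz sense. -/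
theorem exists_le_map_add [Nontrivial A] (hD : Cu.Divisible D) {ξ ξ' : Cu A} {w : Cu D}
    (hξ : Cu.WayBelow ξ' ξ) (hw : w ≠ 0) :
    ∃ β : Cu D, Cu.map h.inj β ≤ ξ ∧ ξ' ≤ Cu.map h.inj β + Cu.map h.inj w := by
  obtain ⟨a, ha, rfl⟩ := Cu.exists_mk ξ
  obtain ⟨ε, hε, hξ'⟩ := hξ.exists_cut le_rfl
  obtain ⟨r, hr, hrε, hrr⟩ := exists_radius a (half_pos hε)
  obtain ⟨M, hM⟩ := exists_of_mul_star ha (half_pos hr)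
  set a₁ := of M * star (of M) with ha₁
  have ha₁0 : 0 ≤ a₁ := mul_star_self_nonneg _
  have ho : IsOpen {C : Stab A | ‖a₁ - C * star C‖ < r / 2 ∧ ‖a - C * star C‖ < r / 2} :=
    (isOpen_lt (f := fun C : Stab A => ‖a₁ - C * star C‖) (by fun_prop) continuous_const).inter
      (isOpen_lt (f := fun C : Stab A => ‖a - C * star C‖) (by fun_prop) continuous_const)
  obtain ⟨n, hn⟩ := M.exists_suppLE
  obtain ⟨C, hC, T, g, h0, h1, hT, hgw⟩ := h.exists_approx_stab hD hw hn
    (ho.mem_nhds ⟨by rw [← ha₁, sub_self, norm_zero]; exact half_pos hr, hM⟩)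
  set H := diagHom n (φ (1 - g)) with hH
  have hHs : star H = H := star_compress h0
  have ht0 : 0 ≤ T * star T := mul_star_self_nonneg T
  have eT : Stab.map h.inj (T * star T) = H * (C * star C) * H := by
    rw [map_mul, map_star, hT, star_mul, hHs]
    noncomm_ring
  have hιt := map_nonneg_starHom (Stab.map h.inj) ht0
  have hHa0 : 0 ≤ H * a * H := by
    have := star_left_conjugate_nonneg ha H
    rwa [hHs] at this
  -- The cut absorbs the error `r / 2` between `T T*` and the compression of `a`, giving an exact
  -- upper bound; the other half of `r` pays for this cut in the lower bound.
  refine ⟨Cu.mk (cut (T * star T) (r / 2)) (cut_nonneg _), ?_, ?_⟩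
  · rw [Cu.map_mk_cut h.inj ht0 (half_pos hr).le]
    refine Cu.mk_le_mk.2 ((cut_subeq_of_norm_lt hιt hHa0 ?_).trans ?_)
    · rw [eT, ← sub_mul, ← mul_sub]
      refine (norm_compress_le h0 h1 _).trans_lt ?_
      rw [norm_sub_rev]
      exact hC.2
    · have := cuntzSubeq_conj a H
      rwa [hHs] at this
  · have hφg : φ (1 - g) = 1 - φ g := h.map_one_sub g
    have hcut := Cu.mk_cut_le_of_compress (t := cut (Stab.map h.inj (T * star T)) (r / 2)) (n := n)
      (g := φ g) (r := r) ha₁0 (cut_nonneg _) (mul_star_mul_diagHom_one hn)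
      (map_nonneg_starHom φ h0) (half_pos hε) (by
        rw [← hφg, ← hH]
        have h2 : ‖H * a₁ * H - Stab.map h.inj (T * star T)‖ ≤ r / 2 := by
          rw [eT, ← sub_mul, ← mul_sub]
          exact (norm_compress_le h0 h1 _).trans hC.1.le
        have h3 := norm_sub_cut_le hιt (half_pos hr).le
        have := norm_sub_le_norm_sub_add_norm_sub (H * a₁ * H) (Stab.map h.inj (T * star T))
          (cut (Stab.map h.inj (T * star T)) (r / 2))
        linarith) (hrr _ (by linarith))
    rw [Cu.map_mk_cut h.inj ht0 (half_pos hr).le]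
    have hw' := Cu.map_mono h.inj hgw
    rw [map_nsmul, Cu.map_mk] at hw'
    simp only [Stab.map_single] at hw'
    calc ξ' ≤ _ := hξ'
      _ ≤ Cu.mk (cut a₁ (ε / 2)) (cut_nonneg _) := Cu.mk_le_mk.2 (by
        have := cut_add_subeq_cut ha ha₁0 (half_pos hε).le (δ := ε / 2) (by linarith)
        rwa [add_halves] at this)
      _ ≤ _ := hcut
      _ ≤ _ := add_le_add le_rfl hw'

/-- Room found in `Cu(A)` is converted into room in `Cu(D)`, where the error terms live. -/
theorem exists_map_le {w : Cu A} (hw : w ≠ 0) : ∃ z : Cu D, z ≠ 0 ∧ Cu.map h.inj z ≤ w := by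
  obtain ⟨y, hy, hy0, hyw⟩ := Cu.exists_single_le hw
  obtain ⟨b, hb, hb0, hby⟩ := h.exists_subeq hy hy0
  refine ⟨Cu.mk (single 0 0 b) (single_nonneg 0 hb), fun e => hb0 ?_, ?_⟩
  · exact single_injective 0 0 ((Cu.mk_eq_zero_iff.1 e).trans (single_zero 0 0).symm)
  · refine le_trans (Cu.mk_le_mk.2 ?_) hyw
    rw [Stab.map_single]
    exact hby.single 0

end IsLargeHom

end Comparison

/-! ### Transfer of comparison in both directions -/

section Transfer

variable {D A : Type*} [CStarAlgebra D] [CStarAlgebra A] {φ : D →⋆ₙₐ[ℂ] A}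

namespace IsLargeHom

variable (h : IsLargeHom φ) [Nontrivial A] {m : ℕ}
include h

/-- Each `η j` is first split in `Cu(D)` as `ζ j` plus a nonzero `w j`. Comparison in `A` bounds the
image of `ξ''` by that of `∑ ζ j`, and `w 0` pays for returning to `Cu(D)`. -/
theorem hasComparison_of_codomain (hD : Cu.Divisible D) (hA : HasComparison A m) :
    HasComparison D m := by
  intro ξ η hη
  refine Cu.le_of_wayBelow fun ξ' hξ' => ?_
  by_cases hξ : ξ = 0
  · rw [hξ] at hξ'
    exact hξ'.le.trans (Cu.zero_le _)
  obtain ⟨ξ'', h1, h2⟩ := hξ'.interpolate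
  choose ζ w hw hle hζ using fun j =>
    Cu.exists_split_of_stablyBelow hD (hη j) h2 ((hη j).ne_zero hξ)
  have key : Cu.map h.inj ξ'' ≤ Cu.map h.inj (∑ j, ζ j) := by
    rw [map_sum]
    refine hA _ _ fun j => ?_
    obtain ⟨k, hk, hkle⟩ := hζ j
    exact ⟨k, hk, by simpa only [map_nsmul] using Cu.map_mono h.inj hkle⟩
  calc ξ' ≤ ∑ j, ζ j + w 0 := h.le_add_of_map_le hD key h1 (hw 0)
    _ ≤ ∑ j, ζ j + ∑ j, w j := by
      gcongr
      exact Finset.single_le_sum (f := w) (fun j _ => Cu.zero_le _) (Finset.mem_univ 0)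
    _ = ∑ j, (ζ j + w j) := Finset.sum_add_distrib.symm
    _ ≤ ∑ j, η j := Finset.sum_le_sum fun j _ => hle j

/-- Replaces the upper element `ζ` of a strict inequality by some `τ` from `Cu(D)`, at the cost of
the small extra term `u`. -/
theorem exists_stablyBelow (hD : Cu.Divisible D) {β β' u : Cu D} {ξ ζ : Cu A}
    (hβ : Cu.map h.inj β ≤ ξ) (hβ' : Cu.WayBelow β' β) (hu : u ≠ 0) (hξ : StablyBelow ξ ζ) :
    ∃ τ : Cu D, Cu.map h.inj τ ≤ ζ ∧ StablyBelow β' (τ + u) := by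
  obtain ⟨k, hk, hle⟩ := hξ
  obtain ⟨β'', h1, h2⟩ := hβ'.interpolate
  obtain ⟨ζ', hζ', h3⟩ := (((h2.map h.inj).nsmul (k + 1)).trans_le
    ((nsmul_le_nsmul_right hβ (k + 1)).trans hle)).exists_nsmul
  -- The error `s` occurs `k` times from approximating `ζ'` and once more from descending to
  -- `Cu(D)`, hence `k + 1` parts of `u`.
  obtain ⟨s, hs, hsu⟩ := Cu.exists_divide hD hu (k + 1)
  obtain ⟨τ, hτ, h4⟩ := h.exists_le_map_add hD hζ' hs
  have h5 : Cu.map h.inj ((k + 1) • β'') ≤ Cu.map h.inj (k • (τ + s)) := by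
    rw [map_nsmul, map_nsmul, map_add]
    exact h3.trans (nsmul_le_nsmul_right h4 k)
  refine ⟨τ, hτ, k, hk, ?_⟩
  calc (k + 1) • β' ≤ k • (τ + s) + s := h.le_add_of_map_le hD h5 (h1.nsmul (k + 1)) hs
    _ = k • τ + (k + 1) • s := by rw [nsmul_add, add_assoc, succ_nsmul]
    _ ≤ k • τ + k • u := by
      refine add_le_add le_rfl (hsu.trans ?_)
      calc u = 1 • u := (one_nsmul u).symm
        _ ≤ k • u := nsmul_le_nsmul_left (Cu.zero_le u) hk
    _ = _ := (nsmul_add _ _ _).symm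

/-- Both sides are replaced by classes from `Cu(D)`: `β` below `ξ₁`, and `τ j` below the reduced `ζ
j`. Comparison in `D` is applied to a cut-down of `β`, and the errors fit into the parts `w j`
removed from `η j`. -/
theorem hasComparison_of_domain (hD : Cu.Divisible D) (hA : Cu.Divisible A)
    (hcomp : HasComparison D m) : HasComparison A m := by
  intro ξ η hη
  refine Cu.le_of_wayBelow fun ξ' hξ' => ?_
  by_cases hξ : ξ = 0
  · rw [hξ] at hξ'
    exact hξ'.le.trans (Cu.zero_le _)
  obtain ⟨ξ₁, h1, hξ₁⟩ := hξ'.interpolate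
  obtain ⟨ξ₂, h1, h2⟩ := h1.interpolate
  choose ζ w hw hle hζ using fun j =>
    Cu.exists_split_of_stablyBelow hA (hη j) hξ₁ ((hη j).ne_zero hξ)
  choose z hz hzw using fun j => h.exists_map_le (hw j)
  -- Two copies are needed: one `u j` makes `τ j` large enough for comparison, and `u 0` is used
  -- again in approximating `ξ₂` by `β`.
  choose u hu huz using fun j => Cu.exists_divide hD (hz j) 2
  obtain ⟨β, hβ, h3⟩ := h.exists_le_map_add hD h2 (hu 0)
  obtain ⟨γ₁, γ₂, hγ₁, hγ₂, h4⟩ := (h1.trans_le h3).exists_add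
  obtain ⟨β', hβ', h5⟩ := hγ₁.exists_map h.inj
  choose τ hτ hβτ using fun j => h.exists_stablyBelow hD hβ hβ' (hu j) (hζ j)
  have h6 := Cu.map_mono h.inj (hcomp _ _ hβτ)
  rw [map_sum] at h6
  calc ξ' ≤ γ₁ + γ₂ := h4
    _ ≤ ∑ j, Cu.map h.inj (τ j + u j) + Cu.map h.inj (u 0) := add_le_add (h5.trans h6) hγ₂.le
    _ ≤ ∑ j, Cu.map h.inj (τ j + u j) + ∑ j, Cu.map h.inj (u j) := by
      gcongr
      exact Finset.single_le_sum (f := fun j => Cu.map h.inj (u j)) (fun j _ => Cu.zero_le _)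
        (Finset.mem_univ 0)
    _ = ∑ j, (Cu.map h.inj (τ j) + Cu.map h.inj (2 • u j)) := by
      rw [← Finset.sum_add_distrib]
      refine Finset.sum_congr rfl fun j _ => ?_
      rw [map_add, two_nsmul, map_add, add_assoc]
    _ ≤ ∑ j, (ζ j + w j) := Finset.sum_le_sum fun j _ =>
      add_le_add (hτ j) ((Cu.map_mono h.inj (huz j)).trans (hzw j))
    _ ≤ ∑ j, η j := Finset.sum_le_sum fun j _ => hle j

end IsLargeHom

end Transfer

/-! ### Conclusion for simple infinite-dimensional stably finite algebras -/

section Finite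

variable {A : Type*} [CStarAlgebra A]

theorem IsStablyFiniteCStar.mul_star_eq_one (h : IsStablyFiniteCStar A) (v : A)
    (hv : star v * v = 1) : v * star v = 1 := by
  have e := h 1 (Matrix.of fun _ _ => v) (by
    ext i j
    simp [Matrix.mul_apply, Matrix.star_apply, hv, Matrix.one_apply, Subsingleton.elim i j])
  simpa [Matrix.mul_apply, Matrix.star_apply] using congrFun (congrFun e 0) 0

theorem IsLarge.hasComparison_iff (hsimple : IsSimpleCStar A) (hinf : ¬ FiniteDimensional ℂ A)
    (hfin : IsStablyFiniteCStar A) {B : StarSubalgebra ℂ A} [IsClosed (B : Set A)]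
    (hB : IsLarge B) (m : ℕ) : HasComparison B m ↔ HasComparison A m := by
  have := hsimple.1
  have hfull := hsimple.isFullAlg
  -- This is where infinite dimension enters: fullness with a minimal element would make `A`
  -- finite-dimensional.
  have hmin : ∀ p : A, ¬ IsMinimalElt p := fun p hp => hinf (hfull.finiteDimensional hp)
  have hφ := hB.isLargeHom
  have hD := hφ.divisible hfull hmin hfin.mul_star_eq_one
  exact ⟨hφ.hasComparison_of_domain hD ⟨hfull.isPrimeAlg, hmin⟩,
    hφ.hasComparison_of_codomain hD⟩

end Finite

end CuntzCu

end

theorem mainTheorem7 {A : Type*} [CStarAlgebra A] [TopologicalSpace.SeparableSpace A]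
    (hsimple : CuntzCu.IsSimpleCStar A) (hinf : ¬ FiniteDimensional ℂ A)
    (hfin : CuntzCu.IsStablyFiniteCStar A)
    (B : StarSubalgebra ℂ A) [IsClosed (B : Set A)] (hB : CuntzCu.IsLarge B) (m : ℕ) :
    CuntzCu.HasComparison B m ↔ CuntzCu.HasComparison A m :=
  hB.hasComparison_iff hsimple hinf hfin m
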